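/- Let $(V,g)$ be a smooth, time-oriented, four-dimensional Lorentzian manifold (signature $-,+,+,+$) on which $SO(3)$ acts by isometries, and let an advanced Eddington--Finkelstein chart be given: an open $SO(3)$-invariant set of $V$ covered by coordinates $(v,r,\text{angles})$, where $(v,r)$ ranges over an open set contained in $\{r>0\}$, the angles range over the whole unit sphere, $SO(3)$ acts by rotation of the angles, $v$ increases to the future, and $$ds^2=-e^{2\beta}\Big(1-\frac{2m(v,r)}{r}\Big)dv^2+2e^{\beta}\,dv\,dr+r^2d\Omega^2$$ with smooth functions $\beta(v,r)$, $m(v,r)$. Put $$\vec\ell=-e^{-\beta}\partial_r,\qquad \vec k=\partial_v+\tfrac12\Big(1-\frac{2m}{r}\Big)e^{\beta}\partial_r ,$$ let $G_{\mu\nu}$ be the Einstein tensor, let $\mathrm{AH}=\{r=2m(v,r)\}$ be the apparent 3-horizon and $\mathrm{AH}^{iso}=\{p\in\mathrm{AH}: G_{\mu\nu}k^\mu k^\nu|_p=0\}$ its isolated-horizon portion. For $p$ in the chart domain let $\varsigma_p$ be the round sphere (constant $v$ and $r$) through $p$. A closed surface is a compact connected embedded spacelike $C^3$ surface without boundary.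 Its mean curvature vector is $\vec H=\gamma^{AB}\vec K_{AB}$, where $\gamma_{AB}$ is the induced metric and $-\vec K_{AB}$ is the normal part of $\nabla_{\vec e_A}\vec e_B$. The surface is f-trapped (future-trapped) if $\vec H$ is timelike and future-pointing everywhere on it, and untrapped if $\vec H$ is spacelike everywhere on it. Let $\mathscr T$ be the set of points of $V$ that lie on some closed f-trapped surface, and let $\mathscr B=\partial\mathscr T$. A set crosses $\mathrm{AH}$ if it contains points of the chart domain with $r<2m$ and points of the chart domain with $r>2m$. 1. Let $p\in\mathrm{AH}$ with $G_{\mu\nu}k^\mu k^\nu|_p>0$. In every open neighbourhood of $\varsigma_p$ there are a closed f-trapped surface and a closed untrapped surface, both topological spheres, both containing $p$, and both crossing $\mathrm{AH}$. 2. Let $p\in\mathrm{AH}$ with $G_{\mu\nu}k^\mu k^\nu|_p>0$ and let $l\ge 1$ be an integer. There is a number $N\in\mathbb R$ such that the following holds with $\vec n=-\vec\ell+\frac N2\vec k$, the normal vector to $\varsigma_p$ with $k_\mu n^\mu=1$ and $n_\mu n^\mu=N$. Let $Y$ be a real spherical harmonic of degree $l$ and $a_0\neq0$ a constant such that $f=a_0+Y$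 takes both positive and negative values on the unit sphere. For all sufficiently small $\varepsilon>0$, the surface $\varsigma_\varepsilon$ obtained from $\varsigma_p$ by displacing each point by $\varepsilon f\vec n$ (in the coordinates $(v,x)$, where $x\in\mathbb R^3$ is $r$ times the unit vector of the angles) is a topological sphere that crosses $\mathrm{AH}$; it is a closed f-trapped surface if $a_0>0$ and a closed untrapped surface if $a_0<0$. 3. $\mathrm{AH}\setminus\mathrm{AH}^{iso}\subseteq\mathscr T$ and $(\mathrm{AH}\setminus\mathrm{AH}^{iso})\cap\mathscr B=\emptyset$. -/

import Mathlib

open scoped Manifold ContDiff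

noncomputable section

namespace SphTrapped

/-! ### Tensor calculus in a coordinate patch of `ℝ⁴` -/

/-- The `i`-th partial derivative of a real function on `ℝⁿ`. -/
def pd {n : ℕ} (i : Fin n) (F : (Fin n → ℝ) → ℝ) (x : Fin n → ℝ) : ℝ :=
  fderiv ℝ F x (Pi.single i 1)

/-- Metric components `g_{μν}` as functions of the coordinates. -/
abbrev Components := (Fin 4 → ℝ) → Matrix (Fin 4) (Fin 4) ℝ

/-- `Γ^ρ_{μν} = ½ g^{ρσ} (∂_μ g_{σν} + ∂_ν g_{σμ} - ∂_σ g_{μν})`. -/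
def christoffel (g : Components) (ρ μ ν : Fin 4) (y : Fin 4 → ℝ) : ℝ :=
  (1 / 2 : ℝ) * ∑ σ, (g y)⁻¹ ρ σ *
    (pd μ (fun z => g z σ ν) y + pd ν (fun z => g z σ μ) y - pd σ (fun z => g z μ ν) y)

/-- `R^ρ_{σμν} = ∂_μ Γ^ρ_{νσ} - ∂_ν Γ^ρ_{μσ} + Γ^ρ_{μλ} Γ^λ_{νσ} - Γ^ρ_{νλ} Γ^λ_{μσ}`. -/
def riemann (g : Components) (ρ σ μ ν : Fin 4) (y : Fin 4 → ℝ) : ℝ :=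
  pd μ (christoffel g ρ ν σ) y - pd ν (christoffel g ρ μ σ) y
    + ∑ κ, christoffel g ρ μ κ y * christoffel g κ ν σ y
    - ∑ κ, christoffel g ρ ν κ y * christoffel g κ μ σ y

/-- `R_{σν} = R^μ_{σμν}`. -/
def ricci (g : Components) (σ ν : Fin 4) (y : Fin 4 → ℝ) : ℝ :=
  ∑ μ, riemann g μ σ μ ν y

/-- `R = g^{σν} R_{σν}`. -/
def scalarCurvature (g : Components) (y : Fin 4 → ℝ) : ℝ :=
  ∑ σ, ∑ ν, (g y)⁻¹ σ ν * ricci g σ ν y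

/-- `G_{μν} = R_{μν} - ½ R g_{μν}`. -/
def einstein (g : Components) (μ ν : Fin 4) (y : Fin 4 → ℝ) : ℝ :=
  ricci g μ ν y - (1 / 2 : ℝ) * scalarCurvature g y * g y μ ν

/-- `g(u, w) = g_{μν} u^μ w^ν` at `y`. -/
def pair (g : Components) (y u w : Fin 4 → ℝ) : ℝ :=
  ∑ μ, ∑ ν, g y μ ν * u μ * w ν

/-! ### Parametrised surfaces in a coordinate patch -/

/-- The coordinate tangent vector `e_A = ∂Φ/∂λ^A`. -/
def tangentVec (Φ : (Fin 2 → ℝ) → (Fin 4 → ℝ)) (A : Fin 2) (l : Fin 2 → ℝ) : Fin 4 → ℝ :=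
  fun μ => pd A (fun l' => Φ l' μ) l

/-- The first fundamental form `γ_{AB} = g(e_A, e_B)`. -/
def firstForm (g : Components) (Φ : (Fin 2 → ℝ) → (Fin 4 → ℝ)) (l : Fin 2 → ℝ) :
    Matrix (Fin 2) (Fin 2) ℝ :=
  Matrix.of fun A B => pair g (Φ l) (tangentVec Φ A l) (tangentVec Φ B l)

/-- The components of `∇_{e_A} e_B`. -/
def covTangent (g : Components) (Φ : (Fin 2 → ℝ) → (Fin 4 → ℝ)) (A B : Fin 2)
    (l : Fin 2 → ℝ) : Fin 4 → ℝ :=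
  fun μ => pd A (fun l' => tangentVec Φ B l' μ) l
    + ∑ ν, ∑ ρ, christoffel g μ ν ρ (Φ l) * tangentVec Φ A l ν * tangentVec Φ B l ρ

/-- The shape tensor `K_{AB}`, with `∇_{e_A} e_B = (tangential part) - K_{AB}`. -/
def shapeTensor (g : Components) (Φ : (Fin 2 → ℝ) → (Fin 4 → ℝ)) (A B : Fin 2)
    (l : Fin 2 → ℝ) : Fin 4 → ℝ :=
  (∑ C, ∑ D, ((firstForm g Φ l)⁻¹ C D *
      pair g (Φ l) (covTangent g Φ A B l) (tangentVec Φ C l)) • tangentVec Φ D l)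
    - covTangent g Φ A B l

/-- The mean curvature vector `H = γ^{AB} K_{AB}`, in components. -/
def meanCurvature (g : Components) (Φ : (Fin 2 → ℝ) → (Fin 4 → ℝ)) (l : Fin 2 → ℝ) :
    Fin 4 → ℝ :=
  ∑ A, ∑ B, (firstForm g Φ l)⁻¹ A B • shapeTensor g Φ A B l

/-! ### Spacetimes -/

/-- A smooth, time-oriented, four-dimensional Lorentzian manifold of signature `(-,+,+,+)`. -/
structure Spacetime (V : Type*) [TopologicalSpace V] [ChartedSpace (Fin 4 → ℝ) V]
    [IsManifold 𝓘(ℝ, Fin 4 → ℝ) ∞ V] where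
  /-- the metric tensor -/
  metric (p : V) : TangentSpace 𝓘(ℝ, Fin 4 → ℝ) p →L[ℝ] TangentSpace 𝓘(ℝ, Fin 4 → ℝ) p →L[ℝ] ℝ
  symm (p : V) (u w : TangentSpace 𝓘(ℝ, Fin 4 → ℝ) p) : metric p u w = metric p w u
  signature (p : V) : ∃ u : TangentSpace 𝓘(ℝ, Fin 4 → ℝ) p, metric p u u < 0 ∧
    ∀ w : TangentSpace 𝓘(ℝ, Fin 4 → ℝ) p, w ≠ 0 → metric p u w = 0 → 0 < metric p w w
  smooth : ContMDiff 𝓘(ℝ, Fin 4 → ℝ)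
    (𝓘(ℝ, Fin 4 → ℝ).prod 𝓘(ℝ, (Fin 4 → ℝ) →L[ℝ] (Fin 4 → ℝ) →L[ℝ] ℝ)) ∞
    (fun p => Bundle.TotalSpace.mk' ((Fin 4 → ℝ) →L[ℝ] (Fin 4 → ℝ) →L[ℝ] ℝ)
      (E := fun q : V => TangentSpace 𝓘(ℝ, Fin 4 → ℝ) q →L[ℝ]
        TangentSpace 𝓘(ℝ, Fin 4 → ℝ) q →L[ℝ] ℝ) p (metric p))
  /-- a timelike vector field, which fixes the future -/
  time (p : V) : TangentSpace 𝓘(ℝ, Fin 4 → ℝ) p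
  time_timelike (p : V) : metric p (time p) (time p) < 0
  time_continuous : Continuous
    (fun p => (⟨p, time p⟩ : TangentBundle 𝓘(ℝ, Fin 4 → ℝ) V))

/-- The group `SO(3)`. -/
abbrev SO3 : Type := Matrix.specialOrthogonalGroup (Fin 3) ℝ

namespace Spacetime

variable {V : Type*} [TopologicalSpace V] [ChartedSpace (Fin 4 → ℝ) V]
  [IsManifold 𝓘(ℝ, Fin 4 → ℝ) ∞ V]

/-- A vector is timelike and future-pointing. -/
def IsFutureTimelike (M : Spacetime V) (p : V) (u : TangentSpace 𝓘(ℝ, Fin 4 → ℝ) p) : Prop :=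
  M.metric p u u < 0 ∧ M.metric p (M.time p) u < 0

/-- A vector is spacelike. -/
def IsSpacelike (M : Spacetime V) (p : V) (u : TangentSpace 𝓘(ℝ, Fin 4 → ℝ) p) : Prop :=
  0 < M.metric p u u

/-- The tangent vector of `V` at the point with coordinates `y` in the chart `e`
whose components in that chart are `u`. -/
def pushVec (e : OpenPartialHomeomorph V (Fin 4 → ℝ)) (y u : Fin 4 → ℝ) :
    TangentSpace 𝓘(ℝ, Fin 4 → ℝ) (e.symm y) :=
  mfderiv 𝓘(ℝ, Fin 4 → ℝ) 𝓘(ℝ, Fin 4 → ℝ) e.symm y u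

/-- The components of the metric in the chart `e`. -/
def comp (M : Spacetime V) (e : OpenPartialHomeomorph V (Fin 4 → ℝ)) : Components :=
  fun y => Matrix.of fun μ ν =>
    M.metric (e.symm y) (pushVec e y (Pi.single μ 1)) (pushVec e y (Pi.single ν 1))

/-- `Φ : W → ℝ⁴`, read in the chart `e`, is a `C³` parametrisation of an open piece of `S`
which is a homeomorphism onto that piece. -/
structure IsLocalParam (S : Set V) (e : OpenPartialHomeomorph V (Fin 4 → ℝ))
    (W : Set (Fin 2 → ℝ)) (Φ : (Fin 2 → ℝ) → (Fin 4 → ℝ)) : Prop where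
  chart : e ∈ IsManifold.maximalAtlas 𝓘(ℝ, Fin 4 → ℝ) ∞ V
  isOpen : IsOpen W
  contDiffOn : ContDiffOn ℝ 3 Φ W
  mapsTo : Set.MapsTo Φ W e.target
  embedding : Topology.IsEmbedding (W.domRestrict Φ)
  range_eq : ∃ O : Set V, IsOpen O ∧ (fun l => e.symm (Φ l)) '' W = S ∩ O

/-- `S` is a closed (compact, connected, without boundary) spacelike embedded `C³` surface whose
mean curvature vector has the property `P` at every point. -/
def IsClosedSurfaceWith (M : Spacetime V)
    (P : ∀ p : V, TangentSpace 𝓘(ℝ, Fin 4 → ℝ) p → Prop) (S : Set V) : Prop :=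
  IsCompact S ∧ IsConnected S ∧ ∀ q ∈ S,
    ∃ (e : OpenPartialHomeomorph V (Fin 4 → ℝ)) (W : Set (Fin 2 → ℝ))
      (Φ : (Fin 2 → ℝ) → (Fin 4 → ℝ)) (l : Fin 2 → ℝ),
      IsLocalParam S e W Φ ∧ l ∈ W ∧ e.symm (Φ l) = q ∧
      (firstForm (M.comp e) Φ l).PosDef ∧
      P (e.symm (Φ l)) (pushVec e (Φ l) (SphTrapped.meanCurvature (M.comp e) Φ l))

/-- Closed future-trapped surfaces: `H` is timelike and future-pointing everywhere. -/
def IsClosedFTrapped (M : Spacetime V) (S : Set V) : Prop :=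
  M.IsClosedSurfaceWith M.IsFutureTimelike S

/-- Closed untrapped surfaces: `H` is spacelike everywhere. -/
def IsClosedUntrapped (M : Spacetime V) (S : Set V) : Prop :=
  M.IsClosedSurfaceWith M.IsSpacelike S

/-- The future-trapped region `𝒯`. -/
def trappedRegion (M : Spacetime V) : Set V :=
  {p | ∃ S : Set V, M.IsClosedFTrapped S ∧ p ∈ S}

/-- The boundary `ℬ` of the future-trapped region. -/
def trappedBoundary (M : Spacetime V) : Set V := frontier M.trappedRegion

/-- `SO(3)` acts (faithfully) by isometries. -/
structure IsSphericallySymmetric [MulAction SO3 V] (M : Spacetime V) : Prop where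
  faithful (R : SO3) : (∀ p : V, R • p = p) → R = 1
  smooth (R : SO3) : ContMDiff 𝓘(ℝ, Fin 4 → ℝ) 𝓘(ℝ, Fin 4 → ℝ) ∞ (fun p : V => R • p)
  isometry (R : SO3) (p : V) (u w : TangentSpace 𝓘(ℝ, Fin 4 → ℝ) p) :
    M.metric (R • p)
      (mfderiv 𝓘(ℝ, Fin 4 → ℝ) 𝓘(ℝ, Fin 4 → ℝ) (fun q : V => R • q) p u)
      (mfderiv 𝓘(ℝ, Fin 4 → ℝ) 𝓘(ℝ, Fin 4 → ℝ) (fun q : V => R • q) p w) = M.metric p u w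

end Spacetime

/-! ### Advanced Eddington-Finkelstein coordinates

The coordinates are `y = (v, x)` with `x ∈ ℝ³ \ {0}`; the area coordinate is `r = |x|` and the
angles are `x / r`. -/

/-- `r = |x|` for `y = (v, x)`. -/
def radius (y : Fin 4 → ℝ) : ℝ := Real.sqrt (∑ i : Fin 3, y i.succ ^ 2)

/-- The value `dr(u)` at the point `y`. -/
def dr (y u : Fin 4 → ℝ) : ℝ := (∑ i : Fin 3, y i.succ * u i.succ) / radius y

/-- The vector field `∂_v`. -/
def dV : Fin 4 → ℝ := Fin.cons 1 (fun _ => 0)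

/-- The vector field `∂_r` (at constant `v` and constant angles). -/
def dR (y : Fin 4 → ℝ) : Fin 4 → ℝ := Fin.cons 0 (fun i : Fin 3 => y i.succ / radius y)

/-- The bilinear form
`-e^{2β} (1 - 2m/r) dv² + 2 e^β dv dr + r² dΩ²` at `y`, where `r² dΩ² = |dx|² - dr²`
and `β`, `m` are evaluated at `(v, r)`. -/
def efForm (β m : ℝ × ℝ → ℝ) (y u w : Fin 4 → ℝ) : ℝ :=
  -Real.exp (2 * β (y 0, radius y)) * (1 - 2 * m (y 0, radius y) / radius y) * (u 0 * w 0)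
    + Real.exp (β (y 0, radius y)) * (u 0 * dr y w + dr y u * w 0)
    + ((∑ i : Fin 3, u i.succ * w i.succ) - dr y u * dr y w)

/-- An advanced Eddington-Finkelstein chart of a spacetime with an action of `SO(3)`: a chart with
coordinates `(v, x)`, ranging over all points with `(v, r)` in an open set `D ⊆ {r > 0}`, in which
`SO(3)` acts by rotation of `x`, the metric is
`-e^{2β} (1 - 2m/r) dv² + 2 e^β dv dr + r² dΩ²` with smooth `β(v, r)`, `m(v, r)`, and `v` increases
to the future. -/
structure EFChart {V : Type*} [TopologicalSpace V] [ChartedSpace (Fin 4 → ℝ) V]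
    [IsManifold 𝓘(ℝ, Fin 4 → ℝ) ∞ V] [MulAction SO3 V] (M : Spacetime V) where
  e : OpenPartialHomeomorph V (Fin 4 → ℝ)
  D : Set (ℝ × ℝ)
  β : ℝ × ℝ → ℝ
  m : ℝ × ℝ → ℝ
  chart : e ∈ IsManifold.maximalAtlas 𝓘(ℝ, Fin 4 → ℝ) ∞ V
  isOpen_D : IsOpen D
  pos_D : ∀ z ∈ D, 0 < z.2
  target_eq : e.target = {y | (y 0, radius y) ∈ D}
  smooth_β : ContDiffOn ℝ ∞ β D
  smooth_m : ContDiffOn ℝ ∞ m D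
  rotation : ∀ (R : SO3), ∀ p ∈ e.source, R • p ∈ e.source ∧
    e (R • p) = Fin.cons (e p 0) (R.1.mulVec (fun i : Fin 3 => e p i.succ))
  metric_eq : ∀ y ∈ e.target, ∀ u w : Fin 4 → ℝ,
    M.metric (e.symm y) (Spacetime.pushVec e y u) (Spacetime.pushVec e y w) = efForm β m y u w
  future : ∀ p ∈ e.source,
    0 < (show Fin 4 → ℝ from
      mfderiv 𝓘(ℝ, Fin 4 → ℝ) 𝓘(ℝ, Fin 4 → ℝ) e p (M.time p)) 0

namespace EFChart

variable {V : Type*} [TopologicalSpace V] [ChartedSpace (Fin 4 → ℝ) V]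
  [IsManifold 𝓘(ℝ, Fin 4 → ℝ) ∞ V] [MulAction SO3 V] {M : Spacetime V}

/-- The area coordinate of a point of the chart domain. -/
def r (C : EFChart M) (p : V) : ℝ := radius (C.e p)

/-- The mass function at a point of the chart domain. -/
def mass (C : EFChart M) (p : V) : ℝ := C.m (C.e p 0, C.r p)

/-- The round sphere (constant `v` and `r`) through `p`. -/
def roundSphere (C : EFChart M) (p : V) : Set V :=
  {q | q ∈ C.e.source ∧ C.e q 0 = C.e p 0 ∧ C.r q = C.r p}

/-- The ingoing future null vector field `ℓ = -e^{-β} ∂_r`, in components. -/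
def ell (C : EFChart M) (y : Fin 4 → ℝ) : Fin 4 → ℝ :=
  -(Real.exp (-C.β (y 0, radius y)) • dR y)

/-- The outgoing future null vector field `k = ∂_v + ½ (1 - 2m/r) e^β ∂_r`, in components. -/
def k (C : EFChart M) (y : Fin 4 → ℝ) : Fin 4 → ℝ :=
  dV + ((1 / 2 : ℝ) * (1 - 2 * C.m (y 0, radius y) / radius y) *
    Real.exp (C.β (y 0, radius y))) • dR y

/-- `G_{μν} k^μ k^ν` at a point of the chart domain. -/
def Gkk (C : EFChart M) (p : V) : ℝ :=
  ∑ μ, ∑ ν, einstein (M.comp C.e) μ ν (C.e p) * C.k (C.e p) μ * C.k (C.e p) ν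

/-- The apparent 3-horizon `AH : r = 2m` (in the chart domain). -/
def AH (C : EFChart M) : Set V := {p | p ∈ C.e.source ∧ C.r p = 2 * C.mass p}

/-- The isolated-horizon portion of `AH`, where `G_{μν} k^μ k^ν = 0`. -/
def AHiso (C : EFChart M) : Set V := {p | p ∈ C.AH ∧ C.Gkk p = 0}

/-- `S` has points on both sides of `AH`: in `{r < 2m}` and in `{r > 2m}`. -/
def CrossesAH (C : EFChart M) (S : Set V) : Prop :=
  (∃ q ∈ S, q ∈ C.e.source ∧ C.r q < 2 * C.mass q) ∧
  (∃ q ∈ S, q ∈ C.e.source ∧ 2 * C.mass q < C.r q)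

/-- The point with angles `x` (a unit vector) on the round sphere through `p`, in coordinates. -/
def onSphere (C : EFChart M) (p : V) (x : Fin 3 → ℝ) : Fin 4 → ℝ :=
  Fin.cons (C.e p 0) (fun i => C.r p * x i)

/-- The normal vector `n = -ℓ + (N/2) k`, in components; it satisfies `g(k, n) = 1`,
`g(n, n) = N`. -/
def normalVec (C : EFChart M) (N : ℝ) (y : Fin 4 → ℝ) : Fin 4 → ℝ :=
  -C.ell y + (N / 2) • C.k y

/-- The deformation of the round sphere through `p` along `f n` by the parameter `ε`: each
point `y(x)` of the sphere is moved to the point with coordinates `y(x) + ε f(x) n`. -/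
def deformedSphere (C : EFChart M) (p : V) (N : ℝ) (f : (Fin 3 → ℝ) → ℝ) (ε : ℝ) : Set V :=
  {q | q ∈ C.e.source ∧ ∃ x : Fin 3 → ℝ, ∑ i, x i ^ 2 = 1 ∧
    C.e q = C.onSphere p x + (ε * f x) • C.normalVec N (C.onSphere p x)}

end EFChart

/-- `Y` is, on the unit sphere, a real spherical harmonic of degree `l`: the restriction of a
homogeneous harmonic polynomial of degree `l` in three variables. -/
def IsSphericalHarmonic (l : ℕ) (Y : (Fin 3 → ℝ) → ℝ) : Prop :=
  ∃ P : MvPolynomial (Fin 3) ℝ, P.IsHomogeneous l ∧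
    ∑ i, MvPolynomial.pderiv i (MvPolynomial.pderiv i P) = 0 ∧
    ∀ x : Fin 3 → ℝ, ∑ i, x i ^ 2 = 1 → Y x = MvPolynomial.eval x P

/-- `S` is a topological 2-sphere. -/
def IsTopSphere {V : Type*} [TopologicalSpace V] (S : Set V) : Prop :=
  Nonempty (S ≃ₜ Metric.sphere (0 : EuclideanSpace ℝ (Fin 3)) 1)

end SphTrapped

end

open SphTrapped

/-! Write the metric as -A dv² + 2B dv dr + r² dΩ² with A = e^{2β}(1 - 2m/r) and B = e^β, so that AH
is the zero set of A. On AH the vector k is ∂_v and g_vv = 0, hence G(k,k) = R_vv = -A_v/(rB)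
(`Gkk_eq`); where G(k,k) ≠ 0, also A_v ≠ 0.

Deform a round sphere of AH to v = v₀ + ενf, r = r₀ + εbf with b = e^{-β}. As ε → 0, H^v → 2/(rB)
and H^r/ε → 2a/(B²r) - bΔf/r², where a = (νA_v + bA_r)f is the limit of A/ε and Δ is the Laplacian
of the unit sphere. Hence g(H,H)/ε → (4/r²)(a/B² - bΔf/r) (`good_of_eps_eq_zero`). For f = a₀ + Y
with Y a spherical harmonic of degree l, Δf = -L(f - a₀) with L = l(l+1) (`trace_polyJet`). Since
A_v ≠ 0, ν can be chosen with νA_v + bA_r = -(B/r)L (`exists_tuned`). Then the terms in f cancel,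
and the limit is the constant -4La₀/(Br³): g(H,H) has the sign of -a₀ at every point, although f
itself changes sign. The same tuning gives A/ε → -(B/r)Lf, so the sphere is inside AH where f > 0
and outside where f < 0 (`eventually_fA_sign`). As H^v > 0, a timelike H is future-pointing
(`isFutureTimelike`).

To make this uniform, each point of the sphere is taken as the centre of a gnomonic parametrisation
attached to an orthonormal frame of ℝ³. The second derivatives at the centre form the covariant
Hessian, and `meanCurvature_polarSurf` gives H there exactly, as a function of finitely many numbers
(`Profile`). With A/ε treated as an independent variable this function extends continuously to ε =
0. The required signs are open conditions and the set of frames is compact, so small ε > 0 works at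
all points at once (`eventually_forall_good`).

For spheres through a given p in direction n, take f = a₀(1 - n·x - e·x) with a unit vector e ⊥ n:
it vanishes at n and takes both signs (`exists_surf_near`). For the trapped region, take f = 1 - d·x
for all unit vectors d simultaneously. One ε serves all d, and with that ε fixed the base sphere may
still be moved slightly. Choosing d as the direction of q puts every q near p on a trapped sphere
(`eventually_mem_trappedRegion`), so p is an interior point of 𝒯. -/

noncomputable section

namespace SphTrapped

/-! ### Partial derivatives -/

section PartialDerivatives

variable {n : ℕ} {i : Fin n} {F G : (Fin n → ℝ) → ℝ} {x : Fin n → ℝ}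

lemma pd_congr (h : F =ᶠ[nhds x] G) : pd i F x = pd i G x := by
  simp only [pd, h.fderiv_eq]

lemma pd_const (c : ℝ) : pd i (fun _ => c) x = 0 := by simp [pd]

lemma pd_add (hF : DifferentiableAt ℝ F x) (hG : DifferentiableAt ℝ G x) :
    pd i (fun y => F y + G y) x = pd i F x + pd i G x := by
  simp [pd, fderiv_fun_add hF hG]

lemma pd_sub (hF : DifferentiableAt ℝ F x) (hG : DifferentiableAt ℝ G x) :
    pd i (fun y => F y - G y) x = pd i F x - pd i G x := by
  simp [pd, fderiv_fun_sub hF hG]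

lemma pd_neg : pd i (fun y => -F y) x = -pd i F x := by
  simp [pd, fderiv_fun_neg]

lemma pd_mul (hF : DifferentiableAt ℝ F x) (hG : DifferentiableAt ℝ G x) :
    pd i (fun y => F y * G y) x = pd i F x * G x + F x * pd i G x := by
  simp [pd, fderiv_fun_mul hF hG]; ring

lemma pd_const_mul (c : ℝ) (hF : DifferentiableAt ℝ F x) :
    pd i (fun y => c * F y) x = c * pd i F x := by
  rw [pd_mul (differentiableAt_const c) hF, pd_const]; ring

lemma pd_sum {ι : Type*} (s : Finset ι) {F : ι → (Fin n → ℝ) → ℝ}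
    (hF : ∀ j ∈ s, DifferentiableAt ℝ (F j) x) :
    pd i (fun y => ∑ j ∈ s, F j y) x = ∑ j ∈ s, pd i (F j) x := by
  simp [pd, fderiv_fun_sum hF]

lemma pd_coord (j : Fin n) : pd i (fun y => y j) x = if j = i then 1 else 0 := by
  have : HasFDerivAt (fun y : Fin n → ℝ => y j) (ContinuousLinearMap.proj (R := ℝ) j) x :=
    (ContinuousLinearMap.proj (R := ℝ) (φ := fun _ : Fin n => ℝ) j).hasFDerivAt
  simp [pd, this.fderiv, Pi.single_apply]

lemma contDiff_pd {m : ℕ∞ω} (hF : ContDiff ℝ (m + 1) F) : ContDiff ℝ m (fun y => pd i F y) :=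
  (hF.fderiv_right le_rfl).clm_apply contDiff_const

end PartialDerivatives

/-! ### Functions of `(v, r)` -/

/-- The coordinates `(v, r)` of `y = (v, x)`. -/
def vr (y : Fin 4 → ℝ) : ℝ × ℝ := (y 0, radius y)

/-- The unit vector `x / r` of `y = (v, x)`. -/
def nrm (y : Fin 4 → ℝ) (i : Fin 3) : ℝ := y i.succ / radius y

/-- The projection orthogonal to the unit vector `x / r`. -/
def prj (y : Fin 4 → ℝ) (i j : Fin 3) : ℝ := (if i = j then 1 else 0) - nrm y i * nrm y j

/-- `∂φ/∂v`. -/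
def Dv (φ : ℝ × ℝ → ℝ) (z : ℝ × ℝ) : ℝ := fderiv ℝ φ z (1, 0)

/-- `∂φ/∂r`. -/
def Dr (φ : ℝ × ℝ → ℝ) (z : ℝ × ℝ) : ℝ := fderiv ℝ φ z (0, 1)

section Radial

variable {y : Fin 4 → ℝ}

lemma radius_sq (y : Fin 4 → ℝ) : radius y ^ 2 = ∑ i : Fin 3, y i.succ ^ 2 :=
  Real.sq_sqrt (Finset.sum_nonneg fun _ _ => sq_nonneg _)

lemma continuous_radius : Continuous radius := by unfold radius; fun_prop

lemma continuous_vr : Continuous vr :=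
  (continuous_apply 0).prodMk continuous_radius

lemma sum_nrm_sq (h : 0 < radius y) : ∑ i, nrm y i * nrm y i = 1 := by
  have := radius_sq y
  simp only [nrm, ← pow_two, div_pow, ← Finset.sum_div, ← this]
  field_simp

lemma sum_nrm_mul_prj (h : 0 < radius y) (j : Fin 3) : ∑ i, nrm y i * prj y i j = 0 := by
  have := sum_nrm_sq h
  simp only [prj, mul_sub, Finset.sum_sub_distrib, mul_ite, mul_one, mul_zero,
    Finset.sum_ite_eq', Finset.mem_univ, if_true, ← mul_assoc, ← Finset.sum_mul, this]
  ring

lemma prj_comm (i j : Fin 3) : prj y i j = prj y j i := by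
  simp only [prj, eq_comm (a := i), mul_comm]

lemma sum_prj_mul_prj (h : 0 < radius y) (i k : Fin 3) :
    ∑ j, prj y i j * prj y j k = prj y i k := by
  have h1 : ∀ j, prj y i j * prj y j k
      = (if i = j then prj y j k else 0) - nrm y i * (nrm y j * prj y j k) := by
    intro j; rw [prj]; split_ifs <;> ring
  simp only [h1, Finset.sum_sub_distrib, ← Finset.mul_sum, sum_nrm_mul_prj h]
  simp

lemma sum_prj_self (h : 0 < radius y) : ∑ i, prj y i i = 2 := by
  have := sum_nrm_sq h
  simp [prj, this]; norm_num

lemma hasFDerivAt_radius (h : 0 < radius y) :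
    HasFDerivAt radius (∑ i : Fin 3, nrm y i •
      ContinuousLinearMap.proj (R := ℝ) (φ := fun _ : Fin 4 => ℝ) i.succ) y := by
  have h0 : (∑ i : Fin 3, y i.succ ^ 2) ≠ 0 := by
    rw [← radius_sq]; positivity
  have h1 : ∀ i ∈ (Finset.univ : Finset (Fin 3)),
      HasFDerivAt (fun y : Fin 4 → ℝ => y i.succ ^ 2) ((2 * y i.succ) •
      ContinuousLinearMap.proj (R := ℝ) (φ := fun _ : Fin 4 => ℝ) i.succ) y := by
    intro i _
    have := ((ContinuousLinearMap.proj (R := ℝ) (φ := fun _ : Fin 4 => ℝ)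
      i.succ).hasFDerivAt (x := y)).pow 2
    simpa using this
  have h2 := (HasFDerivAt.fun_sum h1).sqrt h0
  refine h2.congr_fderiv ?_
  change (1 / (2 * radius y)) • _ = _
  rw [Finset.smul_sum]
  refine Finset.sum_congr rfl fun i _ => ?_
  rw [smul_smul]; congr 1
  rw [nrm]; field_simp

lemma differentiableAt_radius (h : 0 < radius y) : DifferentiableAt ℝ radius y :=
  (hasFDerivAt_radius h).differentiableAt

lemma differentiableAt_vr (h : 0 < radius y) : DifferentiableAt ℝ vr y :=
  (differentiableAt_apply 0 y).prodMk (differentiableAt_radius h)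

lemma differentiableAt_nrm (h : 0 < radius y) (i : Fin 3) :
    DifferentiableAt ℝ (fun y => nrm y i) y := by
  simp only [nrm, div_eq_mul_inv]
  exact (differentiableAt_apply i.succ y).mul ((differentiableAt_radius h).fun_inv h.ne')

lemma pd_zero_radius (h : 0 < radius y) : pd 0 radius y = 0 := by
  simp [pd, (hasFDerivAt_radius h).fderiv]

lemma pd_succ_radius (h : 0 < radius y) (j : Fin 3) : pd j.succ radius y = nrm y j := by
  simp [pd, (hasFDerivAt_radius h).fderiv, Pi.single_apply]

lemma fderiv_comp_vr {φ : ℝ × ℝ → ℝ} (h : 0 < radius y) (hφ : DifferentiableAt ℝ φ (vr y))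
    (u : Fin 4 → ℝ) :
    fderiv ℝ (fun y => φ (vr y)) y u = u 0 * Dv φ (vr y) + (∑ i, nrm y i * u i.succ) * Dr φ (vr y) := by
  have h1 : HasFDerivAt vr ((ContinuousLinearMap.proj (R := ℝ) (φ := fun _ : Fin 4 => ℝ) 0).prod
      (∑ i : Fin 3, nrm y i •
        ContinuousLinearMap.proj (R := ℝ) (φ := fun _ : Fin 4 => ℝ) i.succ)) y :=
    (ContinuousLinearMap.proj (R := ℝ) (φ := fun _ : Fin 4 => ℝ) 0).hasFDerivAt.prodMk
      (hasFDerivAt_radius h)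
  have h2 := (hφ.hasFDerivAt.comp y h1).fderiv
  change fderiv ℝ (φ ∘ vr) y u = _
  rw [h2, Dv, Dr, ← smul_eq_mul, ← smul_eq_mul, ← map_smul, ← map_smul, ← map_add]
  simp [ContinuousLinearMap.comp_apply]

lemma pd_zero_comp_vr {φ : ℝ × ℝ → ℝ} (h : 0 < radius y) (hφ : DifferentiableAt ℝ φ (vr y)) :
    pd 0 (fun y => φ (vr y)) y = Dv φ (vr y) := by
  rw [pd, fderiv_comp_vr h hφ]; simp

lemma pd_succ_comp_vr {φ : ℝ × ℝ → ℝ} (h : 0 < radius y) (hφ : DifferentiableAt ℝ φ (vr y))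
    (j : Fin 3) : pd j.succ (fun y => φ (vr y)) y = Dr φ (vr y) * nrm y j := by
  rw [pd, fderiv_comp_vr h hφ]; simp [Pi.single_apply, mul_comm]

lemma differentiableAt_comp_vr {φ : ℝ × ℝ → ℝ} (h : 0 < radius y)
    (hφ : DifferentiableAt ℝ φ (vr y)) : DifferentiableAt ℝ (fun y => φ (vr y)) y :=
  hφ.comp y (differentiableAt_vr h)

/-- Differentiating n_i r = x_i by the product rule determines the derivatives of n_i; the spatial
ones below come from the same identity. -/
lemma pd_zero_nrm (h : 0 < radius y) (i : Fin 3) : pd 0 (fun y => nrm y i) y = 0 := by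
  have h1 : pd 0 (fun y => nrm y i * radius y) y = 0 := by
    have : (fun y => nrm y i * radius y) =ᶠ[nhds y] fun y => y i.succ := by
      filter_upwards [continuous_radius.continuousAt.eventually (lt_mem_nhds h)] with w hw
      rw [nrm]; field_simp
    rw [pd_congr this, pd_coord]; simp
  rw [pd_mul (differentiableAt_nrm h i) (differentiableAt_radius h), pd_zero_radius h] at h1
  have := h.ne'
  simpa [this] using h1

lemma pd_succ_nrm (h : 0 < radius y) (i j : Fin 3) :
    pd j.succ (fun y => nrm y i) y = prj y i j / radius y := by
  have h1 : pd j.succ (fun y => nrm y i * radius y) y = if i = j then 1 else 0 := by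
    have : (fun y => nrm y i * radius y) =ᶠ[nhds y] fun y => y i.succ := by
      filter_upwards [continuous_radius.continuousAt.eventually (lt_mem_nhds h)] with w hw
      rw [nrm]; field_simp
    rw [pd_congr this, pd_coord]; simp
  rw [pd_mul (differentiableAt_nrm h i) (differentiableAt_radius h), pd_succ_radius h] at h1
  rw [eq_div_iff h.ne', prj, ← h1]; ring

end Radial

/-! ### The Eddington-Finkelstein metric `-A dv² + 2 B dv dr + r² dΩ²` -/

/-- The components of `-A dv² + 2 B dv dr + r² dΩ²`. -/
def efMat (A B : ℝ × ℝ → ℝ) : Components := fun y => Matrix.of fun μ ν =>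
  Fin.cases (Fin.cases (-A (vr y)) (fun j => B (vr y) * nrm y j) ν)
    (fun i => Fin.cases (B (vr y) * nrm y i) (fun j => prj y i j) ν) μ

/-- The components of the inverse metric. -/
def efInv (A B : ℝ × ℝ → ℝ) : Components := fun y => Matrix.of fun μ ν =>
  Fin.cases (Fin.cases 0 (fun j => nrm y j / B (vr y)) ν)
    (fun i => Fin.cases (nrm y i / B (vr y))
      (fun j => A (vr y) / B (vr y) ^ 2 * (nrm y i * nrm y j) + prj y i j) ν) μ

section Entries
variable (A B : ℝ × ℝ → ℝ) (y : Fin 4 → ℝ) (i j : Fin 3)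
lemma efMat_zero_zero : efMat A B y 0 0 = -A (vr y) := rfl
lemma efMat_zero_succ : efMat A B y 0 j.succ = B (vr y) * nrm y j := rfl
lemma efMat_succ_zero : efMat A B y i.succ 0 = B (vr y) * nrm y i := rfl
lemma efMat_succ_succ : efMat A B y i.succ j.succ = prj y i j := rfl
lemma efInv_zero_zero : efInv A B y 0 0 = 0 := rfl
lemma efInv_zero_succ : efInv A B y 0 j.succ = nrm y j / B (vr y) := rfl
lemma efInv_succ_zero : efInv A B y i.succ 0 = nrm y i / B (vr y) := rfl
lemma efInv_succ_succ : efInv A B y i.succ j.succ =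
    A (vr y) / B (vr y) ^ 2 * (nrm y i * nrm y j) + prj y i j := rfl
end Entries

/-- With P = 1 - n nᵀ, the block product reduces to |n| = 1, Pn = 0 and P² = P. -/
lemma efMat_inv {A B : ℝ × ℝ → ℝ} {y : Fin 4 → ℝ} (h : 0 < radius y) (hB : B (vr y) ≠ 0) :
    (efMat A B y)⁻¹ = efInv A B y := by
  have h1 := sum_nrm_sq h
  have h2 := sum_nrm_mul_prj h
  have h3 : ∀ i, ∑ j, prj y i j * nrm y j = 0 := by
    intro i; rw [← h2 i]; exact Finset.sum_congr rfl fun j _ => by rw [prj_comm]; ring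
  have h4 := sum_prj_mul_prj h
  apply Matrix.inv_eq_right_inv
  ext μ ν
  rw [Matrix.mul_apply, Fin.sum_univ_succ]
  refine Fin.cases ?_ (fun i => ?_) μ <;> refine Fin.cases ?_ (fun k => ?_) ν
  · simp only [efMat_zero_zero, efMat_zero_succ, efInv_zero_zero, efInv_succ_zero]
    have : ∀ j, B (vr y) * nrm y j * (nrm y j / B (vr y)) = nrm y j * nrm y j := by
      intro j; field_simp
    simp [this, h1]
  · simp only [efMat_zero_zero, efMat_zero_succ, efInv_zero_succ, efInv_succ_succ]
    have : ∀ j, B (vr y) * nrm y j *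
        (A (vr y) / B (vr y) ^ 2 * (nrm y j * nrm y k) + prj y j k)
        = (A (vr y) / B (vr y) * nrm y k) * (nrm y j * nrm y j)
          + B (vr y) * (nrm y j * prj y j k) := by
      intro j; field_simp
    simp only [this, Finset.sum_add_distrib, ← Finset.mul_sum, h1, h2]
    rw [Matrix.one_apply_ne (Fin.succ_ne_zero k).symm]; ring
  · simp only [efMat_succ_zero, efMat_succ_succ, efInv_zero_zero, efInv_succ_zero]
    have : ∀ j, prj y i j * (nrm y j / B (vr y)) = prj y i j * nrm y j / B (vr y) := by
      intro j; ring
    simp only [this, ← Finset.sum_div, h3]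
    rw [Matrix.one_apply_ne (Fin.succ_ne_zero i)]; ring
  · simp only [efMat_succ_zero, efMat_succ_succ, efInv_zero_succ, efInv_succ_succ]
    have : ∀ j, prj y i j *
        (A (vr y) / B (vr y) ^ 2 * (nrm y j * nrm y k) + prj y j k)
        = (A (vr y) / B (vr y) ^ 2 * nrm y k) * (prj y i j * nrm y j)
          + prj y i j * prj y j k := by
      intro j; ring
    simp only [this, Finset.sum_add_distrib, ← Finset.mul_sum, h3, h4]
    rw [Matrix.one_apply]
    simp only [Fin.succ_inj, prj]
    field_simp
    ring

end SphTrapped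
end


/-! ### Christoffel symbols of the metric and the Ricci component R_vv. -/

noncomputable section

namespace SphTrapped

/-- `g = -A dv² + 2 B dv dr + r² dΩ²` over the open set `D` of pairs `(v, r)`. -/
structure IsEFMetric (g : Components) (A B : ℝ × ℝ → ℝ) (D : Set (ℝ × ℝ)) : Prop where
  isOpen : IsOpen D
  contDiffOn_A : ContDiffOn ℝ ∞ A D
  contDiffOn_B : ContDiffOn ℝ ∞ B D
  B_pos : ∀ z ∈ D, 0 < B z
  r_pos : ∀ z ∈ D, 0 < z.2
  eq_efMat : ∀ y, vr y ∈ D → g y = efMat A B y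

/-- `Γ^v_{vv}` -/
def gamVVV (A B : ℝ × ℝ → ℝ) (z : ℝ × ℝ) : ℝ := (Dv B z + Dr A z / 2) / B z

/-- `Γ^r_{vv}` -/
def gamRVV (A B : ℝ × ℝ → ℝ) (z : ℝ × ℝ) : ℝ :=
  -(Dv A z / (2 * B z)) + A z / B z ^ 2 * (Dv B z + Dr A z / 2)

/-- `-Γ^r_{vr}` -/
def gamRVR (A B : ℝ × ℝ → ℝ) (z : ℝ × ℝ) : ℝ := Dr A z / (2 * B z)

/-- `Γ^r_{rr}` -/
def gamRRR (B : ℝ × ℝ → ℝ) (z : ℝ × ℝ) : ℝ := Dr B z / B z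

lemma contDiffOn_Dv {φ : ℝ × ℝ → ℝ} {D : Set (ℝ × ℝ)} (hD : IsOpen D)
    (hφ : ContDiffOn ℝ ∞ φ D) : ContDiffOn ℝ ∞ (Dv φ) D :=
  (hφ.fderiv_of_isOpen hD (by norm_num)).clm_apply contDiffOn_const

lemma contDiffOn_Dr {φ : ℝ × ℝ → ℝ} {D : Set (ℝ × ℝ)} (hD : IsOpen D)
    (hφ : ContDiffOn ℝ ∞ φ D) : ContDiffOn ℝ ∞ (Dr φ) D :=
  (hφ.fderiv_of_isOpen hD (by norm_num)).clm_apply contDiffOn_const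

lemma two_le_infty : (2 : ℕ∞ω) ≤ ∞ :=
  WithTop.coe_le_coe.2 (le_top : (2 : ℕ∞) ≤ ⊤)

lemma Dv_Dr_comm {φ : ℝ × ℝ → ℝ} {D : Set (ℝ × ℝ)} (hD : IsOpen D)
    (hφ : ContDiffOn ℝ ∞ φ D) {z : ℝ × ℝ} (hz : z ∈ D) : Dv (Dr φ) z = Dr (Dv φ) z := by
  have h1 : ContDiffAt ℝ ∞ φ z := hφ.contDiffAt (hD.mem_nhds hz)
  have h2 : DifferentiableAt ℝ (fderiv ℝ φ) z :=
    ((hφ.fderiv_of_isOpen (m := 1) hD two_le_infty).contDiffAt (hD.mem_nhds hz)).differentiableAt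
      (by norm_num)
  have h3 := (h1.isSymmSndFDerivAt (by simpa using two_le_infty)).eq (1, 0) (0, 1)
  change fderiv ℝ (fun w => fderiv ℝ φ w (0, 1)) z (1, 0)
    = fderiv ℝ (fun w => fderiv ℝ φ w (1, 0)) z (0, 1)
  rw [fderiv_clm_apply h2 (differentiableAt_const _), fderiv_clm_apply h2 (differentiableAt_const _)]
  simpa using h3

lemma Dv_mul {φ ψ : ℝ × ℝ → ℝ} {z : ℝ × ℝ} (hφ : DifferentiableAt ℝ φ z)
    (hψ : DifferentiableAt ℝ ψ z) : Dv (fun w => φ w * ψ w) z = Dv φ z * ψ z + φ z * Dv ψ z := by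
  simp [Dv, fderiv_fun_mul hφ hψ]; ring

lemma Dr_mul {φ ψ : ℝ × ℝ → ℝ} {z : ℝ × ℝ} (hφ : DifferentiableAt ℝ φ z)
    (hψ : DifferentiableAt ℝ ψ z) : Dr (fun w => φ w * ψ w) z = Dr φ z * ψ z + φ z * Dr ψ z := by
  simp [Dr, fderiv_fun_mul hφ hψ]; ring

lemma Dr_add {φ ψ : ℝ × ℝ → ℝ} {z : ℝ × ℝ} (hφ : DifferentiableAt ℝ φ z)
    (hψ : DifferentiableAt ℝ ψ z) : Dr (fun w => φ w + ψ w) z = Dr φ z + Dr ψ z := by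
  simp [Dr, fderiv_fun_add hφ hψ]

lemma Dv_congr {φ ψ : ℝ × ℝ → ℝ} {D : Set (ℝ × ℝ)} (hD : IsOpen D) {z : ℝ × ℝ} (hz : z ∈ D)
    (h : Set.EqOn φ ψ D) : Dv φ z = Dv ψ z := by
  rw [Dv, (h.eventuallyEq_of_mem (hD.mem_nhds hz)).fderiv_eq, Dv]

lemma Dr_congr {φ ψ : ℝ × ℝ → ℝ} {D : Set (ℝ × ℝ)} (hD : IsOpen D) {z : ℝ × ℝ} (hz : z ∈ D)
    (h : Set.EqOn φ ψ D) : Dr φ z = Dr ψ z := by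
  rw [Dr, (h.eventuallyEq_of_mem (hD.mem_nhds hz)).fderiv_eq, Dr]

namespace IsEFMetric

variable {g : Components} {A B : ℝ × ℝ → ℝ} {D : Set (ℝ × ℝ)} (h : IsEFMetric g A B D)
  {y : Fin 4 → ℝ}

include h

lemma differentiableAt {φ : ℝ × ℝ → ℝ} (hφ : ContDiffOn ℝ ∞ φ D) {z : ℝ × ℝ} (hz : z ∈ D) :
    DifferentiableAt ℝ φ z :=
  (hφ.contDiffAt (h.isOpen.mem_nhds hz)).differentiableAt (by norm_num)

lemma mem_nhds (hy : vr y ∈ D) : ∀ᶠ w in nhds y, vr w ∈ D :=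
  continuous_vr.continuousAt.eventually (h.isOpen.mem_nhds hy)

lemma radius_pos (hy : vr y ∈ D) : 0 < radius y := h.r_pos _ hy

lemma inv_eq (hy : vr y ∈ D) : (g y)⁻¹ = efInv A B y := by
  rw [h.eq_efMat y hy, efMat_inv (h.radius_pos hy) (h.B_pos _ hy).ne']

lemma pd_comp (hy : vr y ∈ D) (i μ ν : Fin 4) :
    pd i (fun w => g w μ ν) y = pd i (fun w => efMat A B w μ ν) y :=
  pd_congr (by filter_upwards [h.mem_nhds hy] with w hw; rw [h.eq_efMat w hw])

lemma pd_zero_zero_zero (hy : vr y ∈ D) : pd 0 (fun w => g w 0 0) y = -Dv A (vr y) := by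
  rw [h.pd_comp hy]; simp only [efMat_zero_zero]
  rw [pd_neg, pd_zero_comp_vr (h.radius_pos hy) (h.differentiableAt h.contDiffOn_A hy)]

lemma pd_succ_zero_zero (hy : vr y ∈ D) (i : Fin 3) :
    pd i.succ (fun w => g w 0 0) y = -(Dr A (vr y) * nrm y i) := by
  rw [h.pd_comp hy]; simp only [efMat_zero_zero]
  rw [pd_neg, pd_succ_comp_vr (h.radius_pos hy) (h.differentiableAt h.contDiffOn_A hy)]

lemma pd_zero_zero_succ (hy : vr y ∈ D) (j : Fin 3) :
    pd 0 (fun w => g w 0 j.succ) y = Dv B (vr y) * nrm y j := by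
  have hr := h.radius_pos hy
  have hB := h.differentiableAt h.contDiffOn_B hy
  rw [h.pd_comp hy]; simp only [efMat_zero_succ]
  rw [pd_mul (differentiableAt_comp_vr hr hB) (differentiableAt_nrm hr j),
    pd_zero_comp_vr hr hB, pd_zero_nrm hr]; ring

lemma pd_zero_succ_zero (hy : vr y ∈ D) (j : Fin 3) :
    pd 0 (fun w => g w j.succ 0) y = Dv B (vr y) * nrm y j := by
  rw [← h.pd_zero_zero_succ hy, h.pd_comp hy, h.pd_comp hy]; rfl

lemma pd_succ_zero_succ (hy : vr y ∈ D) (i j : Fin 3) :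
    pd i.succ (fun w => g w 0 j.succ) y
      = Dr B (vr y) * nrm y i * nrm y j + B (vr y) * prj y i j / radius y := by
  have hr := h.radius_pos hy
  have hB := h.differentiableAt h.contDiffOn_B hy
  rw [h.pd_comp hy]; simp only [efMat_zero_succ]
  rw [pd_mul (differentiableAt_comp_vr hr hB) (differentiableAt_nrm hr j),
    pd_succ_comp_vr hr hB, pd_succ_nrm hr, prj_comm j i]; ring

lemma pd_succ_succ_zero (hy : vr y ∈ D) (i j : Fin 3) :
    pd i.succ (fun w => g w j.succ 0) y
      = Dr B (vr y) * nrm y i * nrm y j + B (vr y) * prj y i j / radius y := by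
  rw [← h.pd_succ_zero_succ hy, h.pd_comp hy, h.pd_comp hy]; rfl

lemma pd_zero_succ_succ (hy : vr y ∈ D) (i j : Fin 3) :
    pd 0 (fun w => g w i.succ j.succ) y = 0 := by
  have hr := h.radius_pos hy
  rw [h.pd_comp hy]; simp only [efMat_succ_succ, prj]
  rw [pd_sub (differentiableAt_const _) ((differentiableAt_nrm hr i).fun_mul (differentiableAt_nrm hr j)),
    pd_const, pd_mul (differentiableAt_nrm hr i) (differentiableAt_nrm hr j),
    pd_zero_nrm hr, pd_zero_nrm hr]; ring

lemma pd_succ_succ_succ (hy : vr y ∈ D) (k i j : Fin 3) :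
    pd k.succ (fun w => g w i.succ j.succ) y
      = -((prj y i k * nrm y j + nrm y i * prj y j k) / radius y) := by
  have hr := h.radius_pos hy
  rw [h.pd_comp hy]; simp only [efMat_succ_succ, prj]
  rw [pd_sub (differentiableAt_const _) ((differentiableAt_nrm hr i).fun_mul (differentiableAt_nrm hr j)),
    pd_const, pd_mul (differentiableAt_nrm hr i) (differentiableAt_nrm hr j),
    pd_succ_nrm hr, pd_succ_nrm hr, prj, prj]; ring

lemma christoffel_zero_zero_zero (hy : vr y ∈ D) : christoffel g 0 0 0 y = gamVVV A B (vr y) := by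
  have hB := (h.B_pos _ hy).ne'
  have h1 : ∀ s : Fin 3, efInv A B y 0 s.succ * (pd 0 (fun z => g z s.succ 0) y
        + pd 0 (fun z => g z s.succ 0) y - pd s.succ (fun z => g z 0 0) y)
      = 2 * gamVVV A B (vr y) * (nrm y s * nrm y s) := by
    intro s
    rw [efInv_zero_succ, h.pd_zero_succ_zero hy, h.pd_succ_zero_zero hy, gamVVV]
    field_simp; ring
  rw [christoffel, h.inv_eq hy, Fin.sum_univ_succ, efInv_zero_zero]
  simp only [h1, ← Finset.mul_sum, sum_nrm_sq (h.radius_pos hy)]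
  ring

lemma christoffel_zero_zero_succ (hy : vr y ∈ D) (j : Fin 3) : christoffel g 0 0 j.succ y = 0 := by
  have h1 : ∀ s : Fin 3, efInv A B y 0 s.succ * (pd 0 (fun z => g z s.succ j.succ) y
        + pd j.succ (fun z => g z s.succ 0) y - pd s.succ (fun z => g z 0 j.succ) y) = 0 := by
    intro s
    rw [h.pd_zero_succ_succ hy, h.pd_succ_zero_succ hy, h.pd_succ_succ_zero hy, prj_comm s j]
    ring
  rw [christoffel, h.inv_eq hy, Fin.sum_univ_succ, efInv_zero_zero]
  simp [h1]

lemma christoffel_comm (hy : vr y ∈ D) (ρ μ ν : Fin 4) :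
    christoffel g ρ μ ν y = christoffel g ρ ν μ y := by
  have hs : ∀ w : Fin 4 → ℝ, efMat A B w μ ν = efMat A B w ν μ := by
    intro w
    refine Fin.cases ?_ (fun i => ?_) μ <;> refine Fin.cases ?_ (fun k => ?_) ν <;> try rfl
    simp only [efMat_succ_succ, prj_comm]
  have h2 : ∀ σ, pd σ (fun z => g z μ ν) y = pd σ (fun z => g z ν μ) y := by
    intro σ
    rw [h.pd_comp hy, h.pd_comp hy]; simp only [hs]
  simp only [christoffel, h2]
  congr 1; refine Finset.sum_congr rfl fun σ _ => ?_
  ring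

lemma christoffel_zero_succ_succ (hy : vr y ∈ D) (i j : Fin 3) :
    christoffel g 0 i.succ j.succ y = -(prj y i j / (radius y * B (vr y))) := by
  have hB := (h.B_pos _ hy).ne'
  have hr := h.radius_pos hy
  have h1 : ∀ s : Fin 3, efInv A B y 0 s.succ * (pd i.succ (fun z => g z s.succ j.succ) y
        + pd j.succ (fun z => g z s.succ i.succ) y - pd s.succ (fun z => g z i.succ j.succ) y)
      = -(2 * prj y i j / (radius y * B (vr y))) * (nrm y s * nrm y s) := by
    intro s
    rw [efInv_zero_succ, h.pd_succ_succ_succ hy, h.pd_succ_succ_succ hy, h.pd_succ_succ_succ hy,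
      prj_comm j i, prj_comm s i, prj_comm s j]
    field_simp; ring
  rw [christoffel, h.inv_eq hy, Fin.sum_univ_succ, efInv_zero_zero]
  simp only [h1, ← Finset.mul_sum, sum_nrm_sq hr]
  ring

/-- In every symbol Γ^i the bracket of metric derivatives is radial in its spatial index, so the
projection part of the inverse metric never contributes. This is why all Γ^i are multiples of n_i.
-/
lemma sum_efInv_mul_nrm (hy : vr y ∈ D) (i : Fin 3) (c : ℝ) :
    ∑ s : Fin 3, efInv A B y i.succ s.succ * (c * nrm y s) =
      A (vr y) / B (vr y) ^ 2 * nrm y i * c := by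
  have hr := h.radius_pos hy
  have h1 : ∀ s : Fin 3, efInv A B y i.succ s.succ * (c * nrm y s)
      = A (vr y) / B (vr y) ^ 2 * nrm y i * c * (nrm y s * nrm y s)
        + c * (nrm y s * prj y s i) := by
    intro s; rw [efInv_succ_succ, prj_comm]; ring
  simp only [h1, Finset.sum_add_distrib, ← Finset.mul_sum, sum_nrm_sq hr, sum_nrm_mul_prj hr]
  ring

lemma christoffel_succ_zero_zero (hy : vr y ∈ D) (i : Fin 3) :
    christoffel g i.succ 0 0 y = nrm y i * gamRVV A B (vr y) := by
  have hB := (h.B_pos _ hy).ne'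
  have h1 : ∀ s : Fin 3, (pd 0 (fun z => g z s.succ 0) y
        + pd 0 (fun z => g z s.succ 0) y - pd s.succ (fun z => g z 0 0) y)
      = (2 * Dv B (vr y) + Dr A (vr y)) * nrm y s := by
    intro s
    rw [h.pd_zero_succ_zero hy, h.pd_succ_zero_zero hy]
    ring
  rw [christoffel, h.inv_eq hy, Fin.sum_univ_succ, efInv_succ_zero]
  simp only [h1, h.sum_efInv_mul_nrm hy, h.pd_zero_zero_zero hy]
  rw [gamRVV]; field_simp; ring

lemma christoffel_succ_zero_succ (hy : vr y ∈ D) (i j : Fin 3) :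
    christoffel g i.succ 0 j.succ y = nrm y i * (-gamRVR A B (vr y) * nrm y j) := by
  have hB := (h.B_pos _ hy).ne'
  have h1 : ∀ s : Fin 3, (pd 0 (fun z => g z s.succ j.succ) y
        + pd j.succ (fun z => g z s.succ 0) y - pd s.succ (fun z => g z 0 j.succ) y)
      = 0 * nrm y s := by
    intro s
    rw [h.pd_zero_succ_succ hy, h.pd_succ_zero_succ hy, h.pd_succ_succ_zero hy, prj_comm s j]
    ring
  rw [christoffel, h.inv_eq hy, Fin.sum_univ_succ, efInv_succ_zero]
  simp only [h1, h.sum_efInv_mul_nrm hy, h.pd_zero_zero_succ hy, h.pd_succ_zero_zero hy]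
  rw [gamRVR]; field_simp; ring

lemma christoffel_succ_succ_succ (hy : vr y ∈ D) (i j k : Fin 3) :
    christoffel g i.succ j.succ k.succ y = nrm y i * (gamRRR B (vr y) * nrm y j * nrm y k
      + (1 - A (vr y) / B (vr y) ^ 2) / radius y * prj y j k) := by
  have hB := (h.B_pos _ hy).ne'
  have hr := h.radius_pos hy
  have h1 : ∀ s : Fin 3, (pd j.succ (fun z => g z s.succ k.succ) y
        + pd k.succ (fun z => g z s.succ j.succ) y - pd s.succ (fun z => g z j.succ k.succ) y)
      = (-2 * prj y j k / radius y) * nrm y s := by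
    intro s
    rw [h.pd_succ_succ_succ hy, h.pd_succ_succ_succ hy, h.pd_succ_succ_succ hy,
      prj_comm k j, prj_comm s k, prj_comm s j]
    ring
  rw [christoffel, h.inv_eq hy, Fin.sum_univ_succ, efInv_succ_zero]
  simp only [h1, h.sum_efInv_mul_nrm hy, h.pd_zero_succ_succ hy, h.pd_succ_zero_succ hy]
  rw [gamRRR, prj_comm k j]; field_simp; ring

lemma contDiffOn_gamVVV : ContDiffOn ℝ ∞ (gamVVV A B) D :=
  ((contDiffOn_Dv h.isOpen h.contDiffOn_B).add
    ((contDiffOn_Dr h.isOpen h.contDiffOn_A).div_const 2)).div h.contDiffOn_B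
      fun z hz => (h.B_pos z hz).ne'

lemma contDiffOn_gamRVR : ContDiffOn ℝ ∞ (gamRVR A B) D :=
  (contDiffOn_Dr h.isOpen h.contDiffOn_A).div (contDiffOn_const.mul h.contDiffOn_B)
      fun z hz => mul_ne_zero two_ne_zero (h.B_pos z hz).ne'

lemma contDiffOn_gamRRR : ContDiffOn ℝ ∞ (gamRRR B) D :=
  (contDiffOn_Dr h.isOpen h.contDiffOn_B).div h.contDiffOn_B fun z hz => (h.B_pos z hz).ne'

lemma contDiffOn_gamRVV : ContDiffOn ℝ ∞ (gamRVV A B) D :=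
  ((contDiffOn_Dv h.isOpen h.contDiffOn_A).div (contDiffOn_const.mul h.contDiffOn_B)
      fun z hz => mul_ne_zero two_ne_zero (h.B_pos z hz).ne').neg.add
    ((h.contDiffOn_A.div (h.contDiffOn_B.pow 2) fun z hz => pow_ne_zero 2 (h.B_pos z hz).ne').mul
      ((contDiffOn_Dv h.isOpen h.contDiffOn_B).add
        ((contDiffOn_Dr h.isOpen h.contDiffOn_A).div_const 2)))

/-- Obtained by differentiating the relation 2B · `gamRVR` = A_r, so that derivatives of quotients
do not appear. -/
lemma Dv_gamRVR {z : ℝ × ℝ} (hz : z ∈ D) :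
    2 * B z * Dv (gamRVR A B) z = Dv (Dr A) z - 2 * gamRVR A B z * Dv B z := by
  have h1 : Dv (fun w => gamRVR A B w * B w) z = Dv (fun w => (1 / 2 : ℝ) * Dr A w) z :=
    Dv_congr h.isOpen hz fun w hw => by
      have := (h.B_pos w hw).ne'
      simp only [gamRVR]; field_simp
  rw [Dv_mul (h.differentiableAt h.contDiffOn_gamRVR hz) (h.differentiableAt h.contDiffOn_B hz),
    Dv_mul (differentiableAt_const _)
      (h.differentiableAt (contDiffOn_Dr h.isOpen h.contDiffOn_A) hz)] at h1
  have h2 : Dv (fun _ => (1 / 2 : ℝ)) z = 0 := by simp [Dv]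
  rw [h2] at h1
  linear_combination 2 * h1

/-- Obtained by differentiating B · `gamRVV` = -A_v/2 + A · `gamVVV`. The derivative of `gamVVV`
comes with the factor A, which is zero on the horizon. -/
lemma Dr_gamRVV {z : ℝ × ℝ} (hz : z ∈ D) (hA : A z = 0) :
    2 * B z * Dr (gamRVV A B) z + 2 * gamRVV A B z * Dr B z
      = 2 * Dr A z * gamVVV A B z - Dr (Dv A) z := by
  have dA := h.differentiableAt h.contDiffOn_A hz
  have dB := h.differentiableAt h.contDiffOn_B hz
  have dα := h.differentiableAt h.contDiffOn_gamVVV hz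
  have dκ := h.differentiableAt h.contDiffOn_gamRVV hz
  have dAv := h.differentiableAt (contDiffOn_Dv h.isOpen h.contDiffOn_A) hz
  have h1 : Dr (fun w => gamRVV A B w * B w) z
      = Dr (fun w => (-1 / 2 : ℝ) * Dv A w + A w * gamVVV A B w) z :=
    Dr_congr h.isOpen hz fun w hw => by
      have := (h.B_pos w hw).ne'
      simp only [gamRVV, gamVVV]; field_simp
  rw [Dr_mul dκ dB, Dr_add ((differentiableAt_const _).fun_mul dAv) (dA.fun_mul dα),
    Dr_mul (differentiableAt_const _) dAv, Dr_mul dA dα] at h1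
  have h2 : Dr (fun _ => (-1 / 2 : ℝ)) z = 0 := by simp [Dr]
  rw [h2, hA] at h1
  linear_combination 2 * h1

/-- The index i is not summed. The split into P_ii and n_i² prepares the trace, in which these sum
to 2 and 1. -/
lemma riemann_succ_zero_succ_zero (hy : vr y ∈ D) (i : Fin 3) :
    riemann g i.succ 0 i.succ 0 y = prj y i i * (gamRVV A B (vr y) / radius y)
      + nrm y i * nrm y i * (Dr (gamRVV A B) (vr y) + Dv (gamRVR A B) (vr y)
        - gamRVR A B (vr y) * gamVVV A B (vr y) + gamRVV A B (vr y) * gamRRR B (vr y)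
        - gamRVR A B (vr y) ^ 2) := by
  have hr := h.radius_pos hy
  have dn := differentiableAt_nrm hr i
  have dκ := h.differentiableAt h.contDiffOn_gamRVV hy
  have dl := h.differentiableAt h.contDiffOn_gamRVR hy
  have e1 : pd i.succ (christoffel g i.succ 0 0) y
      = prj y i i * (gamRVV A B (vr y) / radius y)
        + nrm y i * nrm y i * Dr (gamRVV A B) (vr y) := by
    rw [pd_congr (G := fun y => nrm y i * gamRVV A B (vr y)) (by
        filter_upwards [h.mem_nhds hy] with w hw using h.christoffel_succ_zero_zero hw i),
      pd_mul dn (differentiableAt_comp_vr hr dκ), pd_succ_nrm hr, pd_succ_comp_vr hr dκ]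
    ring
  have e2 : pd 0 (christoffel g i.succ i.succ 0) y
      = -(nrm y i * nrm y i * Dv (gamRVR A B) (vr y)) := by
    rw [pd_congr (G := fun y => -(nrm y i * nrm y i * gamRVR A B (vr y))) (by
        filter_upwards [h.mem_nhds hy] with w hw
        rw [h.christoffel_comm hw, h.christoffel_succ_zero_succ hw i i]; ring),
      pd_neg, pd_mul (dn.fun_mul dn) (differentiableAt_comp_vr hr dl), pd_mul dn dn,
      pd_zero_nrm hr, pd_zero_comp_vr hr dl]
    ring
  have e3 : ∑ κ, christoffel g i.succ i.succ κ y * christoffel g κ 0 0 y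
      = nrm y i * nrm y i * (gamRVV A B (vr y) * gamRRR B (vr y)
        - gamRVR A B (vr y) * gamVVV A B (vr y)) := by
    have : ∀ k : Fin 3, christoffel g i.succ i.succ k.succ y * christoffel g k.succ 0 0 y
        = nrm y i * nrm y i * (gamRVV A B (vr y) * gamRRR B (vr y)) * (nrm y k * nrm y k)
          + nrm y i * gamRVV A B (vr y) * ((1 - A (vr y) / B (vr y) ^ 2) / radius y)
            * (nrm y k * prj y k i) := by
      intro k
      rw [h.christoffel_succ_succ_succ hy, h.christoffel_succ_zero_zero hy, prj_comm i k]; ring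
    rw [Fin.sum_univ_succ]
    simp only [this, Finset.sum_add_distrib, ← Finset.mul_sum, sum_nrm_sq hr, sum_nrm_mul_prj hr]
    rw [h.christoffel_comm hy, h.christoffel_succ_zero_succ hy, h.christoffel_zero_zero_zero hy]
    ring
  have e4 : ∑ κ, christoffel g i.succ 0 κ y * christoffel g κ i.succ 0 y
      = nrm y i * nrm y i * gamRVR A B (vr y) ^ 2 := by
    have : ∀ k : Fin 3, christoffel g i.succ 0 k.succ y * christoffel g k.succ i.succ 0 y
        = nrm y i * nrm y i * gamRVR A B (vr y) ^ 2 * (nrm y k * nrm y k) := by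
      intro k
      rw [h.christoffel_comm hy k.succ, h.christoffel_succ_zero_succ hy,
        h.christoffel_succ_zero_succ hy]; ring
    rw [Fin.sum_univ_succ]
    simp only [this, ← Finset.mul_sum, sum_nrm_sq hr]
    rw [h.christoffel_comm hy 0, h.christoffel_zero_zero_succ hy]
    ring
  rw [riemann, e1, e2, e3, e4]; ring

/-- On the apparent horizon `R_{vv} = -A_v / (r B)`. -/
lemma ricci_zero_zero (hy : vr y ∈ D) (hA : A (vr y) = 0) :
    ricci g 0 0 y = -(Dv A (vr y) / (radius y * B (vr y))) := by
  have hr := h.radius_pos hy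
  have hB := (h.B_pos _ hy).ne'
  have h0 : riemann g 0 0 0 0 y = 0 := by rw [riemann]; ring
  have h1 := h.Dv_gamRVR hy
  have h2 := h.Dr_gamRVV hy hA
  rw [ricci, Fin.sum_univ_succ, h0]
  simp only [h.riemann_succ_zero_succ_zero hy, Finset.sum_add_distrib, ← Finset.sum_mul,
    sum_nrm_sq hr, sum_prj_self hr]
  -- The radial part of the trace vanishes on the horizon: the derivatives A_vr cancel by symmetry
  -- and the remaining products cancel through the definitions of the symbols. What survives is 2 ·
  -- `gamRVV` / r, where `gamRVV` = -A_v/(2B) because A = 0.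
  have h3 : Dr (gamRVV A B) (vr y) + Dv (gamRVR A B) (vr y)
        - gamRVR A B (vr y) * gamVVV A B (vr y) + gamRVV A B (vr y) * gamRRR B (vr y)
        - gamRVR A B (vr y) ^ 2 = 0 := by
    have h4 : 2 * B (vr y) * (Dr (gamRVV A B) (vr y) + Dv (gamRVR A B) (vr y)
        - gamRVR A B (vr y) * gamVVV A B (vr y) + gamRVV A B (vr y) * gamRRR B (vr y)
        - gamRVR A B (vr y) ^ 2) = 0 := by
      have h5 : gamRRR B (vr y) * B (vr y) = Dr B (vr y) := by rw [gamRRR]; field_simp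
      have h6 : gamRVR A B (vr y) * (2 * B (vr y)) = Dr A (vr y) := by rw [gamRVR]; field_simp
      have h7 : gamVVV A B (vr y) * B (vr y) = Dv B (vr y) + gamRVR A B (vr y) * B (vr y) := by
        rw [gamVVV, gamRVR]; field_simp
      linear_combination h1 + h2 + Dv_Dr_comm h.isOpen h.contDiffOn_A hy
        + 2 * gamRVV A B (vr y) * h5 - gamVVV A B (vr y) * 2 * h6 + 2 * gamRVR A B (vr y) * h7
    simpa [hB] using h4
  rw [h3, gamRVV, hA]
  field_simp; ring

end IsEFMetric

end SphTrapped
end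


noncomputable section

namespace SphTrapped

/-! ### Contractions in an Eddington-Finkelstein metric -/

/-- The radial component `n · u` of the spatial part of `u`. -/
def rad (y u : Fin 4 → ℝ) : ℝ := ∑ i : Fin 3, nrm y i * u i.succ

/-- The Euclidean product of the spatial parts. -/
def spat (u w : Fin 4 → ℝ) : ℝ := ∑ i : Fin 3, u i.succ * w i.succ

lemma sum_nrm_mul_nrm (y u w : Fin 4 → ℝ) :
    ∑ i : Fin 3, ∑ j : Fin 3, nrm y i * nrm y j * u i.succ * w j.succ = rad y u * rad y w := by
  simp only [rad, Finset.sum_mul_sum]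
  exact Finset.sum_congr rfl fun i _ => Finset.sum_congr rfl fun j _ => by ring

lemma sum_prj_mul_mul (y u w : Fin 4 → ℝ) :
    ∑ i : Fin 3, ∑ j : Fin 3, prj y i j * u i.succ * w j.succ
      = spat u w - rad y u * rad y w := by
  rw [← sum_nrm_mul_nrm]
  simp [prj, sub_mul, Finset.sum_sub_distrib, spat]

/-- Used to split contractions into the vv, v-spatial, spatial-v and spatial-spatial blocks, in
which the symbols have uniform formulas. -/
lemma sum_sum_eq_of_blocks {b00 : ℝ} {b0 b1 : Fin 3 → ℝ} {b : Fin 3 → Fin 3 → ℝ}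
    {c : Fin 4 → Fin 4 → ℝ} (h00 : c 0 0 = b00) (h01 : ∀ j : Fin 3, c 0 j.succ = b0 j)
    (h10 : ∀ i : Fin 3, c i.succ 0 = b1 i) (h11 : ∀ i j : Fin 3, c i.succ j.succ = b i j) :
    ∑ μ, ∑ ν, c μ ν = b00 + ∑ j, b0 j + ∑ i, b1 i + ∑ i, ∑ j, b i j := by
  rw [Fin.sum_univ_succ]
  simp only [Fin.sum_univ_succ (n := 3), h00, h01, h10, h11, Finset.sum_add_distrib]
  ring

namespace IsEFMetric

variable {g : Components} {A B : ℝ × ℝ → ℝ} {D : Set (ℝ × ℝ)} (h : IsEFMetric g A B D)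
  {y : Fin 4 → ℝ}

include h

lemma pair_eq (hy : vr y ∈ D) (u w : Fin 4 → ℝ) :
    pair g y u w = -A (vr y) * (u 0 * w 0) + B (vr y) * (u 0 * rad y w + rad y u * w 0)
      + (spat u w - rad y u * rad y w) := by
  rw [pair, h.eq_efMat y hy, sum_sum_eq_of_blocks (c := fun μ ν => efMat A B y μ ν * u μ * w ν)
    (b00 := -A (vr y) * (u 0 * w 0)) (b0 := fun j => B (vr y) * u 0 * (nrm y j * w j.succ))
    (b1 := fun j => B (vr y) * w 0 * (nrm y j * u j.succ))
    (b := fun i j => prj y i j * u i.succ * w j.succ)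
    (by rw [efMat_zero_zero]; ring) (fun j => by rw [efMat_zero_succ]; ring)
    (fun j => by rw [efMat_succ_zero]; ring) (fun i j => by rw [efMat_succ_succ]),
    sum_prj_mul_mul, ← Finset.mul_sum, ← Finset.mul_sum]
  simp only [rad]; ring

lemma sum_christoffel_zero (hy : vr y ∈ D) (u w : Fin 4 → ℝ) :
    ∑ ν, ∑ ρ, christoffel g 0 ν ρ y * u ν * w ρ = gamVVV A B (vr y) * (u 0 * w 0)
      - (spat u w - rad y u * rad y w) / (radius y * B (vr y)) := by
  rw [sum_sum_eq_of_blocks (c := fun ν ρ => christoffel g 0 ν ρ y * u ν * w ρ)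
    (b00 := gamVVV A B (vr y) * (u 0 * w 0)) (b0 := fun _ => 0) (b1 := fun _ => 0)
    (b := fun i j => -(1 / (radius y * B (vr y))) * (prj y i j * u i.succ * w j.succ))
    (by rw [h.christoffel_zero_zero_zero hy]; ring)
    (fun j => by rw [h.christoffel_zero_zero_succ hy]; ring)
    (fun j => by rw [h.christoffel_comm hy, h.christoffel_zero_zero_succ hy]; ring)
    (fun i j => by rw [h.christoffel_zero_succ_succ hy]; ring)]
  simp only [← Finset.mul_sum, sum_prj_mul_mul]
  simp; ring

lemma sum_christoffel_succ (hy : vr y ∈ D) (k : Fin 3) (u w : Fin 4 → ℝ) :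
    ∑ ν, ∑ ρ, christoffel g k.succ ν ρ y * u ν * w ρ =
      nrm y k * (gamRVV A B (vr y) * (u 0 * w 0)
        - gamRVR A B (vr y) * (u 0 * rad y w + rad y u * w 0)
        + gamRRR B (vr y) * (rad y u * rad y w)
        + (1 - A (vr y) / B (vr y) ^ 2) / radius y * (spat u w - rad y u * rad y w)) := by
  rw [sum_sum_eq_of_blocks (c := fun ν ρ => christoffel g k.succ ν ρ y * u ν * w ρ)
    (b00 := nrm y k * gamRVV A B (vr y) * (u 0 * w 0))
    (b0 := fun j => -nrm y k * gamRVR A B (vr y) * u 0 * (nrm y j * w j.succ))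
    (b1 := fun j => -nrm y k * gamRVR A B (vr y) * w 0 * (nrm y j * u j.succ))
    (b := fun i j => nrm y k * gamRRR B (vr y) * (nrm y i * nrm y j * u i.succ * w j.succ)
      + nrm y k * ((1 - A (vr y) / B (vr y) ^ 2) / radius y)
        * (prj y i j * u i.succ * w j.succ))
    (by rw [h.christoffel_succ_zero_zero hy]; ring)
    (fun j => by rw [h.christoffel_succ_zero_succ hy]; ring)
    (fun j => by rw [h.christoffel_comm hy, h.christoffel_succ_zero_succ hy]; ring)
    (fun i j => by rw [h.christoffel_succ_succ_succ hy]; ring)]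
  simp only [Finset.sum_add_distrib, ← Finset.mul_sum, sum_prj_mul_mul, sum_nrm_mul_nrm]
  simp only [rad]; ring

end IsEFMetric

/-! ### Orthonormal frames -/

/-- `(E 0, E 1, η)` is an orthonormal frame of `ℝ³`. -/
structure IsFrame (η : Fin 3 → ℝ) (E : Fin 2 → Fin 3 → ℝ) : Prop where
  unit : ∑ i, η i * η i = 1
  orth : ∀ a, ∑ i, E a i * η i = 0
  ortho : ∀ a b, ∑ i, E a i * E b i = if a = b then 1 else 0

/-- The vector `t ∂_v + s η + z^a E_a`. -/
def fvec (η : Fin 3 → ℝ) (E : Fin 2 → Fin 3 → ℝ) (t s : ℝ) (z : Fin 2 → ℝ) : Fin 4 → ℝ :=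
  Fin.cons t (fun i => s * η i + ∑ a, z a * E a i)

section Fvec

variable {η : Fin 3 → ℝ} {E : Fin 2 → Fin 3 → ℝ}

@[simp] lemma fvec_zero (t s : ℝ) (z : Fin 2 → ℝ) : fvec η E t s z 0 = t := rfl

lemma fvec_succ (t s : ℝ) (z : Fin 2 → ℝ) (i : Fin 3) :
    fvec η E t s z i.succ = s * η i + ∑ a, z a * E a i := rfl

lemma fvec_smul (c t s : ℝ) (z : Fin 2 → ℝ) :
    c • fvec η E t s z = fvec η E (c * t) (c * s) (fun a => c * z a) := by
  funext μ
  refine Fin.cases ?_ (fun i => ?_) μ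
  · rfl
  · rw [Pi.smul_apply, fvec_succ, fvec_succ]
    simp only [smul_eq_mul, mul_add, Finset.mul_sum, mul_assoc]

lemma fvec_sub (t s t' s' : ℝ) (z z' : Fin 2 → ℝ) :
    fvec η E t s z - fvec η E t' s' z' = fvec η E (t - t') (s - s') (fun a => z a - z' a) := by
  funext μ
  refine Fin.cases ?_ (fun i => ?_) μ
  · rfl
  · rw [Pi.sub_apply, fvec_succ, fvec_succ, fvec_succ]
    simp only [sub_mul, Finset.sum_sub_distrib]
    ring

lemma fvec_sum {ι : Type*} (S : Finset ι) (t s : ι → ℝ) (z : ι → Fin 2 → ℝ) :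
    ∑ k ∈ S, fvec η E (t k) (s k) (z k)
      = fvec η E (∑ k ∈ S, t k) (∑ k ∈ S, s k) (fun a => ∑ k ∈ S, z k a) := by
  funext μ
  rw [Finset.sum_apply]
  refine Fin.cases ?_ (fun i => ?_) μ
  · rfl
  · simp only [fvec_succ, Finset.sum_add_distrib, Finset.sum_mul]
    congr 1
    rw [Finset.sum_comm]

variable (hE : IsFrame η E) {y : Fin 4 → ℝ}
include hE

lemma rad_fvec (hn : nrm y = η) (t s : ℝ) (z : Fin 2 → ℝ) : rad y (fvec η E t s z) = s := by
  have h1 := hE.unit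
  have h2 := hE.orth 0
  have h3 := hE.orth 1
  simp only [Fin.sum_univ_three] at h1 h2 h3
  simp only [rad, hn, fvec_succ, Fin.sum_univ_three, Fin.sum_univ_two]
  linear_combination s * h1 + z 0 * h2 + z 1 * h3

lemma spat_fvec (t s t' s' : ℝ) (z z' : Fin 2 → ℝ) :
    spat (fvec η E t s z) (fvec η E t' s' z') = s * s' + ∑ a, z a * z' a := by
  have h1 := hE.unit
  have h2 := hE.orth 0
  have h3 := hE.orth 1
  have h4 := hE.ortho 0 0
  have h5 := hE.ortho 0 1
  have h6 := hE.ortho 1 1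
  simp [Fin.sum_univ_three] at h1 h2 h3 h4 h5 h6
  simp only [spat, fvec_succ, Fin.sum_univ_three, Fin.sum_univ_two]
  linear_combination s * s' * h1 + (z 0 * s' + s * z' 0) * h2 + (z 1 * s' + s * z' 1) * h3
    + z 0 * z' 0 * h4 + (z 0 * z' 1 + z 1 * z' 0) * h5 + z 1 * z' 1 * h6

lemma IsEFMetric.pair_fvec {g : Components} {A B : ℝ × ℝ → ℝ} {D : Set (ℝ × ℝ)}
    (h : IsEFMetric g A B D) (hy : vr y ∈ D) (hn : nrm y = η) (t s t' s' : ℝ) (z z' : Fin 2 → ℝ) :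
    pair g y (fvec η E t s z) (fvec η E t' s' z')
      = -A (vr y) * (t * t') + B (vr y) * (t * s' + s * t') + ∑ a, z a * z' a := by
  rw [h.pair_eq hy, rad_fvec hE hn, rad_fvec hE hn, spat_fvec hE]
  simp only [fvec_zero]; ring

end Fvec

/-! ### The gnomonic parametrisation of a hemisphere -/

/-- `(1 + |l|²)^{-1/2}` -/
def gnoFactor (l : Fin 2 → ℝ) : ℝ := (Real.sqrt (1 + ∑ a, l a ^ 2))⁻¹

/-- The vector `η + l^a E_a`. -/
def gnoLin (η : Fin 3 → ℝ) (E : Fin 2 → Fin 3 → ℝ) (i : Fin 3) (l : Fin 2 → ℝ) : ℝ :=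
  η i + ∑ a, l a * E a i

/-- The unit vector `(η + l^a E_a) / |η + l^a E_a|`. -/
def gno (η : Fin 3 → ℝ) (E : Fin 2 → Fin 3 → ℝ) (i : Fin 3) (l : Fin 2 → ℝ) : ℝ :=
  gnoLin η E i l * gnoFactor l

section Gnomonic

variable (η : Fin 3 → ℝ) (E : Fin 2 → Fin 3 → ℝ)

lemma one_add_sum_sq_pos (l : Fin 2 → ℝ) : 0 < 1 + ∑ a, l a ^ 2 := by positivity

lemma gnoFactor_pos (l : Fin 2 → ℝ) : 0 < gnoFactor l :=
  inv_pos.2 (Real.sqrt_pos.2 (one_add_sum_sq_pos l))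

lemma gnoFactor_sq (l : Fin 2 → ℝ) : gnoFactor l * gnoFactor l * (1 + ∑ a, l a ^ 2) = 1 := by
  have h := one_add_sum_sq_pos l
  have h2 := Real.mul_self_sqrt h.le
  rw [gnoFactor, ← mul_inv, h2, inv_mul_cancel₀ h.ne']

lemma contDiff_gnoFactor {m : ℕ∞ω} : ContDiff ℝ m gnoFactor := by
  have h1 : ContDiff ℝ m (fun l : Fin 2 → ℝ => 1 + ∑ a, l a ^ 2) := by fun_prop
  exact (h1.sqrt fun l => (one_add_sum_sq_pos l).ne').inv
    fun l => (Real.sqrt_pos.2 (one_add_sum_sq_pos l)).ne'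

lemma contDiff_gnoLin {m : ℕ∞ω} (i : Fin 3) : ContDiff ℝ m (gnoLin η E i) := by
  unfold gnoLin; fun_prop

lemma contDiff_gno {m : ℕ∞ω} (i : Fin 3) : ContDiff ℝ m (gno η E i) :=
  (contDiff_gnoLin η E i).mul contDiff_gnoFactor

lemma gnoFactor_zero : gnoFactor 0 = 1 := by simp [gnoFactor]

lemma gno_zero (i : Fin 3) : gno η E i 0 = η i := by simp [gno, gnoLin, gnoFactor_zero]

/-- Implicit differentiation of q²(1 + |l|²) = 1, followed by division by the nonzero factor 2(1 +
|l|²)q. -/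
lemma pd_gnoFactor (a : Fin 2) (l : Fin 2 → ℝ) : pd a gnoFactor l = -(l a * gnoFactor l ^ 3) := by
  have h0 : DifferentiableAt ℝ gnoFactor l :=
    (contDiff_gnoFactor (m := 1)).differentiable (by norm_num) l
  have hq := gnoFactor_pos l
  have hc : ∀ b, DifferentiableAt ℝ (fun l : Fin 2 → ℝ => l b) l := fun b =>
    differentiableAt_apply b l
  have h1 : pd a (fun l => gnoFactor l * gnoFactor l * (1 + ∑ b, l b * l b)) l = 0 := by
    have : (fun l => gnoFactor l * gnoFactor l * (1 + ∑ b, l b * l b)) = fun _ => 1 := by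
      funext l
      have := gnoFactor_sq l
      simpa only [pow_two] using this
    rw [this, pd_const]
  have h2 : pd a (fun l : Fin 2 → ℝ => 1 + ∑ b, l b * l b) l = 2 * l a := by
    rw [pd_add (differentiableAt_const _) (by fun_prop), pd_const,
      pd_sum _ (fun b _ => (hc b).fun_mul (hc b))]
    simp [pd_mul (hc _) (hc _), pd_coord, Finset.sum_add_distrib]
    ring
  rw [pd_mul (h0.fun_mul h0) (by fun_prop), pd_mul h0 h0, h2] at h1
  have h3 := gnoFactor_sq l
  simp only [pow_two] at h3
  have h4 : 2 * (1 + ∑ b, l b * l b) * gnoFactor l * (pd a gnoFactor l + l a * gnoFactor l ^ 3) = 0 := by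
    linear_combination h1 + (2 * gnoFactor l ^ 2 * l a) * h3
  have h5 : (1 + ∑ b, l b * l b) ≠ 0 := by
    have := (one_add_sum_sq_pos l).ne'
    simpa only [pow_two] using this
  have h6 : pd a gnoFactor l + l a * gnoFactor l ^ 3 = 0 := by
    rcases mul_eq_zero.1 h4 with h | h
    · exact absurd h (mul_ne_zero (mul_ne_zero two_ne_zero h5) hq.ne')
    · exact h
  linarith

lemma pd_gnoLin (a : Fin 2) (i : Fin 3) (l : Fin 2 → ℝ) : pd a (gnoLin η E i) l = E a i := by
  have hc : ∀ b, DifferentiableAt ℝ (fun l : Fin 2 → ℝ => l b) l := fun b =>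
    differentiableAt_apply b l
  unfold gnoLin
  rw [pd_add (differentiableAt_const _) (by fun_prop), pd_const,
    pd_sum _ (fun b _ => (hc b).fun_mul (differentiableAt_const _))]
  simp [pd_mul (hc _) (differentiableAt_const _), pd_coord, pd_const]

lemma pd_gno (a : Fin 2) (i : Fin 3) (l : Fin 2 → ℝ) :
    pd a (gno η E i) l
      = E a i * gnoFactor l - gnoLin η E i l * (l a * gnoFactor l ^ 3) := by
  unfold gno
  rw [pd_mul ((contDiff_gnoLin η E i (m := 1)).differentiable (by norm_num) l)
    (contDiff_gnoFactor (m := 1).differentiable (by norm_num) l), pd_gnoLin, pd_gnoFactor]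
  ring

lemma pd_gno_zero (a : Fin 2) (i : Fin 3) : pd a (gno η E i) 0 = E a i := by
  simp [pd_gno, gnoFactor_zero]

/-- There is no tangential part: the Christoffel symbols of the round metric vanish at the centre of
a gnomonic parametrisation. Ordinary second derivatives at 0 are therefore the covariant Hessian. -/
lemma pd_pd_gno_zero (a b : Fin 2) (i : Fin 3) :
    pd a (fun l => pd b (gno η E i) l) 0 = if a = b then -η i else 0 := by
  have h1 : DifferentiableAt ℝ gnoFactor 0 :=
    contDiff_gnoFactor (m := 1).differentiable (by norm_num) _
  have h2 : DifferentiableAt ℝ (gnoLin η E i) 0 :=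
    (contDiff_gnoLin η E i (m := 1)).differentiable (by norm_num) _
  have h3 : DifferentiableAt ℝ (fun l : Fin 2 → ℝ => l b) 0 := differentiableAt_apply b _
  have h4 : DifferentiableAt ℝ (fun l => gnoFactor l ^ 3) 0 := h1.fun_pow 3
  simp only [pd_gno]
  rw [pd_sub ((differentiableAt_const _).fun_mul h1) (h2.fun_mul (h3.fun_mul h4)),
    pd_mul (differentiableAt_const _) h1, pd_mul h2 (h3.fun_mul h4), pd_mul h3 h4, pd_const,
    pd_gnoFactor, pd_coord]
  simp [gnoFactor_zero, gnoLin, eq_comm]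
  split_ifs <;> simp

end Gnomonic

end SphTrapped
end


noncomputable section

namespace SphTrapped

/-! ### Surfaces `v = V`, `r = ρ` over a hemisphere -/

/-- The parametrised surface `(V, ρ σ)`, where `σ` is the gnomonic parametrisation. -/
def polarSurf (η : Fin 3 → ℝ) (E : Fin 2 → Fin 3 → ℝ) (V ρ : (Fin 2 → ℝ) → ℝ)
    (l : Fin 2 → ℝ) : Fin 4 → ℝ :=
  Fin.cons (V l) (fun i => ρ l * gno η E i l)

section PolarSurf

variable {η : Fin 3 → ℝ} {E : Fin 2 → Fin 3 → ℝ} {V ρ : (Fin 2 → ℝ) → ℝ}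

lemma contDiff_polarSurf {m : ℕ∞ω} (hV : ContDiff ℝ m V) (hρ : ContDiff ℝ m ρ) :
    ContDiff ℝ m (polarSurf η E V ρ) := by
  refine contDiff_pi.2 fun μ => ?_
  refine Fin.cases ?_ (fun i => ?_) μ
  · exact hV
  · exact hρ.mul (contDiff_gno η E i)

lemma tangentVec_polarSurf_succ (hρ : ContDiff ℝ 2 ρ) (b : Fin 2) (i : Fin 3) (l : Fin 2 → ℝ) :
    tangentVec (polarSurf η E V ρ) b l i.succ
      = pd b ρ l * gno η E i l + ρ l * pd b (gno η E i) l :=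
  pd_mul (hρ.differentiable (by norm_num) l)
    ((contDiff_gno η E i (m := 1)).differentiable (by norm_num) l)

/-- Only the centre l = 0 is needed, because each point of a deformed sphere is the centre of a
parametrisation of its own. -/
lemma tangentVec_polarSurf (hρ : ContDiff ℝ 2 ρ) (b : Fin 2) :
    tangentVec (polarSurf η E V ρ) b 0
      = fvec η E (pd b V 0) (pd b ρ 0) (fun c => if b = c then ρ 0 else 0) := by
  funext μ
  refine Fin.cases ?_ (fun i => ?_) μ
  · rfl
  · rw [tangentVec_polarSurf_succ hρ, fvec_succ, gno_zero, pd_gno_zero]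
    simp

lemma pd_tangentVec_polarSurf (hρ : ContDiff ℝ 2 ρ) (a b : Fin 2) :
    (fun μ => pd a (fun l => tangentVec (polarSurf η E V ρ) b l μ) 0)
      = fvec η E (pd a (fun l => pd b V l) 0)
        (pd a (fun l => pd b ρ l) 0 - if a = b then ρ 0 else 0)
        (fun c => (if b = c then pd a ρ 0 else 0) + if a = c then pd b ρ 0 else 0) := by
  funext μ
  refine Fin.cases ?_ (fun i => ?_) μ
  · rfl
  · have h1 : DifferentiableAt ℝ ρ 0 := hρ.differentiable (by norm_num) _
    have h2 : DifferentiableAt ℝ (fun l => pd b ρ l) 0 :=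
      (contDiff_pd (m := 1) hρ).differentiable (by norm_num) _
    have h3 : DifferentiableAt ℝ (gno η E i) 0 :=
      (contDiff_gno η E i (m := 1)).differentiable (by norm_num) _
    have h4 : DifferentiableAt ℝ (fun l => pd b (gno η E i) l) 0 :=
      (contDiff_pd (m := 1) (contDiff_gno η E i)).differentiable (by norm_num) _
    simp only [tangentVec_polarSurf_succ hρ]
    rw [pd_add (h2.fun_mul h3) (h1.fun_mul h4), pd_mul h2 h3, pd_mul h1 h4, pd_pd_gno_zero, fvec_succ,
      pd_gno_zero, pd_gno_zero, gno_zero]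
    simp only [add_mul, Finset.sum_add_distrib, ite_mul, zero_mul, Finset.sum_ite_eq,
      Finset.mem_univ, if_true]
    split_ifs <;> ring

end PolarSurf

/-! ### The mean curvature vector in terms of the deformation profile -/

section Profile

variable (A B : ℝ × ℝ → ℝ) (ν b : ℝ)

/-- The data `(ε, A / ε, (v, r), df, ddf)` at a point of a deformed sphere
`v = v₀ + ε ν f`, `r = r₀ + ε b f`. -/
abbrev Profile : Type :=
  ℝ × ℝ × (ℝ × ℝ) × (Fin 2 → ℝ) × (Fin 2 → Fin 2 → ℝ)

namespace Profile

def eps (X : Profile) : ℝ := X.1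
-- An independent coordinate rather than the quotient A/ε, so that the expressions below make sense
-- and are continuous at ε = 0.
def aOver (X : Profile) : ℝ := X.2.1
def pt (X : Profile) : ℝ × ℝ := X.2.2.1
def df (X : Profile) : Fin 2 → ℝ := X.2.2.2.1
def ddf (X : Profile) : Fin 2 → Fin 2 → ℝ := X.2.2.2.2

/-- The first fundamental form. -/
def gam (X : Profile) : Matrix (Fin 2) (Fin 2) ℝ := Matrix.of fun i j =>
  (if i = j then X.pt.2 * X.pt.2 else 0) + X.eps ^ 2 *
    (-(X.eps * X.aOver) * ν ^ 2 + 2 * B X.pt * ν * b) * (X.df i * X.df j)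

/-- The `v`-component of `∇_i e_j`. -/
def cov0 (X : Profile) (i j : Fin 2) : ℝ :=
  X.eps * ν * X.ddf i j + gamVVV A B X.pt * (X.eps * ν) ^ 2 * (X.df i * X.df j)
    - if i = j then X.pt.2 / B X.pt else 0

/-- The radial component of `∇_i e_j`, divided by `ε`. -/
def cov1 (X : Profile) (i j : Fin 2) : ℝ :=
  b * X.ddf i j - (if i = j then X.aOver / B X.pt ^ 2 * X.pt.2 else 0)
    + X.eps * (gamRVV A B X.pt * ν ^ 2 - 2 * gamRVR A B X.pt * ν * b + gamRRR B X.pt * b ^ 2)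
      * (X.df i * X.df j)

/-- The angular components of `∇_i e_j`, divided by `ε`. -/
def cov2 (X : Profile) (i j k : Fin 2) : ℝ :=
  (if j = k then b * X.df i else 0) + if i = k then b * X.df j else 0

/-- The product of `∇_i e_j` with `e_k`, divided by `ε`. -/
def tang (X : Profile) (i j k : Fin 2) : ℝ :=
  -(X.eps * X.aOver) * (X.cov0 A B ν i j * (ν * X.df k))
    + B X.pt * (X.cov0 A B ν i j * (b * X.df k) + X.eps * X.cov1 A B ν b i j * (ν * X.df k))
    + X.pt.2 * X.cov2 b i j k

/-- The `v`-component of the mean curvature vector. -/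
def mean0 (X : Profile) : ℝ := ∑ i, ∑ j, (X.gam B ν b)⁻¹ i j *
  ((∑ k, ∑ m, (X.gam B ν b)⁻¹ k m * X.tang A B ν b i j k * (X.eps ^ 2 * ν * X.df m))
    - X.cov0 A B ν i j)

/-- The radial component of the mean curvature vector, divided by `ε`. -/
def mean1 (X : Profile) : ℝ := ∑ i, ∑ j, (X.gam B ν b)⁻¹ i j *
  ((∑ k, ∑ m, (X.gam B ν b)⁻¹ k m * X.tang A B ν b i j k * (X.eps * b * X.df m))
    - X.cov1 A B ν b i j)

/-- The angular components of the mean curvature vector, divided by `ε`. -/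
def mean2 (X : Profile) (n : Fin 2) : ℝ := ∑ i, ∑ j, (X.gam B ν b)⁻¹ i j *
  ((∑ k, ∑ m, (X.gam B ν b)⁻¹ k m * X.tang A B ν b i j k * (if m = n then X.pt.2 else 0))
    - X.cov2 b i j n)

/-- The norm `g(H, H)` of the mean curvature vector, divided by `ε`. -/
def meanSq (X : Profile) : ℝ :=
  -X.aOver * (X.mean0 A B ν b * X.mean0 A B ν b)
    + 2 * B X.pt * X.mean0 A B ν b * X.mean1 A B ν b
    + X.eps * ∑ n, X.mean2 A B ν b n * X.mean2 A B ν b n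

end Profile

/-- The mean curvature vector in the frame. -/
theorem meanCurvature_polarSurf {A B : ℝ × ℝ → ℝ} {ν b : ℝ} {g : Components} {D : Set (ℝ × ℝ)}
    (h : IsEFMetric g A B D) {η : Fin 3 → ℝ} {E : Fin 2 → Fin 3 → ℝ} (hE : IsFrame η E)
    {φ : (Fin 2 → ℝ) → ℝ} (hφ : ContDiff ℝ 2 φ) (z : ℝ × ℝ) (ε a : ℝ)
    (hz : (z.1 + ε * ν * φ 0, z.2 + ε * b * φ 0) ∈ D)
    (ha : A (z.1 + ε * ν * φ 0, z.2 + ε * b * φ 0) = ε * a)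
    {X : Profile} (hX : X = (ε, a, (z.1 + ε * ν * φ 0, z.2 + ε * b * φ 0),
      fun i => pd i φ 0, fun i j => pd i (fun l => pd j φ l) 0)) :
    firstForm g (polarSurf η E (fun l => z.1 + ε * ν * φ l) (fun l => z.2 + ε * b * φ l)) 0
      = X.gam B ν b ∧
    meanCurvature g (polarSurf η E (fun l => z.1 + ε * ν * φ l) (fun l => z.2 + ε * b * φ l)) 0
      = fvec η E (X.mean0 A B ν b) (ε * X.mean1 A B ν b) (fun n => ε * X.mean2 A B ν b n) := by
  set V : (Fin 2 → ℝ) → ℝ := fun l => z.1 + ε * ν * φ l with hV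
  set ρ : (Fin 2 → ℝ) → ℝ := fun l => z.2 + ε * b * φ l with hρ
  have hVc : ContDiff ℝ 2 V := by fun_prop
  have hρc : ContDiff ℝ 2 ρ := by fun_prop
  have hφd : Differentiable ℝ φ := hφ.differentiable (by norm_num)
  have hpd : ∀ (i : Fin 2), Differentiable ℝ (fun l => pd i φ l) := fun i =>
    (contDiff_pd (m := 1) hφ).differentiable (by norm_num)
  have hp : ∀ (c d : ℝ) (i : Fin 2) (l : Fin 2 → ℝ),
      pd i (fun l => c + d * φ l) l = d * pd i φ l := by
    intro c d i l
    rw [pd_add (differentiableAt_const _) ((differentiableAt_const _).fun_mul (hφd l)), pd_const,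
      pd_const_mul _ (hφd l), zero_add]
  have hpp : ∀ (c d : ℝ) (i j : Fin 2),
      pd i (fun l => pd j (fun l => c + d * φ l) l) 0 = d * pd i (fun l => pd j φ l) 0 := by
    intro c d i j
    simp only [hp]
    rw [pd_const_mul _ (hpd j 0)]
  have hr : 0 < ρ 0 := h.r_pos _ hz
  have hy0 : polarSurf η E V ρ 0 0 = V 0 := rfl
  have hys : ∀ i : Fin 3, polarSurf η E V ρ 0 i.succ = ρ 0 * η i := by
    intro i; rw [← gno_zero η E i]; rfl
  have hrad : radius (polarSurf η E V ρ 0) = ρ 0 := by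
    rw [radius]; simp only [hys]
    rw [show ∑ i, (ρ 0 * η i) ^ 2 = ρ 0 ^ 2 * ∑ i, η i * η i by
      rw [Finset.mul_sum]; exact Finset.sum_congr rfl fun i _ => by ring, hE.unit, mul_one,
      Real.sqrt_sq hr.le]
  have hvr : vr (polarSurf η E V ρ 0) = (V 0, ρ 0) := by rw [vr, hrad, hy0]
  have hnrm : nrm (polarSurf η E V ρ 0) = η := by
    funext i; rw [nrm, hrad, hys]; field_simp
  have hy : vr (polarSurf η E V ρ 0) ∈ D := by rw [hvr]; exact hz
  have hpt : X.pt = (V 0, ρ 0) := by rw [hX]; rfl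
  have hpt2 : X.pt.2 = ρ 0 := by rw [hpt]
  have heps : X.eps = ε := by rw [hX]; rfl
  have haO : X.aOver = a := by rw [hX]; rfl
  have hdf : ∀ i, X.df i = pd i φ 0 := by intro i; rw [hX]; rfl
  have hddf : ∀ i j, X.ddf i j = pd i (fun l => pd j φ l) 0 := by intro i j; rw [hX]; rfl
  have hA : A (V 0, ρ 0) = ε * a := ha
  have htan : ∀ i, tangentVec (polarSurf η E V ρ) i 0
      = fvec η E (ε * ν * X.df i) (ε * b * X.df i) (fun c => if i = c then ρ 0 else 0) := by
    intro i; rw [tangentVec_polarSurf hρc, hp, hp, hdf]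
  have hgam : firstForm g (polarSurf η E V ρ) 0 = X.gam B ν b := by
    ext i j
    rw [firstForm, Matrix.of_apply, htan, htan, h.pair_fvec hE hy hnrm, hvr, hA, Profile.gam,
      Matrix.of_apply, hpt, heps, haO]
    simp only [ite_mul, zero_mul, Finset.sum_ite_eq, Finset.mem_univ, if_true, mul_ite, mul_zero]
    by_cases hij : i = j
    · subst hij; simp; ring
    · simp [hij]; ring
  have hcov : ∀ i j, covTangent g (polarSurf η E V ρ) i j 0
      = fvec η E (X.cov0 A B ν i j) (ε * X.cov1 A B ν b i j) (fun k => ε * X.cov2 b i j k) := by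
    intro i j
    have e0 := pd_tangentVec_polarSurf (η := η) (E := E) (V := V) hρc i j
    have hB := (h.B_pos _ hz).ne'
    have hsp : spat (tangentVec (polarSurf η E V ρ) i 0) (tangentVec (polarSurf η E V ρ) j 0)
        = ε * b * X.df i * (ε * b * X.df j) + if i = j then ρ 0 * ρ 0 else 0 := by
      rw [htan, htan, spat_fvec hE]
      simp only [ite_mul, zero_mul, Finset.sum_ite_eq, Finset.mem_univ, if_true, mul_ite, mul_zero]
    funext μ
    rw [covTangent, congrFun e0 μ]
    refine Fin.cases ?_ (fun k => ?_) μ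
    · rw [h.sum_christoffel_zero hy, hsp, htan, htan, rad_fvec hE hnrm, rad_fvec hE hnrm, hvr, hrad]
      simp only [fvec_zero]
      rw [hpp, Profile.cov0, hpt, heps, hddf]
      have : ρ 0 * B (V 0, ρ 0) ≠ 0 := mul_ne_zero hr.ne' hB
      split_ifs
      · field_simp; ring
      · ring
    -- The second derivative of the position contributes -ρδ_ij, and the symbol contributes (1 -
    -- A/B²)ρδ_ij. Their sum is -(A/B²)ρδ_ij with A = εa, which is why a factor ε splits off the
    -- radial component.
    · rw [h.sum_christoffel_succ hy, hsp, htan, htan, rad_fvec hE hnrm, rad_fvec hE hnrm, hvr, hrad]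
      simp only [fvec_zero]
      rw [fvec_succ, fvec_succ, hpp, hp, hp, hnrm, Profile.cov1, hpt, heps, hddf, haO, hA]
      simp only [Profile.cov2, ← hdf, mul_add, add_mul, mul_ite, ite_mul, mul_zero, zero_mul,
        Finset.sum_add_distrib, Finset.sum_ite_eq, Finset.mem_univ, if_true]
      split_ifs
      · field_simp; ring
      · ring
  refine ⟨hgam, ?_⟩
  have htg : ∀ i j k, pair g (polarSurf η E V ρ 0) (covTangent g (polarSurf η E V ρ) i j 0)
      (tangentVec (polarSurf η E V ρ) k 0) = ε * X.tang A B ν b i j k := by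
    intro i j k
    rw [hcov, htan, h.pair_fvec hE hy hnrm, hvr, hA, Profile.tang, hpt, heps, haO]
    simp only [mul_ite, mul_zero, Finset.sum_ite_eq, Finset.mem_univ, if_true]
    ring
  have hshape : ∀ i j, shapeTensor g (polarSurf η E V ρ) i j 0 = fvec η E
      ((∑ k, ∑ m, (X.gam B ν b)⁻¹ k m * X.tang A B ν b i j k * (X.eps ^ 2 * ν * X.df m))
        - X.cov0 A B ν i j)
      (ε * ((∑ k, ∑ m, (X.gam B ν b)⁻¹ k m * X.tang A B ν b i j k * (X.eps * b * X.df m))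
        - X.cov1 A B ν b i j))
      (fun n => ε * ((∑ k, ∑ m, (X.gam B ν b)⁻¹ k m * X.tang A B ν b i j k *
        (if m = n then X.pt.2 else 0)) - X.cov2 b i j n)) := by
    intro i j
    rw [shapeTensor, hgam]
    simp only [htg]
    rw [hcov]
    simp only [htan, fvec_smul, fvec_sum, fvec_sub, heps, hpt2]
    simp only [mul_sub, Finset.mul_sum]
    congr 1
    · congr 1
      exact Finset.sum_congr rfl fun k _ => Finset.sum_congr rfl fun m _ => by ring
    · congr 1
      exact Finset.sum_congr rfl fun k _ => Finset.sum_congr rfl fun m _ => by ring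
    · funext n; congr 1
      exact Finset.sum_congr rfl fun k _ => Finset.sum_congr rfl fun m _ => by ring
  rw [meanCurvature, hgam]
  simp only [hshape, fvec_smul, fvec_sum]
  congr 1
  · rw [Profile.mean1, Finset.mul_sum]
    refine Finset.sum_congr rfl fun i _ => ?_
    rw [Finset.mul_sum]
    exact Finset.sum_congr rfl fun j _ => by ring
  · funext n
    rw [Profile.mean2, Finset.mul_sum]
    refine Finset.sum_congr rfl fun i _ => ?_
    rw [Finset.mul_sum]
    exact Finset.sum_congr rfl fun j _ => by ring

end Profile

end SphTrapped
end


/-! ### The limit ε → 0, openness of the sign conditions, and uniformity over compact sets of jets.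
-/

noncomputable section

open Filter Topology

namespace SphTrapped

namespace Profile

variable {A B : ℝ × ℝ → ℝ} {ν b : ℝ} {g : Components} {D : Set (ℝ × ℝ)}

/-- The deformed sphere is spacelike at the point, and its mean curvature vector has `H^v > 0`
and norm of the sign of `s`. -/
def Good (A B : ℝ × ℝ → ℝ) (ν b : ℝ) (D : Set (ℝ × ℝ)) (s : ℝ) (X : Profile) : Prop :=
  X.pt ∈ D ∧ 0 < X.gam B ν b 0 0 ∧ 0 < (X.gam B ν b).det ∧ 0 < X.mean0 A B ν b ∧
    0 < s * X.meanSq A B ν b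

lemma continuous_eps : Continuous eps := by unfold eps; fun_prop
lemma continuous_aOver : Continuous aOver := by unfold aOver; fun_prop
lemma continuous_pt : Continuous pt := by unfold pt; fun_prop
lemma continuous_df : Continuous df := by unfold df; fun_prop
lemma continuous_ddf : Continuous ddf := by unfold ddf; fun_prop

section Continuity

variable (h : IsEFMetric g A B D) {X : Profile} (hX : X.pt ∈ D)
include h hX

lemma continuousAt_pt {φ : ℝ × ℝ → ℝ} (hφ : ContDiffOn ℝ ∞ φ D) :
    ContinuousAt φ X.pt :=
  hφ.continuousOn.continuousAt (h.isOpen.mem_nhds hX)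

lemma continuousAt_gam : ContinuousAt (fun X : Profile => X.gam B ν b) X := by
  have h1 := continuousAt_pt h hX h.contDiffOn_B
  have h2 := continuous_eps.continuousAt (x := X)
  have h3 := continuous_aOver.continuousAt (x := X)
  have h4 := continuous_pt.continuousAt (x := X)
  have h5 := continuous_df.continuousAt (x := X)
  refine continuousAt_pi.2 fun i => continuousAt_pi.2 fun j => ?_
  simp only [gam, Matrix.of_apply]
  have h6 : ∀ i, ContinuousAt (fun X : Profile => X.df i) X := fun i => continuousAt_pi.1 h5 i
  have h7 := h6 i
  have h8 := h6 j
  split_ifs <;> fun_prop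

lemma continuousAt_gam_inv (hdet : (X.gam B ν b).det ≠ 0) (i j : Fin 2) :
    ContinuousAt (fun X : Profile => (X.gam B ν b)⁻¹ i j) X := by
  have h1 := continuousAt_gam (ν := ν) (b := b) h hX
  have h2 : ContinuousAt (fun X : Profile => (X.gam B ν b).det⁻¹) X :=
    ((continuous_id.matrix_det.continuousAt).comp h1).inv₀ hdet
  have h3 : ContinuousAt (fun X : Profile => (X.gam B ν b).adjugate i j) X :=
    ((continuous_id.matrix_adjugate.matrix_elem i j).continuousAt).comp h1
  simp only [Matrix.inv_def, Ring.inverse_eq_inv', Matrix.smul_apply, smul_eq_mul]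
  exact h2.mul h3

lemma continuousAt_cov0 (i j : Fin 2) :
    ContinuousAt (fun X : Profile => X.cov0 A B ν i j) X := by
  have h1 := continuousAt_pt h hX h.contDiffOn_B
  have h2 := continuous_eps.continuousAt (x := X)
  have h4 := continuous_pt.continuousAt (x := X)
  have h5 : ∀ i, ContinuousAt (fun X : Profile => X.df i) X :=
    fun i => continuousAt_pi.1 continuous_df.continuousAt i
  have h6 : ∀ i j, ContinuousAt (fun X : Profile => X.ddf i j) X :=
    fun i j => continuousAt_pi.1 (continuousAt_pi.1 continuous_ddf.continuousAt i) j
  have h7 := h5 i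
  have h8 := h5 j
  have h9 := h6 i j
  have h10 := continuousAt_pt h hX h.contDiffOn_gamVVV
  have hB := (h.B_pos _ hX).ne'
  simp only [cov0]
  split_ifs <;> fun_prop (disch := assumption)

lemma continuousAt_cov1 (i j : Fin 2) :
    ContinuousAt (fun X : Profile => X.cov1 A B ν b i j) X := by
  have h1 := continuousAt_pt h hX h.contDiffOn_B
  have h2 := continuous_eps.continuousAt (x := X)
  have h3 := continuous_aOver.continuousAt (x := X)
  have h4 := continuous_pt.continuousAt (x := X)
  have h5 : ∀ i, ContinuousAt (fun X : Profile => X.df i) X :=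
    fun i => continuousAt_pi.1 continuous_df.continuousAt i
  have h6 : ∀ i j, ContinuousAt (fun X : Profile => X.ddf i j) X :=
    fun i j => continuousAt_pi.1 (continuousAt_pi.1 continuous_ddf.continuousAt i) j
  have h7 := h5 i
  have h8 := h5 j
  have h9 := h6 i j
  have h10 := continuousAt_pt h hX h.contDiffOn_gamRVV
  have h11 := continuousAt_pt h hX h.contDiffOn_gamRVR
  have h12 := continuousAt_pt h hX h.contDiffOn_gamRRR
  have hB := pow_ne_zero 2 (h.B_pos _ hX).ne'
  simp only [cov1]
  split_ifs <;> fun_prop (disch := assumption)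

omit h hX in
lemma continuous_cov2 (i j k : Fin 2) : Continuous (fun X : Profile => X.cov2 b i j k) := by
  have h5 : ∀ i, Continuous (fun X : Profile => X.df i) := continuous_pi_iff.1 continuous_df
  have h7 := h5 i
  have h8 := h5 j
  simp only [cov2]
  split_ifs <;> fun_prop

lemma continuousAt_tang (i j k : Fin 2) :
    ContinuousAt (fun X : Profile => X.tang A B ν b i j k) X := by
  have h1 := continuousAt_pt h hX h.contDiffOn_B
  have h2 := continuous_eps.continuousAt (x := X)
  have h3 := continuous_aOver.continuousAt (x := X)
  have h4 := continuous_pt.continuousAt (x := X)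
  have h5 : ContinuousAt (fun X : Profile => X.df k) X :=
    continuousAt_pi.1 continuous_df.continuousAt k
  have h6 := continuousAt_cov0 (ν := ν) h hX i j
  have h7 := continuousAt_cov1 (ν := ν) (b := b) h hX i j
  have h8 := (continuous_cov2 (b := b) i j k).continuousAt (x := X)
  simp only [tang]
  fun_prop

lemma continuousAt_mean0 (hdet : (X.gam B ν b).det ≠ 0) :
    ContinuousAt (fun X : Profile => X.mean0 A B ν b) X := by
  have h2 := continuous_eps.continuousAt (x := X)
  have h5 : ∀ k, ContinuousAt (fun X : Profile => X.df k) X := fun k =>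
    continuousAt_pi.1 continuous_df.continuousAt k
  have h6 := continuousAt_cov0 (ν := ν) h hX
  have h8 := continuousAt_tang (ν := ν) (b := b) h hX
  have h9 := continuousAt_gam_inv h hX hdet
  simp only [mean0]
  fun_prop

lemma continuousAt_mean1 (hdet : (X.gam B ν b).det ≠ 0) :
    ContinuousAt (fun X : Profile => X.mean1 A B ν b) X := by
  have h2 := continuous_eps.continuousAt (x := X)
  have h5 : ∀ k, ContinuousAt (fun X : Profile => X.df k) X := fun k =>
    continuousAt_pi.1 continuous_df.continuousAt k
  have h6 := continuousAt_cov1 (ν := ν) (b := b) h hX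
  have h8 := continuousAt_tang (ν := ν) (b := b) h hX
  have h9 := continuousAt_gam_inv h hX hdet
  simp only [mean1]
  fun_prop

lemma continuousAt_mean2 (hdet : (X.gam B ν b).det ≠ 0) (n : Fin 2) :
    ContinuousAt (fun X : Profile => X.mean2 A B ν b n) X := by
  have h5 : ∀ m, ContinuousAt (fun X : Profile => if m = n then X.pt.2 else 0) X := by
    intro m
    have := continuous_pt.continuousAt (x := X)
    split_ifs <;> fun_prop
  have h6 := fun i j => (continuous_cov2 (b := b) i j n).continuousAt (x := X)
  have h8 := continuousAt_tang (ν := ν) (b := b) h hX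
  have h9 := continuousAt_gam_inv h hX hdet
  simp only [mean2]
  fun_prop

lemma continuousAt_meanSq (hdet : (X.gam B ν b).det ≠ 0) :
    ContinuousAt (fun X : Profile => X.meanSq A B ν b) X := by
  have h1 := continuousAt_pt h hX h.contDiffOn_B
  have h2 := continuous_eps.continuousAt (x := X)
  have h3 := continuous_aOver.continuousAt (x := X)
  have hp := continuous_pt.continuousAt (x := X)
  have h4 := continuousAt_mean0 h hX hdet
  have h5 := continuousAt_mean1 h hX hdet
  have h6 := continuousAt_mean2 h hX hdet
  simp only [meanSq]
  fun_prop

end Continuity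

/-- The condition consists of membership in an open set and strict inequalities between functions
continuous at X. Positivity of the determinant supplies the continuity of the inverse of the first
fundamental form. -/
lemma Good.eventually (h : IsEFMetric g A B D) {s : ℝ} {X : Profile} (hX : Good A B ν b D s X) :
    ∀ᶠ Y in 𝓝 X, Good A B ν b D s Y := by
  obtain ⟨h1, h2, h3, h4, h5⟩ := hX
  have hg := continuousAt_gam (ν := ν) (b := b) h h1
  have c1 := continuous_pt.continuousAt.eventually (h.isOpen.mem_nhds h1)
  have c2 := (continuousAt_pi.1 (continuousAt_pi.1 hg 0) 0).eventually (lt_mem_nhds h2)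
  have c3 := (((continuous_id.matrix_det.continuousAt).comp hg)).eventually (lt_mem_nhds h3)
  have c4 := (continuousAt_mean0 h h1 h3.ne').eventually (lt_mem_nhds h4)
  have c5 := ((continuousAt_meanSq h h1 h3.ne').const_mul s).eventually (lt_mem_nhds h5)
  filter_upwards [c1, c2, c3, c4, c5] with Y d1 d2 d3 d4 d5 using ⟨d1, d2, d3, d4, d5⟩

/-- At ε = 0 the first fundamental form is r²δ and the tangential corrections to H^v and H^r vanish.
So H^v = 2/(rB) and H^r/ε = 2a/(B²r) - b tr(dd)/r², and in g(H,H)/ε the two terms in a combine to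
4a/(r²B²). -/
lemma good_of_eps_eq_zero (h : IsEFMetric g A B D) {s a : ℝ} {z : ℝ × ℝ} (hz : z ∈ D)
    (d : Fin 2 → ℝ) (dd : Fin 2 → Fin 2 → ℝ)
    (hs : 0 < s * (a / B z ^ 2 - b * (dd 0 0 + dd 1 1) / z.2)) :
    Good A B ν b D s (0, a, z, d, dd) := by
  have hr := h.r_pos z hz
  have hB := h.B_pos z hz
  set X : Profile := (0, a, z, d, dd) with hX
  have e1 : X.eps = 0 := rfl
  have e2 : X.pt = z := rfl
  have e3 : X.aOver = a := rfl
  have e4 : X.ddf = dd := rfl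
  have hg : X.gam B ν b = Matrix.diagonal (fun _ => z.2 * z.2) := by
    ext i j
    rw [gam, Matrix.of_apply, e1, e2, Matrix.diagonal_apply]; simp
  have hgi : (X.gam B ν b)⁻¹ = Matrix.diagonal (fun _ => (z.2 * z.2)⁻¹) := by
    rw [hg]
    apply Matrix.inv_eq_right_inv
    rw [Matrix.diagonal_mul_diagonal]
    have : z.2 * z.2 * (z.2 * z.2)⁻¹ = 1 := mul_inv_cancel₀ (by positivity)
    rw [this, Matrix.diagonal_one]
  have hm0 : X.mean0 A B ν b = 2 / (z.2 * B z) := by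
    simp only [mean0, hgi, e1, cov0, e2, Fin.sum_univ_two, Matrix.diagonal_apply]
    simp; field_simp; norm_num
  have hm1 : X.mean1 A B ν b = 2 * a / (B z ^ 2 * z.2) - b * (dd 0 0 + dd 1 1) / z.2 ^ 2 := by
    simp only [mean1, hgi, e1, cov1, e2, e3, e4, Fin.sum_univ_two, Matrix.diagonal_apply]
    simp; field_simp; ring
  have hms : X.meanSq A B ν b = 4 / z.2 ^ 2 * (a / B z ^ 2 - b * (dd 0 0 + dd 1 1) / z.2) := by
    rw [meanSq, hm0, hm1, e1, e2, e3]
    field_simp; ring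
  refine ⟨hz, ?_, ?_, ?_, ?_⟩
  · rw [hg]; simp; positivity
  · rw [hg, Matrix.det_diagonal]; simp; positivity
  · rw [hm0]; positivity
  · rw [hms, mul_left_comm]; positivity

end Profile

/-- The value and the first two derivatives of a function on the sphere in a frame. -/
abbrev Jet : Type := ℝ × (Fin 2 → ℝ) × (Fin 2 → Fin 2 → ℝ)

/-- The profile of the deformed sphere with base `z` and parameter `ε` at a point where the
deformation function has the jet `τ`. -/
def profile (A : ℝ × ℝ → ℝ) (ν b ε : ℝ) (z : ℝ × ℝ) (τ : Jet) : Profile :=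
  (ε, A (z.1 + ε * ν * τ.1, z.2 + ε * b * τ.1) / ε, (z.1 + ε * ν * τ.1, z.2 + ε * b * τ.1),
    τ.2.1, τ.2.2)

section Uniform

variable {A B : ℝ × ℝ → ℝ} {ν b : ℝ} {g : Components} {D : Set (ℝ × ℝ)}

lemma fderiv_eq_Dv_Dr (φ : ℝ × ℝ → ℝ) (z w : ℝ × ℝ) :
    fderiv ℝ φ z w = w.1 * Dv φ z + w.2 * Dr φ z := by
  rw [Dv, Dr, ← smul_eq_mul, ← smul_eq_mul, ← map_smul, ← map_smul, ← map_add]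
  simp

/-- The difference quotient of `φ` along the deformation. -/
lemma tendsto_comp_deform_div {φ : ℝ × ℝ → ℝ} {z : ℝ × ℝ} (hφ : DifferentiableAt ℝ φ z)
    (hz : φ z = 0) (t : ℝ) :
    Tendsto (fun p : ℝ × ℝ => φ (z.1 + p.1 * ν * p.2, z.2 + p.1 * b * p.2) / p.1)
      (𝓝[{p | 0 < p.1}] (0, t)) (𝓝 ((ν * Dv φ z + b * Dr φ z) * t)) := by
  -- The limit is taken jointly in the parameter and in the value t of the deformation function, as
  -- the compactness argument requires. The increments divided by the parameter tend to (νt, bt).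
  have h2 := (hφ.hasFDerivAt.hasFDerivWithinAt (s := Set.univ)).lim
    (l := 𝓝[{p : ℝ × ℝ | 0 < p.1}] (0, t)) (c := fun p => p.1⁻¹)
    (d := fun p => (p.1 * ν * p.2, p.1 * b * p.2)) (v := (ν * t, b * t)) ?_
    (Eventually.of_forall fun _ => Set.mem_univ _) ?_
  · rw [fderiv_eq_Dv_Dr] at h2
    have e : (ν * Dv φ z + b * Dr φ z) * t = ν * t * Dv φ z + b * t * Dr φ z := by ring
    rw [e]
    refine h2.congr fun p => ?_
    rw [hz, sub_zero, smul_eq_mul, div_eq_inv_mul]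
    rfl
  · have : Continuous (fun p : ℝ × ℝ => (p.1 * ν * p.2, p.1 * b * p.2)) := by fun_prop
    exact (this.tendsto' (0, t) _ (by simp)).mono_left nhdsWithin_le_nhds
  · have h3 : Tendsto (fun p : ℝ × ℝ => (ν * p.2, b * p.2))
        (𝓝[{p : ℝ × ℝ | 0 < p.1}] (0, t)) (𝓝 (ν * t, b * t)) := by
      have : Continuous (fun p : ℝ × ℝ => (ν * p.2, b * p.2)) := by fun_prop
      exact (this.tendsto (0, t)).mono_left nhdsWithin_le_nhds
    refine h3.congr' ?_
    filter_upwards [eventually_mem_nhdsWithin] with p hp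
    have : p.1 ≠ 0 := ne_of_gt hp
    ext
    · simp; field_simp
    · simp; field_simp

/-- Near the horizon all the points of the deformed spheres are good, if `N` is chosen well. -/
theorem eventually_forall_good (h : IsEFMetric g A B D) {z : ℝ × ℝ} (hz : z ∈ D) (hA : A z = 0)
    {L a₀ s : ℝ} (hN : ν * Dv A z + b * Dr A z = -(B z / z.2 * L)) (hb : b * B z = 1)
    (hs : 0 < s * (-(L * a₀))) {K : Set Jet} (hK : IsCompact K)
    (htr : ∀ τ ∈ K, τ.2.2 0 0 + τ.2.2 1 1 = -(L * (τ.1 - a₀))) :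
    ∀ᶠ ε in 𝓝[>] (0 : ℝ), ∀ τ ∈ K, Profile.Good A B ν b D s (profile A ν b ε z τ) := by
  have hr := h.r_pos z hz
  have hB := h.B_pos z hz
  -- The one-sided condition 0 < ε becomes a premise, so that the tube lemma for full neighbourhoods
  -- applies to the compact set K.
  have key : ∀ τ ∈ K, ∀ᶠ p in 𝓝 ((0 : ℝ), τ), 0 < p.1 →
      Profile.Good A B ν b D s (profile A ν b p.1 z p.2) := by
    intro τ hτ
    have hg : Profile.Good A B ν b D s (0, (ν * Dv A z + b * Dr A z) * τ.1, z, τ.2.1, τ.2.2) := by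
      refine Profile.good_of_eps_eq_zero h hz _ _ ?_
      rw [htr τ hτ, hN]
      -- The cancellation achieved by the tuning: with b = 1/B the contribution -Lf/(rB) of A/ε
      -- meets L(f - a₀)/(rB) from the Laplacian, and f drops out.
      have : -(B z / z.2 * L) * τ.1 / B z ^ 2 - b * -(L * (τ.1 - a₀)) / z.2
          = (-(L * a₀)) / (B z * z.2) := by
        have : b = 1 / B z := by field_simp; exact hb
        rw [this]; field_simp; ring
      rw [this, ← mul_div_assoc]
      positivity
    have hcont : Continuous (fun p : ℝ × Jet => (z.1 + p.1 * ν * p.2.1, z.2 + p.1 * b * p.2.1)) := by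
      fun_prop
    have ht : Tendsto (fun p : ℝ × Jet => profile A ν b p.1 z p.2) (𝓝[{p | 0 < p.1}] (0, τ))
        (𝓝 (0, (ν * Dv A z + b * Dr A z) * τ.1, z, τ.2.1, τ.2.2)) := by
      refine Tendsto.prodMk_nhds ((continuous_fst.tendsto' _ _ rfl).mono_left nhdsWithin_le_nhds)
        (Tendsto.prodMk_nhds ?_ (Tendsto.prodMk_nhds ?_ (Tendsto.prodMk_nhds ?_ ?_)))
      · refine (tendsto_comp_deform_div (h.differentiableAt h.contDiffOn_A hz) hA τ.1).comp
          (f := fun p : ℝ × Jet => (p.1, p.2.1)) ?_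
        refine tendsto_nhdsWithin_iff.2 ⟨?_, eventually_mem_nhdsWithin⟩
        have : Continuous (fun p : ℝ × Jet => (p.1, p.2.1)) := by fun_prop
        exact (this.tendsto' _ _ rfl).mono_left nhdsWithin_le_nhds
      · exact (hcont.tendsto' _ _ (by simp)).mono_left nhdsWithin_le_nhds
      · have : Continuous (fun p : ℝ × Jet => p.2.2.1) := by fun_prop
        exact (this.tendsto' _ _ rfl).mono_left nhdsWithin_le_nhds
      · have : Continuous (fun p : ℝ × Jet => p.2.2.2) := by fun_prop
        exact (this.tendsto' _ _ rfl).mono_left nhdsWithin_le_nhds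
    exact eventually_nhdsWithin_iff.1 (ht.eventually (hg.eventually h))
  have := hK.eventually_forall_of_forall_eventually (P := fun ε τ => 0 < ε →
      Profile.Good A B ν b D s (profile A ν b ε z τ)) key
  refine eventually_nhdsWithin_iff.2 ?_
  filter_upwards [this] with ε hε hpos τ hτ using hε τ hτ hpos

/-- Goodness for a fixed parameter is stable under small changes of the base. -/
theorem eventually_good_base (h : IsEFMetric g A B D) {z : ℝ × ℝ} {ε s : ℝ} (hε : 0 < ε)
    {K : Set Jet} (hK : IsCompact K)
    (hg : ∀ τ ∈ K, Profile.Good A B ν b D s (profile A ν b ε z τ)) :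
    ∀ᶠ w in 𝓝 z, ∀ τ ∈ K, Profile.Good A B ν b D s (profile A ν b ε w τ) := by
  refine hK.eventually_forall_of_forall_eventually (P := fun w τ =>
      Profile.Good A B ν b D s (profile A ν b ε w τ)) fun τ hτ => ?_
  have hd : (z.1 + ε * ν * τ.1, z.2 + ε * b * τ.1) ∈ D := (hg τ hτ).1
  have hA : ContinuousAt A (z.1 + ε * ν * τ.1, z.2 + ε * b * τ.1) :=
    h.contDiffOn_A.continuousOn.continuousAt (h.isOpen.mem_nhds hd)
  -- With ε > 0 fixed, A/ε is continuous in the base, so the base need not stay on the horizon.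
  have ht : ContinuousAt (fun p : (ℝ × ℝ) × Jet => profile A ν b ε p.1 p.2) (z, τ) := by
    unfold profile
    have hε' := hε.ne'
    fun_prop (disch := assumption)
  exact ht.eventually ((hg τ hτ).eventually h)

end Uniform

end SphTrapped
end


noncomputable section

open Filter Topology

namespace SphTrapped

/-! ### Linear algebra -/

lemma posDef_fin_two {m : Matrix (Fin 2) (Fin 2) ℝ} (hs : m 0 1 = m 1 0) (h0 : 0 < m 0 0)
    (hd : 0 < m.det) : m.PosDef := by
  refine Matrix.PosDef.of_dotProduct_mulVec_pos ?_ fun x hx => ?_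
  · ext i j
    fin_cases i <;> fin_cases j <;> simp [hs]
  · rw [Matrix.det_fin_two] at hd
    simp only [dotProduct, Matrix.mulVec, Fin.sum_univ_two, Pi.star_apply, star_trivial]
    -- Completing the square in the quadratic form after multiplication by the positive entry m₀₀.
    have h1 : m 0 0 * (x 0 * (m 0 0 * x 0 + m 0 1 * x 1) + x 1 * (m 1 0 * x 0 + m 1 1 * x 1))
        = (m 0 0 * x 0 + m 0 1 * x 1) ^ 2 + (m 0 0 * m 1 1 - m 0 1 * m 1 0) * x 1 ^ 2 := by
      rw [hs]; ring
    have h2 : 0 < (m 0 0 * x 0 + m 0 1 * x 1) ^ 2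
        + (m 0 0 * m 1 1 - m 0 1 * m 1 0) * x 1 ^ 2 := by
      by_cases hx1 : x 1 = 0
      · have hx0 : x 0 ≠ 0 := fun hx0 => hx (by funext i; fin_cases i <;> simp [hx0, hx1])
        rw [hx1]
        have := mul_ne_zero h0.ne' hx0
        have := sq_pos_of_ne_zero this
        simpa using this
      · have := mul_pos hd (sq_pos_of_ne_zero hx1)
        nlinarith [sq_nonneg (m 0 0 * x 0 + m 0 1 * x 1)]
    rw [← h1] at h2
    exact pos_of_mul_pos_right h2 h0.le

lemma exists_isFrame {η : Fin 3 → ℝ} (hη : ∑ i, η i ^ 2 = 1) : ∃ E, IsFrame η E := by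
  -- Only the value at index 2 is prescribed: the orthonormal set {η} is extended to a basis with η
  -- in the last place.
  let v : Fin 3 → EuclideanSpace ℝ (Fin 3) := fun _ => WithLp.toLp 2 η
  have hv : Orthonormal ℝ (({2} : Set (Fin 3)).domRestrict v) := by
    constructor
    · intro i
      have : ‖WithLp.toLp 2 η‖ = 1 := by
        rw [EuclideanSpace.norm_eq]; simp [hη]
      exact this
    · intro i j hij
      exact absurd (Subsingleton.elim i j) hij
  obtain ⟨b, hb⟩ := hv.exists_orthonormalBasis_extension_of_card_eq (by simp)
  have hb2 : ∀ i, b 2 i = η i := fun i => by rw [hb 2 rfl]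
  have ho : ∀ i j : Fin 3, ∑ k, b i k * b j k = if i = j then 1 else 0 := by
    intro i j
    have := orthonormal_iff_ite.1 b.orthonormal j i
    rw [PiLp.inner_apply] at this
    simp only [eq_comm (a := j)] at this
    simpa using this
  refine ⟨fun a k => b a.castSucc k, ?_, ?_, ?_⟩
  · have := ho 2 2
    simpa only [hb2, if_true] using this
  · intro a
    have := ho a.castSucc 2
    have hne : a.castSucc ≠ 2 := (Fin.castSucc_lt_last a).ne
    rw [if_neg hne] at this
    simpa only [hb2] using this
  · intro a c
    have := ho a.castSucc c.castSucc
    simpa only [Fin.castSucc_inj] using this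

namespace IsFrame

variable {η : Fin 3 → ℝ} {E : Fin 2 → Fin 3 → ℝ} (hE : IsFrame η E)
include hE

lemma complete (i j : Fin 3) :
    η i * η j + ∑ a, E a i * E a j = if i = j then 1 else 0 := by
  let m : Matrix (Fin 3) (Fin 3) ℝ := Matrix.of ![E 0, E 1, η]
  have h1 := hE.unit
  have h2 := hE.orth
  have h3 := hE.ortho
  have hm : m * m.transpose = 1 := by
    ext k l
    rw [Matrix.mul_apply]
    have h2' : ∀ a, ∑ i, η i * E a i = 0 := fun a => by
      rw [← h2 a]; exact Finset.sum_congr rfl fun _ _ => mul_comm _ _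
    fin_cases k <;> fin_cases l <;> simp [m, h1, h2, h2', h3]
  -- Orthonormal rows of a square matrix force orthonormal columns, which is the completeness
  -- relation.
  have hm1 : m.transpose * m = 1 := mul_eq_one_comm.1 hm
  have hm' := congrFun (congrFun hm1 i) j
  rw [Matrix.mul_apply, Fin.sum_univ_three, Matrix.one_apply] at hm'
  rw [← hm', Fin.sum_univ_two]
  simp [m]; ring

lemma sum_gnoLin_mul (l : Fin 2 → ℝ) : ∑ i, gnoLin η E i l * η i = 1 := by
  have h1 := hE.unit
  have h2 := hE.orth 0
  have h3 := hE.orth 1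
  simp only [gnoLin, Fin.sum_univ_three, Fin.sum_univ_two] at *
  linear_combination h1 + l 0 * h2 + l 1 * h3

lemma sum_gnoLin_mul_frame (l : Fin 2 → ℝ) (a : Fin 2) : ∑ i, gnoLin η E i l * E a i = l a := by
  have h1 := hE.orth a
  have h2 := hE.ortho 0 a
  have h3 := hE.ortho 1 a
  have : l a = l 0 * (if 0 = a then 1 else 0) + l 1 * (if 1 = a then 1 else 0) := by
    fin_cases a <;> simp
  rw [this, ← h2, ← h3]
  simp only [gnoLin, Fin.sum_univ_three, Fin.sum_univ_two] at *
  linear_combination h1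

lemma sum_gnoLin_sq (l : Fin 2 → ℝ) :
    ∑ i, gnoLin η E i l * gnoLin η E i l = 1 + ∑ a, l a ^ 2 := by
  have h1 : ∀ i, gnoLin η E i l * gnoLin η E i l = gnoLin η E i l * η i
      + ∑ a, l a * (gnoLin η E i l * E a i) := by
    intro i
    rw [gnoLin, mul_add, Finset.mul_sum]
    congr 1
    exact Finset.sum_congr rfl fun a _ => by ring
  simp only [h1, Finset.sum_add_distrib]
  rw [hE.sum_gnoLin_mul, Finset.sum_comm]
  simp only [← Finset.mul_sum, hE.sum_gnoLin_mul_frame, pow_two]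

lemma sum_gno_sq (l : Fin 2 → ℝ) : ∑ i, gno η E i l ^ 2 = 1 := by
  have : ∀ i, gno η E i l ^ 2
      = gnoFactor l * gnoFactor l * (gnoLin η E i l * gnoLin η E i l) := by
    intro i; rw [gno]; ring
  simp only [this, ← Finset.mul_sum, hE.sum_gnoLin_sq, gnoFactor_sq]

lemma sum_gno_mul (l : Fin 2 → ℝ) : ∑ i, gno η E i l * η i = gnoFactor l := by
  have : ∀ i, gno η E i l * η i = gnoFactor l * (gnoLin η E i l * η i) := by
    intro i; rw [gno]; ring
  simp only [this, ← Finset.mul_sum, hE.sum_gnoLin_mul, mul_one]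

lemma sum_gno_mul_frame (l : Fin 2 → ℝ) (a : Fin 2) :
    ∑ i, gno η E i l * E a i = gnoFactor l * l a := by
  have : ∀ i, gno η E i l * E a i = gnoFactor l * (gnoLin η E i l * E a i) := by
    intro i; rw [gno]; ring
  simp only [this, ← Finset.mul_sum, hE.sum_gnoLin_mul_frame]

/-- The gnomonic parametrisation covers the hemisphere around `η`. -/
lemma exists_gno_eq {x : Fin 3 → ℝ} (hx : ∑ i, x i ^ 2 = 1) (hpos : 0 < ∑ i, x i * η i) :
    ∃ l, ∀ i, gno η E i l = x i := by
  set c := ∑ i, x i * η i with hc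
  refine ⟨fun a => (∑ i, x i * E a i) / c, ?_⟩
  set l : Fin 2 → ℝ := fun a => (∑ i, x i * E a i) / c with hl
  have h1 : ∀ i, x i = c * gnoLin η E i l := by
    intro i
    have h2 : ∑ j, x j * (η i * η j + ∑ a, E a i * E a j) = x i := by
      simp only [hE.complete]; simp
    rw [← h2, gnoLin]
    simp only [hl, hc, mul_add, Finset.sum_add_distrib, Finset.sum_mul, Finset.mul_sum]
    congr 1
    · exact Finset.sum_congr rfl fun j _ => by ring
    · rw [Finset.sum_comm]
      refine Finset.sum_congr rfl fun a _ => ?_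
      have : c * ((∑ j, x j * E a j) / c * E a i) = ∑ j, x j * E a j * E a i := by
        rw [← Finset.sum_mul]; field_simp
      rw [← Finset.sum_mul, ← hc, this]
      exact Finset.sum_congr rfl fun j _ => by ring
  have h3 : c ^ 2 * (1 + ∑ a, l a ^ 2) = 1 := by
    rw [← hE.sum_gnoLin_sq, ← hx, Finset.mul_sum]
    exact Finset.sum_congr rfl fun i _ => by rw [h1 i]; ring
  -- Both numbers have the same square, and both are nonnegative; here the open hemisphere condition
  -- enters.
  have h4 : c = gnoFactor l := by
    have h5 := gnoFactor_sq l
    have h6 := one_add_sum_sq_pos l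
    have h7 : c ^ 2 = gnoFactor l ^ 2 := by
      apply mul_right_cancel₀ h6.ne'
      rw [h3, pow_two, h5]
    exact (pow_left_inj₀ hpos.le (gnoFactor_pos l).le two_ne_zero).1 h7
  intro i
  rw [h1 i, gno, h4]; ring

end IsFrame

end SphTrapped
end


noncomputable section

open Filter Topology

namespace SphTrapped

/-! ### The metric of an Eddington-Finkelstein chart -/

namespace EFChart

variable {V : Type*} [TopologicalSpace V] [ChartedSpace (Fin 4 → ℝ) V]
  [IsManifold 𝓘(ℝ, Fin 4 → ℝ) ∞ V] [MulAction SO3 V] {M : Spacetime V} (C : EFChart M)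

/-- `-g_{vv}` as a function of `(v, r)`. -/
def fA (z : ℝ × ℝ) : ℝ := Real.exp (2 * C.β z) * (1 - 2 * C.m z / z.2)

/-- `g_{vr}` as a function of `(v, r)`. -/
def fB (z : ℝ × ℝ) : ℝ := Real.exp (C.β z)

lemma mem_target {y : Fin 4 → ℝ} : y ∈ C.e.target ↔ vr y ∈ C.D := by
  rw [C.target_eq]; rfl

lemma dr_eq_rad (y u : Fin 4 → ℝ) : dr y u = rad y u := by
  rw [dr, rad, Finset.sum_div]
  exact Finset.sum_congr rfl fun i _ => by rw [nrm]; ring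

lemma efForm_eq (y u w : Fin 4 → ℝ) :
    efForm C.β C.m y u w = -C.fA (vr y) * (u 0 * w 0)
      + C.fB (vr y) * (u 0 * rad y w + rad y u * w 0) + (spat u w - rad y u * rad y w) := by
  simp only [efForm, fA, fB, vr, dr_eq_rad, spat]; ring

lemma rad_single_zero (y : Fin 4 → ℝ) : rad y (Pi.single 0 1) = 0 := by
  simp [rad]

lemma rad_single_succ (y : Fin 4 → ℝ) (i : Fin 3) : rad y (Pi.single i.succ 1) = nrm y i := by
  simp [rad, Pi.single_apply]

lemma comp_eq {y : Fin 4 → ℝ} (hy : vr y ∈ C.D) : M.comp C.e y = efMat C.fA C.fB y := by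
  ext μ ν
  rw [Spacetime.comp, Matrix.of_apply, C.metric_eq y (C.mem_target.2 hy), efForm_eq]
  refine Fin.cases ?_ (fun i => ?_) μ <;> refine Fin.cases ?_ (fun j => ?_) ν
  · rw [efMat_zero_zero]; simp [rad_single_zero, spat]
  · rw [efMat_zero_succ]; simp [rad_single_zero, rad_single_succ, spat]
  · rw [efMat_succ_zero]; simp [rad_single_zero, rad_single_succ, spat]
  · rw [efMat_succ_succ]; simp [rad_single_succ, spat, prj, Pi.single_apply, eq_comm]

lemma isEFMetric : IsEFMetric (M.comp C.e) C.fA C.fB C.D where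
  isOpen := C.isOpen_D
  contDiffOn_A := (Real.contDiff_exp.comp_contDiffOn (contDiffOn_const.mul C.smooth_β)).mul
    (contDiffOn_const.sub ((contDiffOn_const.mul C.smooth_m).div contDiffOn_snd
      fun z hz => (C.pos_D z hz).ne'))
  contDiffOn_B := Real.contDiff_exp.comp_contDiffOn C.smooth_β
  B_pos _ _ := Real.exp_pos _
  r_pos := C.pos_D
  eq_efMat _ hy := C.comp_eq hy

lemma pair_eq_efForm {y : Fin 4 → ℝ} (hy : vr y ∈ C.D) (u w : Fin 4 → ℝ) :
    pair (M.comp C.e) y u w = efForm C.β C.m y u w := by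
  rw [C.isEFMetric.pair_eq hy, C.efForm_eq]

lemma vr_mem {p : V} (hp : p ∈ C.e.source) : vr (C.e p) ∈ C.D :=
  C.mem_target.1 (C.e.map_source hp)

lemma fA_eq_zero_of_mem_AH {p : V} (hp : p ∈ C.AH) : C.fA (vr (C.e p)) = 0 := by
  obtain ⟨h1, h2⟩ := hp
  have hr := C.pos_D _ (C.vr_mem h1)
  have h3 : (vr (C.e p)).2 = 2 * C.m (vr (C.e p)) := h2
  rw [fA, ← h3, div_self hr.ne']; simp

/-- On the apparent horizon `G(k, k)` is proportional to `∂_v g_{vv}`. -/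
lemma Gkk_eq {p : V} (hp : p ∈ C.AH) :
    C.Gkk p = -(Dv C.fA (vr (C.e p)) / (radius (C.e p) * C.fB (vr (C.e p)))) := by
  have hy := C.vr_mem hp.1
  have hA := C.fA_eq_zero_of_mem_AH hp
  have hr := C.pos_D _ hy
  have hk : C.k (C.e p) = dV := by
    have h3 : (vr (C.e p)).2 = 2 * C.m (vr (C.e p)) := hp.2
    have h4 : 2 * C.m (C.e p 0, radius (C.e p)) / radius (C.e p) = 1 := by
      rw [← show radius (C.e p) = 2 * C.m (C.e p 0, radius (C.e p)) from h3]
      exact div_self hr.ne'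
    rw [k, h4]; simp
  have hk0 : dV 0 = 1 := rfl
  have hks : ∀ i : Fin 3, dV i.succ = 0 := fun _ => rfl
  rw [Gkk, hk, Fin.sum_univ_succ, Fin.sum_univ_succ]
  simp only [hk0, hks, mul_zero, zero_mul, Finset.sum_const_zero, add_zero, mul_one]
  -- With k = ∂_v only the vv component remains, and its scalar curvature term is multiplied by g_vv
  -- = -A = 0.
  rw [einstein, C.isEFMetric.ricci_zero_zero hy hA, C.comp_eq hy, efMat_zero_zero, hA]
  ring

/-- In an Eddington-Finkelstein chart the future timelike vectors are the timelike vectors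
with positive `v`-component. -/
lemma isFutureTimelike {y u : Fin 4 → ℝ} (hy : y ∈ C.e.target)
    (hu : efForm C.β C.m y u u < 0) (hu0 : 0 < u 0) :
    M.IsFutureTimelike (C.e.symm y) (Spacetime.pushVec C.e y u) := by
  have hd := C.mem_target.1 hy
  have hr := C.isEFMetric.radius_pos hd
  have hB := C.isEFMetric.B_pos _ hd
  have hsrc := C.e.map_target hy
  refine ⟨by rw [C.metric_eq y hy]; exact hu, ?_⟩
  set w : Fin 4 → ℝ := (mfderiv 𝓘(ℝ, Fin 4 → ℝ) 𝓘(ℝ, Fin 4 → ℝ) C.e (C.e.symm y)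
    (M.time (C.e.symm y))) with hw
  have hw0 : 0 < w 0 := C.future _ hsrc
  have hmd : OpenPartialHomeomorph.MDifferentiable 𝓘(ℝ, Fin 4 → ℝ) 𝓘(ℝ, Fin 4 → ℝ) C.e :=
    ⟨(contMDiffOn_of_mem_maximalAtlas C.chart).mdifferentiableOn (by norm_num),
      (contMDiffOn_symm_of_mem_maximalAtlas C.chart).mdifferentiableOn (by norm_num)⟩
  have hpush : Spacetime.pushVec C.e y w = M.time (C.e.symm y) := by
    have h1 := hmd.symm_comp_deriv hsrc
    have h2 := congrArg (fun T => T (M.time (C.e.symm y))) h1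
    rw [C.e.right_inv hy] at h2
    exact h2
  have htt := M.time_timelike (C.e.symm y)
  rw [← hpush, C.metric_eq y hy] at htt ⊢
  -- the reversed Cauchy-Schwarz inequality
  rw [efForm_eq] at hu htt ⊢
  set a := C.fA (vr y)
  set c := C.fB (vr y)
  set s := rad y u
  set t := rad y w
  -- The combination w⁰u - u⁰w has no v-component, so its norm is that of its part orthogonal to n
  -- and is nonnegative. Expanding it gives 2u⁰w⁰ g(w,u) ≤ (w⁰)² g(u,u) + (u⁰)² g(w,w), whose right
  -- side is negative.
  have hpos : 0 ≤ ∑ i : Fin 3, ∑ j : Fin 3,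
      prj y i j * (w 0 • u - u 0 • w) i.succ * (w 0 • u - u 0 • w) j.succ := by
    rw [sum_prj_mul_mul]
    have hcs := Finset.sum_mul_sq_le_sq_mul_sq Finset.univ (nrm y)
      (fun i : Fin 3 => (w 0 • u - u 0 • w) i.succ)
    have h1 := sum_nrm_sq hr
    simp only [← pow_two] at h1
    rw [h1, one_mul] at hcs
    simp only [spat, rad, ← pow_two]
    linarith
  rw [sum_prj_mul_mul] at hpos
  have e1 : rad y (w 0 • u - u 0 • w) = w 0 * s - u 0 * t := by
    simp only [rad, s, t, Fin.sum_univ_three, Pi.sub_apply, Pi.smul_apply, smul_eq_mul]; ring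
  have e2 : spat (w 0 • u - u 0 • w) (w 0 • u - u 0 • w)
      = w 0 ^ 2 * spat u u - 2 * (u 0 * w 0) * spat w u + u 0 ^ 2 * spat w w := by
    simp only [spat, Fin.sum_univ_three, Pi.sub_apply, Pi.smul_apply, smul_eq_mul]; ring
  rw [e1, e2] at hpos
  have h1 := mul_pos_of_neg_of_neg (neg_neg_of_pos (pow_pos hw0 2)) hu
  have h2 := mul_pos_of_neg_of_neg (neg_neg_of_pos (pow_pos hu0 2)) htt
  have h3 : 2 * (u 0 * w 0) * (-a * (w 0 * u 0) + c * (w 0 * s + t * u 0)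
      + (spat w u - t * s)) < 0 := by
    nlinarith
  have h4 : 0 < 2 * (u 0 * w 0) := by positivity
  by_contra hcon
  exact absurd h3 (not_lt.2 (mul_nonneg h4.le (not_lt.1 hcon)))

/-! ### Deformed spheres -/

/-- The point with unit vector `x` of the deformed sphere `v = z.1 + ε ν f`, `r = z.2 + ε b f`. -/
def surfPt (z : ℝ × ℝ) (ν b ε : ℝ) (f : (Fin 3 → ℝ) → ℝ) (x : Fin 3 → ℝ) : Fin 4 → ℝ :=
  Fin.cons (z.1 + ε * ν * f x) (fun i => (z.2 + ε * b * f x) * x i)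

/-- The deformed sphere `v = z.1 + ε ν f`, `r = z.2 + ε b f`. -/
def surf (z : ℝ × ℝ) (ν b ε : ℝ) (f : (Fin 3 → ℝ) → ℝ) : Set V :=
  {q | q ∈ C.e.source ∧ ∃ x : Fin 3 → ℝ, ∑ i, x i ^ 2 = 1 ∧ C.e q = surfPt z ν b ε f x}

end EFChart

lemma sum_sq_of_mem_sphere (x : Metric.sphere (0 : EuclideanSpace ℝ (Fin 3)) 1) :
    ∑ i, (x : EuclideanSpace ℝ (Fin 3)) i ^ 2 = 1 := by
  have h := mem_sphere_zero_iff_norm.1 x.2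
  have h2 := EuclideanSpace.norm_sq_eq (x : EuclideanSpace ℝ (Fin 3))
  rw [h] at h2
  simpa using h2.symm

/-- The jet of a polynomial, restricted to the unit sphere, in a frame. -/
def polyJet (Q : MvPolynomial (Fin 3) ℝ) (η : Fin 3 → ℝ) (E : Fin 2 → Fin 3 → ℝ) : Jet :=
  (MvPolynomial.eval η Q, fun i => pd i (fun l => MvPolynomial.eval (fun k => gno η E k l) Q) 0,
    fun i j => pd i (fun l => pd j (fun l => MvPolynomial.eval (fun k => gno η E k l) Q) l) 0)

lemma contDiff_eval (Q : MvPolynomial (Fin 3) ℝ) {m : ℕ∞ω} :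
    ContDiff ℝ m (fun x : Fin 3 → ℝ => MvPolynomial.eval x Q) := by
  induction Q using MvPolynomial.induction_on with
  | C a => simp only [MvPolynomial.eval_C]; exact contDiff_const
  | add p q hp hq => simp only [map_add]; exact hp.add hq
  | mul_X p i hp =>
    simp only [map_mul, MvPolynomial.eval_X]
    exact hp.mul (contDiff_apply ℝ ℝ i)

namespace EFChart

variable {V : Type*} [TopologicalSpace V] [ChartedSpace (Fin 4 → ℝ) V]
  [IsManifold 𝓘(ℝ, Fin 4 → ℝ) ∞ V] [MulAction SO3 V] {M : Spacetime V} (C : EFChart M)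
  {z : ℝ × ℝ} {ν b ε s : ℝ} {Q : MvPolynomial (Fin 3) ℝ}

lemma radius_surfPt {f : (Fin 3 → ℝ) → ℝ} {x : Fin 3 → ℝ} (hx : ∑ i, x i ^ 2 = 1)
    (hr : 0 ≤ z.2 + ε * b * f x) : radius (surfPt z ν b ε f x) = z.2 + ε * b * f x := by
  have : ∀ i : Fin 3, surfPt z ν b ε f x i.succ = (z.2 + ε * b * f x) * x i := fun _ => rfl
  rw [radius]
  simp only [this, mul_pow, ← Finset.mul_sum, hx, mul_one]
  exact Real.sqrt_sq hr

lemma vr_surfPt {f : (Fin 3 → ℝ) → ℝ} {x : Fin 3 → ℝ} (hx : ∑ i, x i ^ 2 = 1)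
    (hr : 0 ≤ z.2 + ε * b * f x) :
    vr (surfPt z ν b ε f x) = (z.1 + ε * ν * f x, z.2 + ε * b * f x) := by
  rw [vr, radius_surfPt hx hr]; rfl

lemma continuous_surfPt {f : (Fin 3 → ℝ) → ℝ} (hf : Continuous f) :
    Continuous (surfPt z ν b ε f) := by
  refine continuous_pi fun μ => ?_
  refine Fin.cases ?_ (fun i => ?_) μ
  · change Continuous fun x => z.1 + ε * ν * f x
    fun_prop
  · change Continuous fun x => (z.2 + ε * b * f x) * x i
    fun_prop

section Sphere

variable {f : (Fin 3 → ℝ) → ℝ} (hf : Continuous f)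
  (hD : ∀ x : Fin 3 → ℝ, ∑ i, x i ^ 2 = 1 → (z.1 + ε * ν * f x, z.2 + ε * b * f x) ∈ C.D)
include hD

lemma surfPt_mem_target {x : Fin 3 → ℝ} (hx : ∑ i, x i ^ 2 = 1) :
    surfPt z ν b ε f x ∈ C.e.target := by
  rw [C.mem_target, vr_surfPt hx (C.pos_D _ (hD x hx)).le]
  exact hD x hx

lemma surfPt_injOn {x x' : Fin 3 → ℝ} (hx : ∑ i, x i ^ 2 = 1) (hx' : ∑ i, x' i ^ 2 = 1)
    (h : surfPt z ν b ε f x = surfPt z ν b ε f x') : x = x' := by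
  have hr : 0 < z.2 + ε * b * f x := C.pos_D _ (hD x hx)
  have hr' : 0 < z.2 + ε * b * f x' := C.pos_D _ (hD x' hx')
  have h1 : z.2 + ε * b * f x = z.2 + ε * b * f x' := by
    rw [← radius_surfPt (ν := ν) hx hr.le, ← radius_surfPt (ν := ν) hx' hr'.le, h]
  funext i
  have h2 : (z.2 + ε * b * f x) * x i = (z.2 + ε * b * f x') * x' i := congrFun h i.succ
  rw [← h1] at h2
  exact mul_left_cancel₀ hr.ne' h2

lemma surf_eq_range : C.surf z ν b ε f
    = Set.range fun x : Metric.sphere (0 : EuclideanSpace ℝ (Fin 3)) 1 =>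
      C.e.symm (surfPt z ν b ε f (WithLp.ofLp (x : EuclideanSpace ℝ (Fin 3)))) := by
  ext q
  constructor
  · rintro ⟨hq, x, hx, hqx⟩
    refine ⟨⟨WithLp.toLp 2 x, ?_⟩, ?_⟩
    · rw [mem_sphere_zero_iff_norm, EuclideanSpace.norm_eq]; simp [hx]
    · change C.e.symm (surfPt z ν b ε f x) = q
      rw [← hqx, C.e.left_inv hq]
  · rintro ⟨x, rfl⟩
    have hx := sum_sq_of_mem_sphere x
    have ht := C.surfPt_mem_target hD hx
    exact ⟨C.e.map_target ht, _, hx, C.e.right_inv ht⟩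

include hf

lemma continuous_sphereMap :
    Continuous fun x : Metric.sphere (0 : EuclideanSpace ℝ (Fin 3)) 1 =>
      C.e.symm (surfPt z ν b ε f (WithLp.ofLp (x : EuclideanSpace ℝ (Fin 3)))) := by
  refine C.e.continuousOn_symm.comp_continuous ((continuous_surfPt hf).comp (by fun_prop))
    fun x => C.surfPt_mem_target hD (sum_sq_of_mem_sphere x)

lemma isCompact_surf : IsCompact (C.surf z ν b ε f) := by
  rw [C.surf_eq_range hD]
  exact isCompact_range (C.continuous_sphereMap hf hD)

lemma isConnected_surf : IsConnected (C.surf z ν b ε f) := by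
  have : ConnectedSpace (Metric.sphere (0 : EuclideanSpace ℝ (Fin 3)) 1) := by
    refine isConnected_iff_connectedSpace.1 (isConnected_sphere ?_ _ zero_le_one)
    rw [← Module.finrank_eq_rank]
    simp
  rw [C.surf_eq_range hD]
  exact isConnected_range (C.continuous_sphereMap hf hD)

/-- A continuous injection from the compact sphere into a Hausdorff space is an embedding;
injectivity holds because r = |x| and x/r are recovered from the image point. -/
lemma isTopSphere_surf [T2Space V] : IsTopSphere (C.surf z ν b ε f) := by
  have hinj : Function.Injective fun x : Metric.sphere (0 : EuclideanSpace ℝ (Fin 3)) 1 =>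
      C.e.symm (surfPt z ν b ε f (WithLp.ofLp (x : EuclideanSpace ℝ (Fin 3)))) := by
    intro x x' h
    have hx := sum_sq_of_mem_sphere x
    have hx' := sum_sq_of_mem_sphere x'
    have h1 := C.e.symm.injOn (C.surfPt_mem_target hD hx) (C.surfPt_mem_target hD hx') h
    exact Subtype.ext (WithLp.ofLp_injective 2 (C.surfPt_injOn hD hx hx' h1))
  have hemb := ((C.continuous_sphereMap hf hD).isClosedEmbedding hinj).isEmbedding
  rw [IsTopSphere, C.surf_eq_range hD]
  exact ⟨hemb.toHomeomorph.symm⟩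

end Sphere

end EFChart

end SphTrapped
end


/-! ### Deformed spheres as closed surfaces with controlled mean curvature. -/

noncomputable section

open Filter Topology

namespace SphTrapped

namespace EFChart

variable {V : Type*} [TopologicalSpace V] [ChartedSpace (Fin 4 → ℝ) V]
  [IsManifold 𝓘(ℝ, Fin 4 → ℝ) ∞ V] [MulAction SO3 V] {M : Spacetime V} (C : EFChart M)
  {z : ℝ × ℝ} {ν b ε s : ℝ} {Q : MvPolynomial (Fin 3) ℝ}
  {η : Fin 3 → ℝ} {E : Fin 2 → Fin 3 → ℝ}

/-- The deformed sphere in the gnomonic parametrisation. -/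
def polyParam (z : ℝ × ℝ) (ν b ε : ℝ) (Q : MvPolynomial (Fin 3) ℝ) (η : Fin 3 → ℝ)
    (E : Fin 2 → Fin 3 → ℝ) : (Fin 2 → ℝ) → (Fin 4 → ℝ) :=
  polarSurf η E (fun l => z.1 + ε * ν * MvPolynomial.eval (fun k => gno η E k l) Q)
    (fun l => z.2 + ε * b * MvPolynomial.eval (fun k => gno η E k l) Q)

lemma polyParam_eq (l : Fin 2 → ℝ) :
    polyParam z ν b ε Q η E l
      = surfPt z ν b ε (fun x => MvPolynomial.eval x Q) (fun k => gno η E k l) := rfl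

lemma contDiff_eval_gno {m : ℕ∞ω} :
    ContDiff ℝ m (fun l => MvPolynomial.eval (fun k => gno η E k l) Q) :=
  (contDiff_eval Q).comp (contDiff_pi.2 fun k => contDiff_gno η E k)

lemma contDiff_polyParam {m : ℕ∞ω} : ContDiff ℝ m (polyParam z ν b ε Q η E) :=
  contDiff_polarSurf (contDiff_const.add (contDiff_const.mul contDiff_eval_gno))
    (contDiff_const.add (contDiff_const.mul contDiff_eval_gno))

section LocalParam

variable (hE : IsFrame η E)
  (hD : ∀ x : Fin 3 → ℝ, ∑ i, x i ^ 2 = 1 →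
    (z.1 + ε * ν * MvPolynomial.eval x Q, z.2 + ε * b * MvPolynomial.eval x Q) ∈ C.D)
include hE hD

lemma polyParam_mul_pos (l : Fin 2 → ℝ) : 0 < ∑ i : Fin 3, polyParam z ν b ε Q η E l i.succ * η i := by
  have hx := hE.sum_gno_sq l
  have hr : 0 < z.2 + ε * b * MvPolynomial.eval (fun k => gno η E k l) Q := C.pos_D _ (hD _ hx)
  have h1 : ∀ i : Fin 3, polyParam z ν b ε Q η E l i.succ * η i
      = (z.2 + ε * b * MvPolynomial.eval (fun k => gno η E k l) Q) * (gno η E i l * η i) :=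
    fun i => mul_assoc _ _ _
  simp only [h1, ← Finset.mul_sum, hE.sum_gno_mul]
  exact mul_pos hr (gnoFactor_pos l)

lemma polyParam_div (l : Fin 2 → ℝ) (a : Fin 2) :
    (∑ i : Fin 3, polyParam z ν b ε Q η E l i.succ * E a i)
      / (∑ i : Fin 3, polyParam z ν b ε Q η E l i.succ * η i) = l a := by
  have hx := hE.sum_gno_sq l
  have hr : 0 < z.2 + ε * b * MvPolynomial.eval (fun k => gno η E k l) Q := C.pos_D _ (hD _ hx)
  have h1 : ∀ (w : Fin 3 → ℝ) (i : Fin 3), polyParam z ν b ε Q η E l i.succ * w i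
      = (z.2 + ε * b * MvPolynomial.eval (fun k => gno η E k l) Q) * (gno η E i l * w i) :=
    fun w i => mul_assoc _ _ _
  have hq := (gnoFactor_pos l).ne'
  simp only [h1, ← Finset.mul_sum, hE.sum_gno_mul, hE.sum_gno_mul_frame]
  field_simp

/-- On the half-space x·η > 0 the map y ↦ (x·E_a)/(x·η) is a continuous left inverse, because
central projection forgets the radius. -/
lemma isEmbedding_polyParam :
    Topology.IsEmbedding ((Set.univ : Set (Fin 2 → ℝ)).domRestrict (polyParam z ν b ε Q η E)) := by
  let U : Set (Fin 4 → ℝ) := {y | 0 < ∑ i : Fin 3, y i.succ * η i}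
  let F : ↥(Set.univ : Set (Fin 2 → ℝ)) → U := fun l =>
    ⟨polyParam z ν b ε Q η E l, C.polyParam_mul_pos hE hD l⟩
  let G : U → (Fin 2 → ℝ) := fun y a =>
    (∑ i : Fin 3, (y : Fin 4 → ℝ) i.succ * E a i) / (∑ i : Fin 3, (y : Fin 4 → ℝ) i.succ * η i)
  have hF : Continuous F :=
    ((contDiff_polyParam (m := 0)).continuous.comp continuous_subtype_val).subtype_mk _
  have hG : Continuous G := by
    have hc : ∀ w : Fin 3 → ℝ, Continuous fun y : U => ∑ i : Fin 3, (y : Fin 4 → ℝ) i.succ * w i := by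
      intro w
      have : Continuous fun y : Fin 4 → ℝ => ∑ i : Fin 3, y i.succ * w i := by fun_prop
      exact this.comp continuous_subtype_val
    exact continuous_pi fun a => (hc (E a)).div (hc η) fun y => y.2.ne'
  have hGF : G ∘ F = Subtype.val := by
    funext l; funext a
    exact C.polyParam_div hE hD l a
  have h1 : Topology.IsEmbedding F := by
    refine Topology.IsEmbedding.of_comp hF hG ?_
    rw [hGF]; exact Topology.IsEmbedding.subtypeVal
  exact Topology.IsEmbedding.subtypeVal.comp h1

/-- The piece covered is exactly the part of the surface in the open half-space x·η > 0, since
gnomonic coordinates reach the whole open hemisphere around η. -/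
lemma isLocalParam :
    Spacetime.IsLocalParam (C.surf z ν b ε (fun x => MvPolynomial.eval x Q)) C.e Set.univ
      (polyParam z ν b ε Q η E) where
  chart := C.chart
  isOpen := isOpen_univ
  contDiffOn := contDiff_polyParam.contDiffOn
  mapsTo l _ := by
    rw [polyParam_eq]
    exact C.surfPt_mem_target hD (hE.sum_gno_sq l)
  embedding := C.isEmbedding_polyParam hE hD
  range_eq := by
    refine ⟨C.e.source ∩ C.e ⁻¹' {y | 0 < ∑ i : Fin 3, y i.succ * η i},
      C.e.isOpen_inter_preimage (isOpen_lt continuous_const (by fun_prop)), ?_⟩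
    ext q
    constructor
    · rintro ⟨l, -, rfl⟩
      have hx := hE.sum_gno_sq l
      have ht : polyParam z ν b ε Q η E l ∈ C.e.target := C.surfPt_mem_target hD hx
      refine ⟨⟨C.e.map_target ht, _, hx, C.e.right_inv ht⟩, C.e.map_target ht, ?_⟩
      rw [Set.mem_preimage, C.e.right_inv ht]
      exact C.polyParam_mul_pos hE hD l
    · rintro ⟨⟨hq, x, hx, hqx⟩, -, hpos⟩
      rw [Set.mem_preimage, hqx] at hpos
      have hr : 0 < z.2 + ε * b * MvPolynomial.eval x Q := C.pos_D _ (hD _ hx)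
      have h1 : ∀ i : Fin 3, surfPt z ν b ε (fun x => MvPolynomial.eval x Q) x i.succ * η i
        = (z.2 + ε * b * MvPolynomial.eval x Q) * (x i * η i) := fun i => mul_assoc _ _ _
      have h2 : 0 < (z.2 + ε * b * MvPolynomial.eval x Q) * ∑ i, x i * η i := by
        rw [Finset.mul_sum]
        simpa only [Set.mem_ofPred_eq, h1] using hpos
      obtain ⟨l, hl⟩ := hE.exists_gno_eq hx (pos_of_mul_pos_right h2 hr.le)
      refine ⟨l, Set.mem_univ _, ?_⟩
      change C.e.symm (polyParam z ν b ε Q η E l) = q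
      rw [polyParam_eq, funext hl, ← hqx, C.e.left_inv hq]

end LocalParam

variable (hε : 0 < ε) (hgood : ∀ η E, IsFrame η E →
    Profile.Good C.fA C.fB ν b C.D s (profile C.fA ν b ε z (polyJet Q η E)))

include hgood

lemma deform_mem_of_good (x : Fin 3 → ℝ) (hx : ∑ i, x i ^ 2 = 1) :
    (z.1 + ε * ν * MvPolynomial.eval x Q, z.2 + ε * b * MvPolynomial.eval x Q) ∈ C.D := by
  obtain ⟨E, hE⟩ := exists_isFrame hx
  exact (hgood x E hE).1

include hε

/-- The mean curvature vector of a deformed sphere all of whose profiles are good. -/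
lemma surf_pointwise (hE : IsFrame η E) :
    (firstForm (M.comp C.e) (polyParam z ν b ε Q η E) 0).PosDef ∧
    0 < meanCurvature (M.comp C.e) (polyParam z ν b ε Q η E) 0 0 ∧
    0 < s * efForm C.β C.m (polyParam z ν b ε Q η E 0)
      (meanCurvature (M.comp C.e) (polyParam z ν b ε Q η E) 0)
      (meanCurvature (M.comp C.e) (polyParam z ν b ε Q η E) 0) := by
  have hD := C.deform_mem_of_good hgood
  obtain ⟨h1, h2, h3, h4, h5⟩ := hgood η E hE
  set X := profile C.fA ν b ε z (polyJet Q η E) with hX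
  have hη : (fun k => gno η E k 0) = η := funext (gno_zero η E)
  have hunit : ∑ i, η i ^ 2 = 1 := by
    rw [← hE.unit]; exact Finset.sum_congr rfl fun i _ => pow_two _
  have hz := hD η hunit
  have hr : 0 < z.2 + ε * b * MvPolynomial.eval η Q := C.pos_D _ hz
  have hpt : X.pt = (z.1 + ε * ν * MvPolynomial.eval η Q, z.2 + ε * b * MvPolynomial.eval η Q) :=
    rfl
  have hvr : vr (polyParam z ν b ε Q η E 0) = X.pt := by
    rw [polyParam_eq, hη, vr_surfPt hunit hr.le, hpt]
  have hnrm : nrm (polyParam z ν b ε Q η E 0) = η := by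
    funext i
    have : polyParam z ν b ε Q η E 0 i.succ = (z.2 + ε * b * MvPolynomial.eval η Q) * η i := by
      rw [polyParam_eq, hη]; rfl
    rw [nrm, this, polyParam_eq, hη, radius_surfPt hunit hr.le]
    field_simp
  have hA : C.fA X.pt = ε * X.aOver := by
    have : X.aOver = C.fA X.pt / ε := rfl
    rw [this]; field_simp
  obtain ⟨e1, e2⟩ := meanCurvature_polarSurf (ν := ν) (b := b) C.isEFMetric hE
    (φ := fun l => MvPolynomial.eval (fun k => gno η E k l) Q) contDiff_eval_gno z ε X.aOver
    (by simp only [hη]; exact hz) (by simp only [hη]; exact hA) (X := X)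
    (by simp only [hη]; rfl)
  change firstForm (M.comp C.e) (polyParam z ν b ε Q η E) 0 = _ at e1
  change meanCurvature (M.comp C.e) (polyParam z ν b ε Q η E) 0 = _ at e2
  refine ⟨?_, ?_, ?_⟩
  · rw [e1]
    refine posDef_fin_two ?_ h2 h3
    simp only [Profile.gam, Matrix.of_apply]
    simp [mul_comm]
  · rw [e2]; exact h4
  · have hy : vr (polyParam z ν b ε Q η E 0) ∈ C.D := by rw [hvr]; exact h1
    rw [e2, ← C.pair_eq_efForm hy, C.isEFMetric.pair_fvec hE hy hnrm, hvr, hA]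
    have : s * (-(ε * X.aOver) * (X.mean0 C.fA C.fB ν b * X.mean0 C.fA C.fB ν b)
        + C.fB X.pt * (X.mean0 C.fA C.fB ν b * (ε * X.mean1 C.fA C.fB ν b)
          + ε * X.mean1 C.fA C.fB ν b * X.mean0 C.fA C.fB ν b)
        + ∑ n, ε * X.mean2 C.fA C.fB ν b n * (ε * X.mean2 C.fA C.fB ν b n))
        = ε * (s * X.meanSq C.fA C.fB ν b) := by
      have heps : X.eps = ε := rfl
      rw [Profile.meanSq, heps, Fin.sum_univ_two, Fin.sum_univ_two]; ring
    rw [this]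
    exact mul_pos hε h5

/-- The definition of a closed surface allows a different parametrisation at each point, so the one
centred at that point is used and evaluated at 0. The hypothesis on P is applied only to vectors
with positive v-component and norm of the sign of s. -/
lemma isClosedSurfaceWith_surf (P : ∀ p : V, TangentSpace 𝓘(ℝ, Fin 4 → ℝ) p → Prop)
    (hP : ∀ y ∈ C.e.target, ∀ u : Fin 4 → ℝ, 0 < u 0 → 0 < s * efForm C.β C.m y u u →
      P (C.e.symm y) (Spacetime.pushVec C.e y u)) :
    M.IsClosedSurfaceWith P (C.surf z ν b ε (fun x => MvPolynomial.eval x Q)) := by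
  have hD := C.deform_mem_of_good hgood
  have hf := (contDiff_eval Q (m := 0)).continuous
  refine ⟨C.isCompact_surf hf hD, C.isConnected_surf hf hD, ?_⟩
  rintro q ⟨hq, x, hx, hqx⟩
  obtain ⟨E, hE⟩ := exists_isFrame hx
  obtain ⟨h1, h2, h3⟩ := C.surf_pointwise hε hgood hE
  have hlp := C.isLocalParam hE hD
  refine ⟨C.e, Set.univ, polyParam z ν b ε Q x E, 0, hlp, Set.mem_univ _, ?_, h1,
    hP _ (hlp.mapsTo (Set.mem_univ _)) _ h2 h3⟩
  rw [polyParam_eq, funext (gno_zero x E), ← hqx, C.e.left_inv hq]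

end EFChart

end SphTrapped
end


noncomputable section

open Filter Topology

namespace SphTrapped

/-! ### Jets of polynomials on the sphere -/

section PolyJet

open MvPolynomial (eval pderiv)

variable {η : Fin 3 → ℝ} {E : Fin 2 → Fin 3 → ℝ}

lemma pd_eval_gno (Q : MvPolynomial (Fin 3) ℝ) (a : Fin 2) (l : Fin 2 → ℝ) :
    pd a (fun l => eval (fun k => gno η E k l) Q) l
      = ∑ i, eval (fun k => gno η E k l) (pderiv i Q) * pd a (gno η E i) l := by
  have hd : ∀ q : MvPolynomial (Fin 3) ℝ,
      DifferentiableAt ℝ (fun l => eval (fun k => gno η E k l) q) l := fun q =>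
    (EFChart.contDiff_eval_gno (m := 1)).differentiable (by norm_num) l
  induction Q using MvPolynomial.induction_on with
  | C c => simp [pd_const]
  | add p q hp hq =>
    simp only [map_add]
    rw [pd_add (hd p) (hd q), hp, hq, ← Finset.sum_add_distrib]
    exact Finset.sum_congr rfl fun i _ => by ring
  | mul_X p j hp =>
    have hg : DifferentiableAt ℝ (gno η E j) l :=
      (contDiff_gno η E j (m := 1)).differentiable (by norm_num) l
    simp only [map_mul, MvPolynomial.eval_X]
    rw [pd_mul (hd p) hg, hp, Finset.sum_mul]
    simp only [MvPolynomial.pderiv_mul, map_add, map_mul, MvPolynomial.eval_X,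
      MvPolynomial.pderiv_X, add_mul, Finset.sum_add_distrib]
    congr 1
    · exact Finset.sum_congr rfl fun i _ => by ring
    · rw [Finset.sum_eq_single j]
      · simp
      · intro i _ hij; simp [hij.symm]
      · simp

lemma polyJet_eq (Q : MvPolynomial (Fin 3) ℝ) (η : Fin 3 → ℝ) (E : Fin 2 → Fin 3 → ℝ) :
    polyJet Q η E = (eval η Q, fun a => ∑ i, eval η (pderiv i Q) * E a i,
      fun a c => ∑ i, ((∑ j, eval η (pderiv j (pderiv i Q)) * E a j) * E c i
        - eval η (pderiv i Q) * (if a = c then η i else 0))) := by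
  have hη : (fun k => gno η E k 0) = η := funext (gno_zero η E)
  rw [polyJet]
  refine Prod.ext rfl (Prod.ext ?_ ?_)
  · funext a
    simp only [pd_eval_gno, hη, pd_gno_zero]
  · funext a c
    simp only [pd_eval_gno]
    have hd : ∀ q : MvPolynomial (Fin 3) ℝ,
        DifferentiableAt ℝ (fun l => eval (fun k => gno η E k l) q) 0 := fun q =>
      (EFChart.contDiff_eval_gno (m := 1)).differentiable (by norm_num) _
    have hg : ∀ i, DifferentiableAt ℝ (fun l => pd c (gno η E i) l) 0 := fun i =>
      (contDiff_pd (m := 1) (contDiff_gno η E i)).differentiable (by norm_num) _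
    rw [pd_sum _ fun i _ => (hd _).fun_mul (hg i)]
    refine Finset.sum_congr rfl fun i _ => ?_
    rw [pd_mul (hd _) (hg i), pd_pd_gno_zero, pd_eval_gno, pd_gno_zero]
    simp only [hη, pd_gno_zero]
    split_ifs <;> ring

/-- Euler's identity for homogeneous polynomials. -/
lemma sum_mul_eval_pderiv {P : MvPolynomial (Fin 3) ℝ} {l : ℕ} (hP : P.IsHomogeneous l)
    (x : Fin 3 → ℝ) : ∑ i, x i * eval x (pderiv i P) = l * eval x P := by
  have := congrArg (eval x) hP.sum_X_mul_pderiv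
  simpa using this

/-- The Laplacian of a spherical harmonic on the unit sphere. -/
lemma trace_polyJet (hE : IsFrame η E) {P : MvPolynomial (Fin 3) ℝ} {l : ℕ} (hl : 1 ≤ l)
    (hP : P.IsHomogeneous l) (hΔ : ∑ i, pderiv i (pderiv i P) = 0) (a₀ : ℝ) :
    (polyJet (MvPolynomial.C a₀ + P) η E).2.2 0 0 + (polyJet (MvPolynomial.C a₀ + P) η E).2.2 1 1
      = -((l * (l + 1)) * ((polyJet (MvPolynomial.C a₀ + P) η E).1 - a₀)) := by
  have h1 := sum_mul_eval_pderiv hP η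
  have h2 : ∀ i, ∑ j, η j * eval η (pderiv j (pderiv i P)) = (l - 1) * eval η (pderiv i P) := by
    intro i
    -- The derivative is homogeneous of degree l - 1 in truncated subtraction; 1 ≤ l makes the cast
    -- equal to the real number l - 1.
    rw [sum_mul_eval_pderiv hP.pderiv]
    push_cast [Nat.cast_sub hl]; ring
  have h3 : ∑ i, eval η (pderiv i (pderiv i P)) = 0 := by
    have := congrArg (eval η) hΔ
    simpa using this
  have h4 : ∀ i j, E 0 j * E 0 i + E 1 j * E 1 i = (if i = j then 1 else 0) - η i * η j := by
    intro i j
    have := hE.complete i j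
    rw [Fin.sum_univ_two] at this
    linarith
  -- The tangential trace of the Euclidean Hessian is the vanishing Laplacian minus the second
  -- radial derivative l(l-1)P. The curvature of the sphere adds -2 times the radial derivative lP,
  -- in total -l(l+1)P.
  have h5 : ∑ i, ∑ j, eval η (pderiv j (pderiv i P)) * (E 0 j * E 0 i + E 1 j * E 1 i)
      = -(l * (l - 1) * eval η P) := by
    have h6 : ∀ i, ∑ j, eval η (pderiv j (pderiv i P)) * (E 0 j * E 0 i + E 1 j * E 1 i)
        = eval η (pderiv i (pderiv i P)) - (l - 1) * (η i * eval η (pderiv i P)) := by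
      intro i
      simp only [h4, mul_sub, mul_ite, mul_one, mul_zero, Finset.sum_sub_distrib,
        Finset.sum_ite_eq, Finset.mem_univ, if_true]
      rw [show (l - 1) * (η i * eval η (pderiv i P))
        = η i * ((l - 1) * eval η (pderiv i P)) by ring, ← h2, Finset.mul_sum]
      congr 1
      exact Finset.sum_congr rfl fun j _ => by ring
    simp only [h6, Finset.sum_sub_distrib, ← Finset.mul_sum, h3, h1]
    ring
  rw [polyJet_eq]
  simp only [map_add, MvPolynomial.pderiv_C, zero_add, MvPolynomial.eval_C, if_true]
  rw [← Finset.sum_add_distrib]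
  have h7 : ∀ i, ((∑ j, eval η (pderiv j (pderiv i P)) * E 0 j) * E 0 i - eval η (pderiv i P) * η i
        + ((∑ j, eval η (pderiv j (pderiv i P)) * E 1 j) * E 1 i - eval η (pderiv i P) * η i))
      = ∑ j, eval η (pderiv j (pderiv i P)) * (E 0 j * E 0 i + E 1 j * E 1 i)
        - 2 * (η i * eval η (pderiv i P)) := by
    intro i
    simp only [Finset.sum_mul, mul_add, Finset.sum_add_distrib]
    simp only [← mul_assoc]; ring
  simp only [h7, Finset.sum_sub_distrib, ← Finset.mul_sum, h1, h5]
  ring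

end PolyJet

/-- The set of orthonormal frames. -/
def frames : Set ((Fin 3 → ℝ) × (Fin 2 → Fin 3 → ℝ)) := {F | IsFrame F.1 F.2}

lemma abs_le_one_of_sum_mul_self {x : Fin 3 → ℝ} (hx : ∑ i, x i * x i = 1) (i : Fin 3) :
    |x i| ≤ 1 := by
  have h1 : x i * x i ≤ ∑ i, x i * x i :=
    Finset.single_le_sum (fun j _ => mul_self_nonneg (x j)) (Finset.mem_univ i)
  rw [hx] at h1
  exact abs_le_one_iff_mul_self_le_one.2 h1

/-- A frame contains its base point η, so compactness here gives uniformity over all points of the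
sphere and all frames at them. -/
lemma isCompact_frames : IsCompact frames := by
  refine (isCompact_closedBall 0 1).of_isClosed_subset ?_ ?_
  · have : frames = {F | ∑ i, F.1 i * F.1 i = 1} ∩ ((⋂ a, {F | ∑ i, F.2 a i * F.1 i = 0}) ∩
        ⋂ a, ⋂ c, {F | ∑ i, F.2 a i * F.2 c i = if a = c then 1 else 0}) := by
      ext F
      simp only [frames, Set.mem_inter_iff, Set.mem_iInter, Set.mem_ofPred_eq]
      exact ⟨fun h => ⟨h.1, h.2, h.3⟩, fun h => ⟨h.1, h.2.1, h.2.2⟩⟩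
    rw [this]
    refine (isClosed_eq (by fun_prop) continuous_const).inter
      ((isClosed_iInter fun a => isClosed_eq (by fun_prop) continuous_const).inter
        (isClosed_iInter fun a => isClosed_iInter fun c =>
          isClosed_eq (by fun_prop) continuous_const))
  · rintro ⟨η, E⟩ hE
    have hE' : IsFrame η E := hE
    rw [mem_closedBall_zero_iff, Prod.norm_def, max_le_iff]
    refine ⟨(pi_norm_le_iff_of_nonneg zero_le_one).2 fun i => ?_,
      (pi_norm_le_iff_of_nonneg zero_le_one).2 fun a =>
        (pi_norm_le_iff_of_nonneg zero_le_one).2 fun i => ?_⟩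
    · exact abs_le_one_of_sum_mul_self hE'.unit i
    · exact abs_le_one_of_sum_mul_self (by simpa using hE'.ortho a a) i

/-- The unit sphere of `ℝ³`. -/
def unitSphere : Set (Fin 3 → ℝ) := {x | ∑ i, x i ^ 2 = 1}

lemma isCompact_unitSphere : IsCompact unitSphere := by
  refine (isCompact_closedBall 0 1).of_isClosed_subset
    (isClosed_eq (by fun_prop) continuous_const) fun x hx => ?_
  have hx' : ∑ i, x i * x i = 1 := by
    rw [← show ∑ i, x i ^ 2 = 1 from hx]
    exact Finset.sum_congr rfl fun i _ => (pow_two _).symm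
  rw [mem_closedBall_zero_iff]
  exact (pi_norm_le_iff_of_nonneg zero_le_one).2 fun i => abs_le_one_of_sum_mul_self hx' i

lemma continuous_polyJet (Q : MvPolynomial (Fin 3) ℝ) :
    Continuous fun F : (Fin 3 → ℝ) × (Fin 2 → Fin 3 → ℝ) => polyJet Q F.1 F.2 := by
  have hc : ∀ q : MvPolynomial (Fin 3) ℝ, Continuous fun x => MvPolynomial.eval x q := fun q =>
    (contDiff_eval q (m := 0)).continuous
  have hc' : ∀ q : MvPolynomial (Fin 3) ℝ, Continuous
      fun F : (Fin 3 → ℝ) × (Fin 2 → Fin 3 → ℝ) => MvPolynomial.eval F.1 q := fun q =>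
    (hc q).comp continuous_fst
  simp only [polyJet_eq]
  refine (hc' _).prodMk ((continuous_pi fun a => ?_).prodMk
    (continuous_pi fun a => continuous_pi fun c => ?_))
  · exact continuous_finsetSum _ fun i _ => (hc' _).mul (by fun_prop)
  · refine continuous_finsetSum _ fun i _ => Continuous.sub
      ((continuous_finsetSum _ fun j _ => (hc' _).mul (by fun_prop)).mul (by fun_prop))
      ((hc' _).mul ?_)
    split_ifs <;> fun_prop

/-- The linear form `⟨d, x⟩`. -/
def linPoly (d : Fin 3 → ℝ) : MvPolynomial (Fin 3) ℝ :=
  ∑ i, MvPolynomial.C (d i) * MvPolynomial.X i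

lemma eval_linPoly (d x : Fin 3 → ℝ) : MvPolynomial.eval x (linPoly d) = ∑ i, d i * x i := by
  simp [linPoly]

lemma pderiv_linPoly (d : Fin 3 → ℝ) (i : Fin 3) :
    MvPolynomial.pderiv i (linPoly d) = MvPolynomial.C (d i) := by
  rw [linPoly, map_sum, Finset.sum_eq_single i]
  · simp
  · intro j _ hij
    simp [MvPolynomial.pderiv_X_of_ne hij]
  · simp

lemma isHomogeneous_linPoly (d : Fin 3 → ℝ) : (linPoly d).IsHomogeneous 1 :=
  MvPolynomial.IsHomogeneous.sum _ _ _ fun i _ => by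
    simpa using (MvPolynomial.isHomogeneous_C (Fin 3) (d i)).mul (MvPolynomial.isHomogeneous_X ℝ i)

lemma harmonic_linPoly (d : Fin 3 → ℝ) :
    ∑ i, MvPolynomial.pderiv i (MvPolynomial.pderiv i (linPoly d)) = 0 := by
  simp [pderiv_linPoly]

/-- Joint continuity in the linear form as well, so that deformations tilted in all directions form
one compact family of jets. -/
lemma continuous_polyJet_lin (a₀ : ℝ) :
    Continuous fun F : (Fin 3 → ℝ) × (Fin 3 → ℝ) × (Fin 2 → Fin 3 → ℝ) =>
      polyJet (MvPolynomial.C a₀ + linPoly F.1) F.2.1 F.2.2 := by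
  simp only [polyJet_eq, map_add, MvPolynomial.pderiv_C, zero_add, pderiv_linPoly,
    MvPolynomial.eval_C, eval_linPoly, map_zero, zero_mul, Finset.sum_const_zero, zero_sub]
  refine Continuous.prodMk (by fun_prop) ((continuous_pi fun a => by fun_prop).prodMk
    (continuous_pi fun a => continuous_pi fun c => continuous_finsetSum _ fun i _ => ?_))
  split_ifs <;> fun_prop

end SphTrapped
end


noncomputable section

open Filter Topology

namespace SphTrapped

namespace EFChart

variable {V : Type*} [TopologicalSpace V] [ChartedSpace (Fin 4 → ℝ) V]
  [IsManifold 𝓘(ℝ, Fin 4 → ℝ) ∞ V] [MulAction SO3 V] {M : Spacetime V} (C : EFChart M)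
  {p : V} {ν L a₀ s : ℝ}

/-! ### Deformations of the round spheres of the apparent horizon -/

/-- The `r`-component of the normal vector `n`. -/
def nR (p : V) : ℝ := Real.exp (-C.β (vr (C.e p)))

lemma nR_mul_fB : C.nR p * C.fB (vr (C.e p)) = 1 := by
  rw [nR, fB, ← Real.exp_add]; simp

/-- `ν` is tuned to the eigenvalue `L` of the spherical Laplacian. -/
def Tuned (p : V) (L ν : ℝ) : Prop :=
  ν * Dv C.fA (vr (C.e p)) + C.nR p * Dr C.fA (vr (C.e p))
    = -(C.fB (vr (C.e p)) / (vr (C.e p)).2 * L)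

/-- The condition is a linear equation for ν with leading coefficient A_v, which is nonzero by
`Gkk_eq`. -/
lemma exists_tuned (hp : p ∈ C.AH) (hG : C.Gkk p ≠ 0) (L : ℝ) : ∃ ν, C.Tuned p L ν := by
  have hv : Dv C.fA (vr (C.e p)) ≠ 0 := by
    intro h; exact hG (by rw [C.Gkk_eq hp, h]; simp)
  refine ⟨(-(C.fB (vr (C.e p)) / (vr (C.e p)).2 * L) - C.nR p * Dr C.fA (vr (C.e p)))
    / Dv C.fA (vr (C.e p)), ?_⟩
  rw [Tuned, div_mul_cancel₀ _ hv]; ring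

/-- All profiles of the deformation along a spherical harmonic are good. -/
lemma eventually_good_harmonic (hp : p ∈ C.AH) {l : ℕ} (hl : 1 ≤ l)
    (hν : C.Tuned p (l * (l + 1)) ν) (hs : 0 < s * -a₀) {P : MvPolynomial (Fin 3) ℝ}
    (hP : P.IsHomogeneous l)
    (hΔ : ∑ i, MvPolynomial.pderiv i (MvPolynomial.pderiv i P) = 0) :
    ∀ᶠ ε in 𝓝[>] (0 : ℝ), ∀ η E, IsFrame η E →
      Profile.Good C.fA C.fB ν (C.nR p) C.D s
        (profile C.fA ν (C.nR p) ε (vr (C.e p)) (polyJet (MvPolynomial.C a₀ + P) η E)) := by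
  have hL : (0 : ℝ) < l * (l + 1) := by positivity
  have h := eventually_forall_good C.isEFMetric (C.vr_mem hp.1) (C.fA_eq_zero_of_mem_AH hp)
    (a₀ := a₀) (s := s) hν C.nR_mul_fB (by nlinarith [mul_pos hL hs])
    (isCompact_frames.image (continuous_polyJet (MvPolynomial.C a₀ + P))) ?_
  · filter_upwards [h] with ε hε η E hE using hε _ ⟨(η, E), hE, rfl⟩
  · rintro τ ⟨F, hF, rfl⟩
    exact trace_polyJet hF hl hP hΔ a₀

/-- Close to the horizon the deformation is inside the horizon where `f` is positive,
and outside where `f` is negative. -/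
lemma eventually_fA_sign (hp : p ∈ C.AH) (hL : 0 < L) (hν : C.Tuned p L ν) (t : ℝ) :
    ∀ᶠ ε in 𝓝[>] (0 : ℝ),
      (0 < t → C.fA ((vr (C.e p)).1 + ε * ν * t, (vr (C.e p)).2 + ε * C.nR p * t) < 0) ∧
      (t < 0 → 0 < C.fA ((vr (C.e p)).1 + ε * ν * t, (vr (C.e p)).2 + ε * C.nR p * t)) := by
  have hd := C.vr_mem hp.1
  have hB := C.isEFMetric.B_pos _ hd
  have hr := C.pos_D _ hd
  have h1 := tendsto_comp_deform_div (ν := ν) (b := C.nR p)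
    (C.isEFMetric.differentiableAt C.isEFMetric.contDiffOn_A hd) (C.fA_eq_zero_of_mem_AH hp) t
  -- After tuning, A/ε tends to -(B/r)Lt, whose sign is opposite to that of t.
  rw [show _ = _ from hν] at h1
  have h2 : Tendsto (fun ε : ℝ => (ε, t)) (𝓝[>] 0) (𝓝[{q : ℝ × ℝ | 0 < q.1}] (0, t)) := by
    refine tendsto_nhdsWithin_iff.2 ⟨?_, eventually_mem_nhdsWithin⟩
    have : Continuous (fun ε : ℝ => (ε, t)) := by fun_prop
    exact (this.tendsto' 0 _ rfl).mono_left nhdsWithin_le_nhds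
  have h3 := h1.comp h2
  have hc : 0 < C.fB (vr (C.e p)) / (vr (C.e p)).2 * L := mul_pos (div_pos hB hr) hL
  rcases lt_trichotomy t 0 with ht | ht | ht
  · filter_upwards [h3.eventually (lt_mem_nhds (a := 0) (by nlinarith)), self_mem_nhdsWithin]
      with ε h4 hε
    refine ⟨fun h => absurd h ht.not_gt, fun _ => ?_⟩
    exact (div_pos_iff_of_pos_right hε).1 h4
  · exact Eventually.of_forall fun _ => ⟨fun h => absurd ht h.ne', fun h => absurd ht h.ne⟩
  · have hlim : -(C.fB (vr (C.e p)) / (vr (C.e p)).2 * L) * t < 0 := by nlinarith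
    filter_upwards [h3.eventually (gt_mem_nhds hlim), self_mem_nhdsWithin]
      with ε h4 hε
    refine ⟨fun _ => ?_, fun h => absurd h ht.not_gt⟩
    by_contra hcon
    exact absurd h4 (not_lt.2 (div_nonneg (not_lt.1 hcon) (le_of_lt hε)))

lemma fA_neg_iff {z : ℝ × ℝ} (hz : 0 < z.2) : C.fA z < 0 ↔ z.2 < 2 * C.m z := by
  rw [fA, ← neg_pos, ← mul_neg, mul_pos_iff_of_pos_left (Real.exp_pos _), neg_pos, sub_neg, one_lt_div hz]

lemma fA_pos_iff {z : ℝ × ℝ} (hz : 0 < z.2) : 0 < C.fA z ↔ 2 * C.m z < z.2 := by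
  rw [fA, mul_pos_iff_of_pos_left (Real.exp_pos _), sub_pos, div_lt_one hz]

lemma crossesAH_surf {z : ℝ × ℝ} {b ε : ℝ} {f : (Fin 3 → ℝ) → ℝ}
    (hD : ∀ x : Fin 3 → ℝ, ∑ i, x i ^ 2 = 1 → (z.1 + ε * ν * f x, z.2 + ε * b * f x) ∈ C.D)
    (h₁ : ∃ x : Fin 3 → ℝ, ∑ i, x i ^ 2 = 1 ∧ C.fA (z.1 + ε * ν * f x, z.2 + ε * b * f x) < 0)
    (h₂ : ∃ x : Fin 3 → ℝ, ∑ i, x i ^ 2 = 1 ∧ 0 < C.fA (z.1 + ε * ν * f x, z.2 + ε * b * f x)) :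
    C.CrossesAH (C.surf z ν b ε f) := by
  have key : ∀ x : Fin 3 → ℝ, ∑ i, x i ^ 2 = 1 →
      C.e.symm (surfPt z ν b ε f x) ∈ C.surf z ν b ε f ∧
      vr (C.e (C.e.symm (surfPt z ν b ε f x))) = (z.1 + ε * ν * f x, z.2 + ε * b * f x) := by
    intro x hx
    have ht := C.surfPt_mem_target hD hx
    have e := C.e.right_inv ht
    exact ⟨⟨C.e.map_target ht, x, hx, e⟩, by rw [e, vr_surfPt hx (C.pos_D _ (hD x hx)).le]⟩
  constructor
  · obtain ⟨x, hx, h⟩ := h₁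
    obtain ⟨k1, k2⟩ := key x hx
    rw [← k2, C.fA_neg_iff (C.pos_D _ (C.vr_mem k1.1))] at h
    exact ⟨_, k1, k1.1, h⟩
  · obtain ⟨x, hx, h⟩ := h₂
    obtain ⟨k1, k2⟩ := key x hx
    rw [← k2, C.fA_pos_iff (C.pos_D _ (C.vr_mem k1.1))] at h
    exact ⟨_, k1, k1.1, h⟩

lemma isClosedFTrapped_surf {z : ℝ × ℝ} {b ε : ℝ} {Q : MvPolynomial (Fin 3) ℝ} (hε : 0 < ε)
    (hgood : ∀ η E, IsFrame η E →
      Profile.Good C.fA C.fB ν b C.D (-1) (profile C.fA ν b ε z (polyJet Q η E))) :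
    M.IsClosedFTrapped (C.surf z ν b ε (fun x => MvPolynomial.eval x Q)) :=
  C.isClosedSurfaceWith_surf hε hgood _ fun _ hy _ hu0 hu =>
    C.isFutureTimelike hy (by linarith) hu0

lemma isClosedUntrapped_surf {z : ℝ × ℝ} {b ε : ℝ} {Q : MvPolynomial (Fin 3) ℝ} (hε : 0 < ε)
    (hgood : ∀ η E, IsFrame η E →
      Profile.Good C.fA C.fB ν b C.D 1 (profile C.fA ν b ε z (polyJet Q η E))) :
    M.IsClosedUntrapped (C.surf z ν b ε (fun x => MvPolynomial.eval x Q)) :=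
  C.isClosedSurfaceWith_surf hε hgood _ fun y hy u _ hu => by
    rw [Spacetime.IsSpacelike, C.metric_eq y hy]; linarith

/-- The deformations of the round sphere through `p` are contained in any neighbourhood of it. -/
lemma eventually_surf_subset (hp : p ∈ C.AH) {U : Set V} (hU : IsOpen U)
    (hpU : C.roundSphere p ⊆ U) {b : ℝ} {f : (Fin 3 → ℝ) → ℝ} (hf : Continuous f) :
    ∀ᶠ ε in 𝓝[>] (0 : ℝ), C.surf (vr (C.e p)) ν b ε f ⊆ U := by
  have hd := C.vr_mem hp.1
  have hr := C.pos_D _ hd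
  have hopen : IsOpen (C.e.target ∩ C.e.symm ⁻¹' U) := C.e.isOpen_inter_preimage_symm hU
  have hcont : Continuous fun q : ℝ × (Fin 3 → ℝ) => surfPt (vr (C.e p)) ν b q.1 f q.2 := by
    refine continuous_pi fun μ => ?_
    refine Fin.cases ?_ (fun i => ?_) μ
    · change Continuous fun q : ℝ × (Fin 3 → ℝ) => (vr (C.e p)).1 + q.1 * ν * f q.2
      fun_prop
    · change Continuous fun q : ℝ × (Fin 3 → ℝ) => ((vr (C.e p)).2 + q.1 * b * f q.2) * q.2 i
      fun_prop
  have h := isCompact_unitSphere.eventually_forall_of_forall_eventually (x₀ := (0 : ℝ))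
    (P := fun ε x => surfPt (vr (C.e p)) ν b ε f x ∈ C.e.target ∩ C.e.symm ⁻¹' U) ?_
  · filter_upwards [mem_nhdsWithin_of_mem_nhds h] with ε hε q hq
    obtain ⟨h1, x, hx, hqx⟩ := hq
    have h2 := (hε x hx).2
    rw [Set.mem_preimage, ← hqx, C.e.left_inv h1] at h2
    exact h2
  -- At ε = 0 the surface is the round sphere itself, which lies in U; compactness of the unit
  -- sphere then gives one bound on ε.
  · intro x hx
    have hD : ∀ x : Fin 3 → ℝ, ∑ i, x i ^ 2 = 1 →
        ((vr (C.e p)).1 + 0 * ν * f x, (vr (C.e p)).2 + 0 * b * f x) ∈ C.D := by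
      intro x _; simpa using hd
    have ht := C.surfPt_mem_target hD hx
    have e := C.e.right_inv ht
    refine hcont.continuousAt.eventually (hopen.mem_nhds ⟨ht, hpU ?_⟩)
    have h3 : vr (C.e (C.e.symm (surfPt (vr (C.e p)) ν b 0 f x))) = vr (C.e p) := by
      rw [e, vr_surfPt hx (C.pos_D _ (hD x hx)).le]; simp
    exact ⟨C.e.map_target ht, congrArg Prod.fst h3, congrArg Prod.snd h3⟩

/-- A point whose unit vector is a zero of `f` lies on the deformed sphere based at it. -/
lemma mem_surf_of_eq_zero {q : V} (hq : q ∈ C.e.source) {b ε : ℝ} {f : (Fin 3 → ℝ) → ℝ}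
    (hf : f (nrm (C.e q)) = 0) : q ∈ C.surf (vr (C.e q)) ν b ε f := by
  have hr : 0 < radius (C.e q) := C.pos_D _ (C.vr_mem hq)
  refine ⟨hq, nrm (C.e q), ?_, ?_⟩
  · rw [← sum_nrm_sq hr]
    exact Finset.sum_congr rfl fun i _ => pow_two _
  · funext μ
    refine Fin.cases ?_ (fun i => ?_) μ
    · change _ = (vr (C.e q)).1 + ε * ν * f (nrm (C.e q))
      rw [hf]; simp [vr]
    · change _ = ((vr (C.e q)).2 + ε * b * f (nrm (C.e q))) * nrm (C.e q) i
      rw [hf, nrm, vr]; field_simp; simp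

/-- The deformed spheres in the coordinates `(v, x)`. -/
lemma deformedSphere_eq_surf (hp : p ∈ C.AH) {N ε : ℝ} {f f' : (Fin 3 → ℝ) → ℝ}
    (hf : ∀ x : Fin 3 → ℝ, ∑ i, x i ^ 2 = 1 → f x = f' x) :
    C.deformedSphere p N f ε = C.surf (vr (C.e p)) (N / 2) (C.nR p) ε f' := by
  have hr : 0 < radius (C.e p) := C.pos_D _ (C.vr_mem hp.1)
  have key : ∀ x : Fin 3 → ℝ, ∑ i, x i ^ 2 = 1 →
      C.onSphere p x + (ε * f x) • C.normalVec N (C.onSphere p x)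
        = surfPt (vr (C.e p)) (N / 2) (C.nR p) ε f' x := by
    intro x hx
    have hs : ∀ i : Fin 3, C.onSphere p x i.succ = radius (C.e p) * x i := fun _ => rfl
    have hrad : radius (C.onSphere p x) = radius (C.e p) := by
      rw [radius]
      simp only [hs, mul_pow, ← Finset.mul_sum, hx, mul_one]
      exact Real.sqrt_sq hr.le
    have h0 : C.onSphere p x 0 = C.e p 0 := rfl
    -- On the horizon 1 - 2m/r = 0, so k = ∂_v and n = e^{-β}∂_r + (N/2)∂_v with constant
    -- coefficients on the sphere. The displacement thus changes v by εfN/2 and r by εf e^{-β}.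
    have hH : 2 * C.m (C.e p 0, radius (C.e p)) / radius (C.e p) = 1 := by
      rw [← show radius (C.e p) = 2 * C.m (C.e p 0, radius (C.e p)) from hp.2]
      exact div_self hr.ne'
    have hd0 : dR (C.onSphere p x) 0 = 0 := rfl
    have hds : ∀ i : Fin 3, dR (C.onSphere p x) i.succ = x i := by
      intro i
      change C.onSphere p x i.succ / radius (C.onSphere p x) = x i
      rw [hs, hrad]; field_simp
    have hv0 : dV 0 = 1 := rfl
    have hvs : ∀ i : Fin 3, dV i.succ = 0 := fun _ => rfl
    funext μ
    simp only [Pi.add_apply, Pi.smul_apply, normalVec, ell, k, Pi.neg_apply, hrad, h0, hH,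
      smul_eq_mul, ← hf x hx, surfPt, nR]
    refine Fin.cases ?_ (fun i => ?_) μ
    · rw [hd0, hv0, h0, Fin.cons_zero]; simp [vr]; ring
    · rw [hds, hvs, hs, Fin.cons_succ]; simp [vr]; ring
  ext q
  refine and_congr_right fun _ => exists_congr fun x => and_congr_right fun hx => ?_
  rw [key x hx]

/-- Near a point of the horizon with `G(k, k) ≠ 0` every point lies on a closed trapped surface. -/
lemma eventually_mem_trappedRegion (hp : p ∈ C.AH) (hG : C.Gkk p ≠ 0) :
    ∀ᶠ q in 𝓝 p, q ∈ M.trappedRegion := by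
  obtain ⟨ν, hν⟩ := C.exists_tuned hp hG ((1 : ℕ) * ((1 : ℕ) + 1))
  -- The jets of 1 + d·x for all unit vectors d at all frames. For d = -n the function vanishes at
  -- n; its being nonnegative does no harm, since no crossing of AH is required here. The first
  -- eigenvalue is L = 2.
  set K : Set Jet := (fun F : (Fin 3 → ℝ) × (Fin 3 → ℝ) × (Fin 2 → Fin 3 → ℝ) =>
      polyJet (MvPolynomial.C 1 + linPoly F.1) F.2.1 F.2.2) '' ((-unitSphere) ×ˢ frames) with hKdef
  have hK : IsCompact K :=
    ((isCompact_unitSphere.neg).prod isCompact_frames).image (continuous_polyJet_lin 1)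
  have h1 := eventually_forall_good C.isEFMetric (C.vr_mem hp.1) (C.fA_eq_zero_of_mem_AH hp)
    (a₀ := 1) (s := -1) hν C.nR_mul_fB (by norm_num) hK (by
      rintro τ ⟨F, hF, rfl⟩
      exact trace_polyJet hF.2 le_rfl (isHomogeneous_linPoly _) (harmonic_linPoly _) 1)
  -- The order matters: ε is fixed at the base sphere of p, uniformly in d, and only then does the
  -- base move to nearby spheres, which need not lie on the horizon.
  obtain ⟨ε, hε, hε0⟩ := (h1.and self_mem_nhdsWithin).exists
  have hε0 : 0 < ε := hε0
  have h2 := eventually_good_base C.isEFMetric hε0 hK hε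
  have h3 : ContinuousAt (fun q => vr (C.e q)) p :=
    continuous_vr.continuousAt.comp (C.e.continuousAt hp.1)
  filter_upwards [h3.eventually h2, C.e.open_source.mem_nhds hp.1] with q hq hqs
  have hr : 0 < radius (C.e q) := C.pos_D _ (C.vr_mem hqs)
  have hu : ∑ i, nrm (C.e q) i ^ 2 = 1 := by
    rw [← sum_nrm_sq hr]
    exact Finset.sum_congr rfl fun i _ => pow_two _
  refine ⟨_, C.isClosedFTrapped_surf hε0 (z := vr (C.e q))
    (Q := MvPolynomial.C 1 + linPoly (-nrm (C.e q))) (fun η E hE => hq _ ⟨(-nrm (C.e q), η, E),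
      ⟨by rw [Set.mem_neg, neg_neg]; exact hu, hE⟩, rfl⟩), C.mem_surf_of_eq_zero hqs ?_⟩
  simp only [map_add, MvPolynomial.eval_C, eval_linPoly, Pi.neg_apply, neg_mul,
    Finset.sum_neg_distrib, sum_nrm_sq hr]
  norm_num

/-- The deformation along a spherical harmonic, with all its properties. -/
lemma eventually_deform [T2Space V] (hp : p ∈ C.AH) {l : ℕ} (hl : 1 ≤ l)
    (hν : C.Tuned p (l * (l + 1)) ν) (ha₀ : a₀ ≠ 0) {P : MvPolynomial (Fin 3) ℝ}
    (hP : P.IsHomogeneous l)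
    (hΔ : ∑ i, MvPolynomial.pderiv i (MvPolynomial.pderiv i P) = 0)
    (h₁ : ∃ x : Fin 3 → ℝ, ∑ i, x i ^ 2 = 1 ∧ 0 < a₀ + MvPolynomial.eval x P)
    (h₂ : ∃ x : Fin 3 → ℝ, ∑ i, x i ^ 2 = 1 ∧ a₀ + MvPolynomial.eval x P < 0) :
    ∀ᶠ ε in 𝓝[>] (0 : ℝ),
      IsTopSphere (C.surf (vr (C.e p)) ν (C.nR p) ε fun x => a₀ + MvPolynomial.eval x P) ∧
      C.CrossesAH (C.surf (vr (C.e p)) ν (C.nR p) ε fun x => a₀ + MvPolynomial.eval x P) ∧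
      (0 < a₀ → M.IsClosedFTrapped
        (C.surf (vr (C.e p)) ν (C.nR p) ε fun x => a₀ + MvPolynomial.eval x P)) ∧
      (a₀ < 0 → M.IsClosedUntrapped
        (C.surf (vr (C.e p)) ν (C.nR p) ε fun x => a₀ + MvPolynomial.eval x P)) := by
  have hL : (0 : ℝ) < l * (l + 1) := by positivity
  obtain ⟨x₁, hx₁, hf₁⟩ := h₁
  obtain ⟨x₂, hx₂, hf₂⟩ := h₂
  have hQ : ∀ x, a₀ + MvPolynomial.eval x P = MvPolynomial.eval x (MvPolynomial.C a₀ + P) := by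
    intro x; simp
  -- The sign s = -a₀ treats both cases together: the condition becomes a₀² > 0, and the sign of a₀
  -- decides at the end between timelike and spacelike H.
  have hg := C.eventually_good_harmonic hp hl hν (a₀ := a₀) (s := -a₀)
    (mul_self_pos.2 (neg_ne_zero.2 ha₀)) hP hΔ
  filter_upwards [hg, C.eventually_fA_sign hp hL hν (a₀ + MvPolynomial.eval x₁ P),
    C.eventually_fA_sign hp hL hν (a₀ + MvPolynomial.eval x₂ P), self_mem_nhdsWithin]
    with ε hgood hs₁ hs₂ hε
  have hD := C.deform_mem_of_good hgood
  refine ⟨?_, ?_, fun ha => ?_, fun ha => ?_⟩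
  · simp only [hQ]
    exact C.isTopSphere_surf (contDiff_eval _ (m := 0)).continuous hD
  · simp only [← hQ] at hD
    exact C.crossesAH_surf hD ⟨x₁, hx₁, hs₁.1 hf₁⟩ ⟨x₂, hx₂, hs₂.2 hf₂⟩
  · simp only [hQ]
    refine C.isClosedFTrapped_surf hε fun η E hE => ?_
    obtain ⟨g1, g2, g3, g4, g5⟩ := hgood η E hE
    exact ⟨g1, g2, g3, g4, by nlinarith⟩
  · simp only [hQ]
    refine C.isClosedUntrapped_surf hε fun η E hE => ?_
    obtain ⟨g1, g2, g3, g4, g5⟩ := hgood η E hE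
    exact ⟨g1, g2, g3, g4, by nlinarith⟩

/-- Deformed spheres through a point of the horizon, close to the round sphere. -/
lemma exists_surf_near [T2Space V] (hp : p ∈ C.AH) (hG : C.Gkk p ≠ 0) {U : Set V}
    (hU : IsOpen U) (hpU : C.roundSphere p ⊆ U) (ha₀ : a₀ ≠ 0) :
    ∃ S ⊆ U, p ∈ S ∧ IsTopSphere S ∧ C.CrossesAH S ∧ (0 < a₀ → M.IsClosedFTrapped S) ∧
      (a₀ < 0 → M.IsClosedUntrapped S) := by
  obtain ⟨ν, hν⟩ := C.exists_tuned hp hG ((1 : ℕ) * ((1 : ℕ) + 1))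
  have hr : 0 < radius (C.e p) := C.pos_D _ (C.vr_mem hp.1)
  set n := nrm (C.e p) with hn
  have hunit : ∑ i, n i ^ 2 = 1 := by
    rw [← sum_nrm_sq hr]
    exact Finset.sum_congr rfl fun i _ => pow_two _
  obtain ⟨E, hE⟩ := exists_isFrame hunit
  have en := hE.unit
  have ee := hE.ortho 0 0
  have eo := hE.orth 0
  simp only [if_true] at ee
  -- the deformation function `a₀ (1 - n · x - E₀ · x)` vanishes at `n`
  have hval : ∀ s t : ℝ, a₀ + MvPolynomial.eval (fun i => s * n i + t * E 0 i)
      (linPoly fun i => -a₀ * (n i + E 0 i)) = a₀ * (1 - s - t) := by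
    intro s t
    rw [eval_linPoly]
    simp only [Fin.sum_univ_three] at en ee eo ⊢
    linear_combination (-a₀ * s) * en - a₀ * t * ee - a₀ * (s + t) * eo
  have hsq : ∀ s t : ℝ, ∑ i, (s * n i + t * E 0 i) ^ 2 = s ^ 2 + t ^ 2 := by
    intro s t
    simp only [Fin.sum_univ_three] at en ee eo ⊢
    linear_combination s ^ 2 * en + t ^ 2 * ee + 2 * s * t * eo
  -- The function a₀(1 - n·x) would have only one sign; subtracting a₀E₀·x keeps the zero at n and
  -- gives the linear part norm √2|a₀| > |a₀|, so both signs occur. At x = -n the value is 2a₀.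
  have hin : ∃ x : Fin 3 → ℝ, ∑ i, x i ^ 2 = 1 ∧ a₀ + MvPolynomial.eval x
      (linPoly fun i => -a₀ * (n i + E 0 i)) = a₀ * 2 :=
    ⟨_, by rw [hsq (-1) 0]; norm_num, by rw [hval]; norm_num⟩
  -- The 3-4-5 triangle gives a unit vector with s + t = 7/5 > 1, hence the opposite sign.
  have hout : ∃ x : Fin 3 → ℝ, ∑ i, x i ^ 2 = 1 ∧ a₀ + MvPolynomial.eval x
      (linPoly fun i => -a₀ * (n i + E 0 i)) = a₀ * (-(2 / 5)) :=
    ⟨_, by rw [hsq (3 / 5) (4 / 5)]; norm_num, by rw [hval]; norm_num⟩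
  obtain ⟨x₁, hx₁, e₁⟩ := hin
  obtain ⟨x₂, hx₂, e₂⟩ := hout
  have hpos : ∃ x : Fin 3 → ℝ, ∑ i, x i ^ 2 = 1 ∧ 0 < a₀ + MvPolynomial.eval x
      (linPoly fun i => -a₀ * (n i + E 0 i)) := by
    rcases lt_or_gt_of_ne ha₀ with h | h
    · exact ⟨x₂, hx₂, by rw [e₂]; nlinarith⟩
    · exact ⟨x₁, hx₁, by rw [e₁]; nlinarith⟩
  have hneg : ∃ x : Fin 3 → ℝ, ∑ i, x i ^ 2 = 1 ∧ a₀ + MvPolynomial.eval x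
      (linPoly fun i => -a₀ * (n i + E 0 i)) < 0 := by
    rcases lt_or_gt_of_ne ha₀ with h | h
    · exact ⟨x₁, hx₁, by rw [e₁]; nlinarith⟩
    · exact ⟨x₂, hx₂, by rw [e₂]; nlinarith⟩
  have hcont : Continuous fun x => a₀ + MvPolynomial.eval x
      (linPoly fun i => -a₀ * (n i + E 0 i)) :=
    continuous_const.add (contDiff_eval _ (m := 0)).continuous
  obtain ⟨ε, ⟨h1, h2, h3, h4⟩, h5⟩ := ((C.eventually_deform hp le_rfl hν ha₀
    (isHomogeneous_linPoly _) (harmonic_linPoly _) hpos hneg).and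
    (C.eventually_surf_subset (ν := ν) (b := C.nR p) hp hU hpU hcont)).exists
  refine ⟨_, h5, C.mem_surf_of_eq_zero hp.1 ?_, h1, h2, h3, h4⟩
  have := hval 1 0
  simpa using this

end EFChart

end SphTrapped
end


/-! ### The three statements combined. -/

theorem mainTheorem1 {V : Type*} [TopologicalSpace V] [T2Space V]
    [ChartedSpace (Fin 4 → ℝ) V] [IsManifold 𝓘(ℝ, Fin 4 → ℝ) ∞ V] [MulAction SO3 V]
    (M : Spacetime V) (hM : M.IsSphericallySymmetric) (C : EFChart M) :
    -- near and through every point of `AH` with `G(k,k) > 0` there are closed f-trapped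
    -- topological spheres, and closed untrapped ones, that cross `AH`
    (∀ p ∈ C.AH, 0 < C.Gkk p → ∀ U : Set V, IsOpen U → C.roundSphere p ⊆ U →
      (∃ S ⊆ U, p ∈ S ∧ IsTopSphere S ∧ M.IsClosedFTrapped S ∧ C.CrossesAH S) ∧
      (∃ S ⊆ U, p ∈ S ∧ IsTopSphere S ∧ M.IsClosedUntrapped S ∧ C.CrossesAH S)) ∧
    -- they arise by deforming the round sphere along `(a₀ + Y) n`, with a spherical harmonic `Y`
    (∀ p ∈ C.AH, 0 < C.Gkk p → ∀ l : ℕ, 1 ≤ l → ∃ N : ℝ,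
      ∀ (Y : (Fin 3 → ℝ) → ℝ) (a₀ : ℝ), IsSphericalHarmonic l Y → a₀ ≠ 0 →
      (∃ x : Fin 3 → ℝ, ∑ i, x i ^ 2 = 1 ∧ 0 < a₀ + Y x) →
      (∃ x : Fin 3 → ℝ, ∑ i, x i ^ 2 = 1 ∧ a₀ + Y x < 0) →
      ∃ ε₀ > 0, ∀ ε : ℝ, 0 < ε → ε < ε₀ →
        IsTopSphere (C.deformedSphere p N (fun x => a₀ + Y x) ε) ∧
        C.CrossesAH (C.deformedSphere p N (fun x => a₀ + Y x) ε) ∧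
        (0 < a₀ → M.IsClosedFTrapped (C.deformedSphere p N (fun x => a₀ + Y x) ε)) ∧
        (a₀ < 0 → M.IsClosedUntrapped (C.deformedSphere p N (fun x => a₀ + Y x) ε))) ∧
    -- the part of `AH` that is not an isolated horizon lies in `𝒯` and does not meet `ℬ`
    C.AH \ C.AHiso ⊆ M.trappedRegion ∧
    Disjoint (C.AH \ C.AHiso) M.trappedBoundary := by
  refine ⟨fun p hp hG U hU hpU => ⟨?_, ?_⟩, fun p hp hG l hl => ?_, fun p hp => ?_, ?_⟩
  · obtain ⟨S, h1, h2, h3, h4, h5, -⟩ := C.exists_surf_near hp hG.ne' hU hpU one_ne_zero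
    exact ⟨S, h1, h2, h3, h5 one_pos, h4⟩
  · obtain ⟨S, h1, h2, h3, h4, -, h5⟩ :=
      C.exists_surf_near hp hG.ne' hU hpU (neg_ne_zero.2 one_ne_zero)
    exact ⟨S, h1, h2, h3, h5 (neg_neg_of_pos one_pos), h4⟩
  · obtain ⟨ν, hν⟩ := C.exists_tuned hp hG.ne' (l * (l + 1))
    -- The v-component of n is N/2 on the horizon, so N = 2ν. It depends on p and l only.
    refine ⟨2 * ν, fun Y a₀ hY ha₀ hpos hneg => ?_⟩
    obtain ⟨P, hP, hΔ, hYP⟩ := hY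
    have hf : ∀ x : Fin 3 → ℝ, ∑ i, x i ^ 2 = 1 → a₀ + Y x = a₀ + MvPolynomial.eval x P :=
      fun x hx => by rw [hYP x hx]
    have h := C.eventually_deform hp hl hν ha₀ hP hΔ
      (by obtain ⟨x, hx, hx'⟩ := hpos; exact ⟨x, hx, hf x hx ▸ hx'⟩)
      (by obtain ⟨x, hx, hx'⟩ := hneg; exact ⟨x, hx, hf x hx ▸ hx'⟩)
    obtain ⟨ε₀, hε₀, h'⟩ := mem_nhdsGT_iff_exists_Ioo_subset.1 h
    refine ⟨ε₀, hε₀, fun ε h1 h2 => ?_⟩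
    rw [C.deformedSphere_eq_surf hp hf, mul_div_cancel_left₀ ν two_ne_zero]
    exact h' ⟨h1, h2⟩
  · exact (C.eventually_mem_trappedRegion hp.1 fun h => hp.2 ⟨hp.1, h⟩).self_of_nhds
  -- A frontier point is not an interior point, whereas 𝒯 contains a whole neighbourhood of p.
  · refine Set.disjoint_left.2 fun p hp hb => hb.2 ?_
    exact mem_interior_iff_mem_nhds.2
      (C.eventually_mem_trappedRegion hp.1 fun h => hp.2 ⟨hp.1, h⟩)
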